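/- Let $k$ be an algebraically closed field of characteristic $p>0$, let $e\ge 1$ be an integer prime to $p$, and let $l\ge 2$ be an integer dividing both $e$ and $p+1$. Let $C\subset\mathbb P^2_k$ be the smooth plane curve $$Y^{pe}-YX^{pe-1}=Z^{pe-1}X ,$$ let $\infty=[0:0:1]\in C$, $z=Z/X$ and $D=e(pe-3)\cdot\infty$, so that $\mathrm{div}(dz)=pD$. Let $F_C$ be the Frobenius morphism of $C$ and $\mathcal B^1=d\,F_{C*}\mathcal O_C$. The sequence $$0\to\mathcal O_C(-D)\to F_{C*}\mathcal O_C(-pD)\xrightarrow{\ d\ }\mathcal B^1(-D)\to 0$$ maps $dz\in H^0(C,\mathcal B^1(-D))$ to a class $\xi\in H^1(C,\mathcal O_C(-D))$ in the kernel of $F_C^*\colon H^1(C,\mathcal O_C(-D))\to H^1(C,\mathcal O_C(-pD))$. Let $$0\to\mathcal O_C(-D)\to\mathcal E\xrightarrow{\ \alpha\ }\mathcal O_C\to 0$$ be the extension with class $\xi$, let $g\colon P=\mathbb P(\mathcal E)=\mathrm{Proj}\,\mathrm{Sym}\,\mathcal E\to C$, let $T$ be a divisor with $\mathcal O_P(T)\cong\mathcal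 O_P(1)$, and let $F\subset P$ be the section of $g$ corresponding to $\alpha$. The pull-back of the extension under $F_C$ splits; let $G'\subset\mathbb P(F_C^*\mathcal E)$ be the section corresponding to the splitting map $F_C^*\mathcal E\twoheadrightarrow\mathcal O_C(-pD)$, and let $G\subset P$ be its pull-back under the relative Frobenius morphism $P\to\mathbb P(F_C^*\mathcal E)$. Then $G+F\sim lM$ with $M=\frac{p+1}{l}\,T+g^*\bigl(\tfrac1l D\bigr)$; let $\pi\colon S\to P$ be the corresponding cyclic cover of degree $l$ branched along $G+F$, which is a smooth projective surface. If $\{l,p\}\neq\{2,3\}$, then the canonical divisor $K_S$ is ample. If $\{l,p\}=\{2,3\}$, then $S$ has Kodaira dimension $\kappa(S)=1$. -/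

import Mathlib

open CategoryTheory Limits AlgebraicGeometry

universe u

/-! ## Gluing affine schemes whose coordinate rings lie in one ring -/

namespace Atlas

variable {k Q : Type u} [CommRing k] [CommRing Q] [Algebra k Q] {ι : Type}

/-- The coordinate ring of the intersection of the affine charts `Spec (A i)`, `i ∈ I`: the subalgebra
of `Q` generated by the `A i`. -/
def overlap (A : ι → Subalgebra k Q) (I : Finset ι) : Subalgebra k Q := ⨆ i ∈ I, A i

lemma overlap_mono (A : ι → Subalgebra k Q) {I J : Finset ι} (h : I ⊆ J) :
    overlap A I ≤ overlap A J := biSup_mono fun _ hi => h hi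

lemma le_overlap (A : ι → Subalgebra k Q) {I : Finset ι} {i : ι} (h : i ∈ I) :
    A i ≤ overlap A I := le_biSup A h

/-- The subalgebras `A i ⊆ Q` are the coordinate rings of the members of a separated affine atlas:
`A i ⊔ A j` is obtained from `A i` by inverting one element `g` (with inverse `h`), so that
`Spec (A i ⊔ A j)` is a basic open subset of `Spec (A i)` and of `Spec (A j)`. -/
def IsAtlas (A : ι → Subalgebra k Q) : Prop :=
  ∀ i j, ∃ g ∈ A i, ∃ h ∈ A i ⊔ A j, g * h = 1 ∧ A j ≤ A i ⊔ Algebra.adjoin k {h}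

/-- The elements of `Q` that a power of `g` multiplies into `A`. -/
def bounded (A : Subalgebra k Q) (g : Q) (hg : g ∈ A) : Subalgebra k Q where
  carrier := {b | ∃ n : ℕ, g ^ n * b ∈ A}
  mul_mem' := by
    rintro a b ⟨n, hn⟩ ⟨m, hm⟩
    refine ⟨n + m, ?_⟩
    have : g ^ (n + m) * (a * b) = (g ^ n * a) * (g ^ m * b) := by ring
    rw [this]; exact mul_mem hn hm
  add_mem' := by
    rintro a b ⟨n, hn⟩ ⟨m, hm⟩
    refine ⟨n + m, ?_⟩
    have : g ^ (n + m) * (a + b) = g ^ m * (g ^ n * a) + g ^ n * (g ^ m * b) := by ring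
    rw [this]
    exact add_mem (mul_mem (pow_mem hg _) hn) (mul_mem (pow_mem hg _) hm)
  algebraMap_mem' r := ⟨0, by simp⟩

lemma mem_bounded {A : Subalgebra k Q} {g : Q} {hg : g ∈ A} {b : Q} :
    b ∈ bounded A g hg ↔ ∃ n : ℕ, g ^ n * b ∈ A := Iff.rfl

/-- `Spec B ⟶ Spec A` for subalgebras `A ≤ B`. -/
noncomputable def specIncl {A B : Subalgebra k Q} (h : A ≤ B) :
    Spec (.of B) ⟶ Spec (.of A) :=
  Spec.map (CommRingCat.ofHom (Subalgebra.inclusion h).toRingHom)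

section
variable {A B : Subalgebra k Q} {g h : Q}

lemma isLocalization_away (hAB : A ≤ B) (hg : g ∈ A) (hh : h ∈ B)
    (hgh : g * h = 1) (hB : B ≤ bounded A g hg) :
    let _ := (Subalgebra.inclusion hAB).toRingHom.toAlgebra
    IsLocalization.Away (⟨g, hg⟩ : A) B := by
  let _ := (Subalgebra.inclusion hAB).toRingHom.toAlgebra
  have hmap : ∀ a : A, (algebraMap A B a : Q) = a := fun _ => rfl
  refine IsLocalization.Away.mk _ ?_ ?_ ?_
  · refine IsUnit.of_mul_eq_one ⟨h, hh⟩ (Subtype.ext ?_)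
    rw [MulMemClass.coe_mul, hmap]
    exact hgh
  · rintro ⟨b, hb⟩
    obtain ⟨n, hn⟩ := hB hb
    refine ⟨n, ⟨_, hn⟩, Subtype.ext ?_⟩
    rw [MulMemClass.coe_mul, SubmonoidClass.coe_pow, hmap, hmap]
    exact mul_comm _ _
  · intro a b hab
    refine ⟨0, ?_⟩
    have : (a : Q) = b := by rw [← hmap a, ← hmap b, hab]
    rw [Subtype.ext this]

lemma isOpenImmersion_specIncl (hAB : A ≤ B) (hg : g ∈ A) (hh : h ∈ B)
    (hgh : g * h = 1) (hB : B ≤ bounded A g hg) : IsOpenImmersion (specIncl hAB) := by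
  let _ := (Subalgebra.inclusion hAB).toRingHom.toAlgebra
  have := isLocalization_away hAB hg hh hgh hB
  exact IsOpenImmersion.of_isLocalization (⟨g, hg⟩ : A)

lemma specIncl_refl (A : Subalgebra k Q) : specIncl (le_refl A) = 𝟙 _ := by
  have : CommRingCat.ofHom (Subalgebra.inclusion (le_refl A)).toRingHom = 𝟙 (CommRingCat.of A) := by
    ext x
    simp
  rw [specIncl, this, Spec.map_id]

lemma specIncl_comp {A B C : Subalgebra k Q} (h : A ≤ B) (h' : B ≤ C) :
    specIncl h' ≫ specIncl h = specIncl (h.trans h') := by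
  rw [specIncl, specIncl, specIncl, ← Spec.map_comp, ← CommRingCat.ofHom_comp]
  congr 2

lemma mem_range_specIncl (hAB : A ≤ B) (hg : g ∈ A) (hh : h ∈ B)
    (hgh : g * h = 1) (hB : B ≤ bounded A g hg) (x : Spec (.of A)) :
    x ∈ Set.range (specIncl hAB) ↔ x ∈ PrimeSpectrum.basicOpen (⟨g, hg⟩ : A) := by
  let _ := (Subalgebra.inclusion hAB).toRingHom.toAlgebra
  have := isLocalization_away hAB hg hh hgh hB
  have := PrimeSpectrum.localization_away_comap_range B (⟨g, hg⟩ : A)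
  exact Set.ext_iff.mp this x
end

lemma IsAtlas.localization {A : ι → Subalgebra k Q} (hA : IsAtlas A) (i : ι) :
    ∃ g : ι → Q, ∃ hg : ∀ j, g j ∈ A i, ∀ K I : Finset ι, ∀ hi : i ∈ K, K ⊆ I →
      (∃ h ∈ overlap A I, (∏ j ∈ I, g j) * h = 1) ∧
      overlap A I ≤ bounded (overlap A K) (∏ j ∈ I, g j)
        (prod_mem fun j _ => le_overlap A hi (hg j)) := by
  classical
  choose g hg h hh hgh hle using hA i
  refine ⟨g, hg, fun K I hi hKI => ⟨⟨∏ j ∈ I, h j, ?_, ?_⟩, ?_⟩⟩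
  · refine prod_mem fun j hj => ?_
    exact (sup_le (le_overlap A (hKI hi)) (le_overlap A hj)) (hh j)
  · rw [← Finset.prod_mul_distrib]; exact Finset.prod_eq_one fun j _ => hgh j
  · refine iSup₂_le fun j hj => (hle j).trans (sup_le ?_ ?_)
    · intro a ha
      exact mem_bounded.mpr ⟨0, by simpa using le_overlap A hi ha⟩
    · rw [Algebra.adjoin_le_iff, Set.singleton_subset_iff]
      refine mem_bounded.mpr ⟨1, ?_⟩
      rw [pow_one, ← Finset.mul_prod_erase I g hj, mul_comm, ← mul_assoc, mul_comm (h j), hgh,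
        one_mul]
      exact prod_mem fun j _ => le_overlap A hi (hg j)

/-- The non-empty finite sets of charts, ordered by reverse inclusion. -/
abbrev Index (ι : Type) : Type := {I : Finset ι // I.Nonempty}ᵒᵈ

/-- The diagram of all finite intersections of charts. -/
noncomputable def diagram (A : ι → Subalgebra k Q) : Index ι ⥤ Scheme.{u} where
  obj I := Spec (.of (overlap A I.ofDual.1))
  map f := specIncl (overlap_mono A (leOfHom f))
  map_id _ := specIncl_refl _
  map_comp _ _ := (specIncl_comp _ _).symm

lemma IsAtlas.isOpenImmersion {A : ι → Subalgebra k Q} (hA : IsAtlas A) {I J : Index ι}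
    (f : I ⟶ J) : IsOpenImmersion ((diagram A).map f) := by
  obtain ⟨i, hi⟩ := J.ofDual.2
  obtain ⟨g, hg, H⟩ := hA.localization i
  obtain ⟨⟨h, hh, hgh⟩, hb⟩ := H J.ofDual.1 I.ofDual.1 hi (leOfHom f)
  exact isOpenImmersion_specIncl _ _ hh hgh hb

lemma mem_basicOpen_prod (A : ι → Subalgebra k Q) {K : Finset ι} {i : ι} (hi : i ∈ K) (g : ι → Q)
    (hg : ∀ j, g j ∈ A i) {I : Finset ι} (h : (∏ j ∈ I, g j) ∈ overlap A K)
    (x : PrimeSpectrum (overlap A K)) :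
    x ∈ PrimeSpectrum.basicOpen (⟨∏ j ∈ I, g j, h⟩ : overlap A K) ↔
      ∀ j ∈ I, (⟨g j, le_overlap A hi (hg j)⟩ : overlap A K) ∉ x.asIdeal := by
  have : (⟨∏ j ∈ I, g j, h⟩ : overlap A K) = ∏ j ∈ I, ⟨g j, le_overlap A hi (hg j)⟩ :=
    Subtype.ext (by simp)
  rw [PrimeSpectrum.mem_basicOpen, this, x.isPrime.prod_mem_iff]
  push Not
  rfl

lemma IsAtlas.isLocallyDirected {A : ι → Subalgebra k Q} (hA : IsAtlas A) :
    (diagram A ⋙ Scheme.forget).IsLocallyDirected where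
  cond {I J K} fI fJ xI xJ hx := by
    classical
    obtain ⟨i, hi⟩ := K.ofDual.2
    obtain ⟨g, hg, H⟩ := hA.localization i
    have hKI : K.ofDual.1 ⊆ I.ofDual.1 := leOfHom fI
    have hKJ : K.ofDual.1 ⊆ J.ofDual.1 := leOfHom fJ
    let L : Index ι := OrderDual.toDual ⟨I.ofDual.1 ∪ J.ofDual.1, I.ofDual.2.inl⟩
    have hIL : I.ofDual.1 ⊆ L.ofDual.1 := Finset.subset_union_left
    have hJL : J.ofDual.1 ⊆ L.ofDual.1 := Finset.subset_union_right
    let fLI : L ⟶ I := homOfLE (show L ≤ I from hIL)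
    let fLJ : L ⟶ J := homOfLE (show L ≤ J from hJL)
    obtain ⟨⟨h1, hh1, hgh1⟩, hb1⟩ := H _ _ hi hKI
    obtain ⟨⟨h2, hh2, hgh2⟩, hb2⟩ := H _ _ hi hKJ
    obtain ⟨⟨h3, hh3, hgh3⟩, hb3⟩ := H _ _ hi (hKI.trans hIL)
    have e1 := (mem_range_specIncl (overlap_mono A hKI) _ hh1 hgh1 hb1
      ((diagram A).map fI xI)).mp ⟨xI, rfl⟩
    have e2 := (mem_range_specIncl (overlap_mono A hKJ) _ hh2 hgh2 hb2
      ((diagram A).map fI xI)).mp ⟨xJ, hx.symm⟩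
    have e3 : (diagram A).map fI xI ∈ Set.range (specIncl (overlap_mono A (hKI.trans hIL))) := by
      refine (mem_range_specIncl _ _ hh3 hgh3 hb3 _).mpr ?_
      refine (mem_basicOpen_prod A hi g hg _ _).mpr fun j hj => ?_
      rcases Finset.mem_union.mp hj with hj | hj
      · exact (mem_basicOpen_prod A hi g hg _ _).mp e1 j hj
      · exact (mem_basicOpen_prod A hi g hg _ _).mp e2 j hj
    obtain ⟨x, hx3⟩ := e3
    have := hA.isOpenImmersion fI
    have := hA.isOpenImmersion fJ
    have hcomp : ∀ {M N : Index ι} (f : M ⟶ N) (f' : N ⟶ K) (hM : K.ofDual.1 ⊆ M.ofDual.1)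
        (y : (diagram A).obj M),
        (diagram A).map f' ((diagram A).map f y) = specIncl (overlap_mono A hM) y := by
      intro M N f f' hM y
      rw [← Scheme.Hom.comp_apply, ← Functor.map_comp]
      rfl
    refine ⟨L, fLI, fLJ, x, ?_, ?_⟩
    · apply ((diagram A).map fI).injective
      exact (hcomp fLI fI (hKI.trans hIL) x).trans hx3
    · apply ((diagram A).map fJ).injective
      exact ((hcomp fLJ fJ (hKJ.trans hJL) x).trans hx3).trans hx

/-- The scheme obtained by gluing the charts `Spec (A i)` along the `Spec (A i ⊔ A j)`. -/
noncomputable def glue (A : ι → Subalgebra k Q) (hA : IsAtlas A) : Scheme.{u} :=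
  haveI := fun {I J : Index ι} (f : I ⟶ J) => hA.isOpenImmersion f
  haveI := hA.isLocallyDirected
  colimit (diagram A)

lemma specIncl_algebraMap {A B : Subalgebra k Q} (h : A ≤ B) :
    specIncl h ≫ Spec.map (CommRingCat.ofHom (algebraMap k A)) =
      Spec.map (CommRingCat.ofHom (algebraMap k B)) := by
  rw [specIncl, ← Spec.map_comp, ← CommRingCat.ofHom_comp]
  congr 2

/-- The structure morphism of a glued scheme. -/
noncomputable def toBase (A : ι → Subalgebra k Q) (hA : IsAtlas A) :
    glue A hA ⟶ Spec (.of k) :=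
  haveI := fun {I J : Index ι} (f : I ⟶ J) => hA.isOpenImmersion f
  haveI := hA.isLocallyDirected
  colimit.desc (diagram A)
    { pt := Spec (.of k)
      ι := { app I := Spec.map (CommRingCat.ofHom (algebraMap k (overlap A I.ofDual.1)))
             naturality _ _ _ := (specIncl_algebraMap _).trans (Category.comp_id _).symm } }

/-- The morphism of glued schemes given by inclusions of the coordinate rings of the charts. -/
noncomputable def glueMap {A B : ι → Subalgebra k Q} (hA : IsAtlas A) (hB : IsAtlas B)
    (h : ∀ i, A i ≤ B i) : glue B hB ⟶ glue A hA :=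
  haveI := fun {I J : Index ι} (f : I ⟶ J) => hA.isOpenImmersion f
  haveI := hA.isLocallyDirected
  haveI := fun {I J : Index ι} (f : I ⟶ J) => hB.isOpenImmersion f
  haveI := hB.isLocallyDirected
  colimMap
    { app I := specIncl (iSup₂_mono fun i _ => h i : overlap A I.ofDual.1 ≤ overlap B I.ofDual.1)
      naturality _ _ _ := (specIncl_comp _ _).trans (specIncl_comp _ _).symm }

lemma IsAtlas.map {Q' : Type u} [CommRing Q'] [Algebra k Q'] {A : ι → Subalgebra k Q}
    (hA : IsAtlas A) (φ : Q →ₐ[k] Q') : IsAtlas fun i => (A i).map φ := by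
  intro i j
  obtain ⟨g, hg, h, hh, hgh, hle⟩ := hA i j
  refine ⟨φ g, ⟨g, hg, rfl⟩, φ h, ?_, ?_, ?_⟩
  · rw [← Algebra.map_sup]
    exact ⟨h, hh, rfl⟩
  · rw [← map_mul, hgh, map_one]
  · have := Subalgebra.map_mono (f := φ) hle
    rwa [Algebra.map_sup, AlgHom.map_adjoin, Set.image_singleton] at this

/-! ### Projective line bundles and cyclic covers in charts

A base is given by an atlas `B j` (`j : κ`). A rank two bundle `ℰ` that is trivial on every patch is
given inside a rank two module with basis `e₀`, `f`, dehomogenized by `e₀ = 1`: its frame on the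
patch `j` is `(δ j * e₀, f j)`, where `δ j` and `f j` are units of `Q`. -/

variable {κ : Type}

/-- The member of the frame `(δ j, f j)` of `ℰ` that generates `𝒪(1)` on the chart `a = (j, i)` of
`ℙ(ℰ)`; this chart is the locus over the patch `j` where that member does not vanish. -/
def frameSection (δ f : κ → Qˣ) (a : κ × Bool) : Qˣ := bif a.2 then f a.1 else δ a.1

/-- The coordinate ring of the chart `a = (j, i)` of `ℙ(ℰ) = Proj Sym ℰ`: it is generated over the
patch `j` by the quotients `ℰ / frameSection a`. -/
def projChart (B : κ → Subalgebra k Q) (δ f : κ → Qˣ) (a : κ × Bool) : Subalgebra k Q :=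
  B a.1 ⊔ Algebra.adjoin k
    {((δ a.1 / frameSection δ f a : Qˣ) : Q), ((f a.1 / frameSection δ f a : Qˣ) : Q)}

/-- The chart over `projChart a` of the cover obtained by adjoining the root `s`, which is a section
of a line bundle `M` with local generator `(frameSection a) ^ r * (μ j)⁻¹`. -/
def coverChart (B : κ → Subalgebra k Q) (δ f μ : κ → Qˣ) (s : Q) (r : ℕ) (a : κ × Bool) :
    Subalgebra k Q :=
  projChart B δ f a ⊔ Algebra.adjoin k {s * ((μ a.1 / frameSection δ f a ^ r : Qˣ) : Q)}

lemma IsAtlas.coverChart {B : κ → Subalgebra k Q} (hB : IsAtlas B) {δ f μ : κ → Qˣ}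
    (hδ : ∀ i j, ((δ j / δ i : Qˣ) : Q) ∈ B i ⊔ B j)
    (hμ : ∀ i j, ((μ j / μ i : Qˣ) : Q) ∈ B i ⊔ B j)
    (hf : ∀ i j, ((f j : Q) - f i) * ((δ i)⁻¹ : Qˣ) ∈ B i ⊔ B j) (s : Q) (r : ℕ) :
    IsAtlas (coverChart B δ f μ s r) := by
  set A := Atlas.coverChart B δ f μ s r with hAdef
  have hBA : ∀ a, B a.1 ≤ A a := fun a => le_sup_left.trans le_sup_left
  have hδA : ∀ a, ((δ a.1 / frameSection δ f a : Qˣ) : Q) ∈ A a := fun a =>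
    (le_sup_right.trans le_sup_left : _ ≤ A a) (Algebra.subset_adjoin (by simp))
  have hfA : ∀ a, ((f a.1 / frameSection δ f a : Qˣ) : Q) ∈ A a := fun a =>
    (le_sup_right.trans le_sup_left : _ ≤ A a) (Algebra.subset_adjoin (by simp))
  have hsA : ∀ a, s * ((μ a.1 / frameSection δ f a ^ r : Qˣ) : Q) ∈ A a := fun a =>
    (le_sup_right : _ ≤ A a) (Algebra.subset_adjoin (by simp))
  -- the frames of one patch over another patch
  have key1 : ∀ a b : κ × Bool, ∀ T : Subalgebra k Q, A a ≤ T → B b.1 ≤ T →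
      ((δ b.1 / frameSection δ f a : Qˣ) : Q) ∈ T ∧ ((f b.1 / frameSection δ f a : Qˣ) : Q) ∈ T := by
    intro a b T hT hT'
    have hsup : B a.1 ⊔ B b.1 ≤ T := sup_le ((hBA a).trans hT) hT'
    constructor
    · have : ((δ b.1 / frameSection δ f a : Qˣ) : Q) =
          ((δ b.1 / δ a.1 : Qˣ) : Q) * ((δ a.1 / frameSection δ f a : Qˣ) : Q) := by
        rw [← Units.val_mul, div_mul_div_cancel]
      rw [this]
      exact mul_mem (hsup (hδ _ _)) (hT (hδA a))
    · have : ((f b.1 / frameSection δ f a : Qˣ) : Q) =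
          ((f b.1 : Q) - f a.1) * ((δ a.1)⁻¹ : Qˣ) * ((δ a.1 / frameSection δ f a : Qˣ) : Q) +
            ((f a.1 / frameSection δ f a : Qˣ) : Q) := by
        simp only [div_eq_mul_inv, Units.val_mul]
        linear_combination (-((f b.1 : Q) - f a.1) *
          ((frameSection δ f a)⁻¹ : Qˣ)) * (δ a.1).inv_mul
      rw [this]
      exact add_mem (mul_mem (hsup (hf _ _)) (hT (hδA a))) (hT (hfA a))
  have key2 : ∀ a b : κ × Bool, ∀ T : Subalgebra k Q, A a ≤ T → B b.1 ≤ T →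
      ((frameSection δ f b / frameSection δ f a : Qˣ) : Q) ∈ T := by
    rintro a ⟨j, _ | _⟩ T hT hT'
    · exact (key1 a (j, false) T hT hT').1
    · exact (key1 a (j, true) T hT hT').2
  intro a b
  obtain ⟨g₀, hg₀, h₀, hh₀, hgh₀, hle₀⟩ := hB a.1 b.1
  set ρ : Qˣ := frameSection δ f b / frameSection δ f a with hρ
  have hρmem : (ρ : Q) ∈ A a ⊔ Algebra.adjoin k {h₀} :=
    key2 a b _ le_sup_left (hle₀.trans (sup_le_sup_right (hBA a) _))
  have hbd : A a ⊔ Algebra.adjoin k {h₀} ≤ bounded (A a) g₀ (hBA a hg₀) := by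
    refine sup_le (fun x hx => mem_bounded.mpr ⟨0, by simpa using hx⟩) ?_
    rw [Algebra.adjoin_le_iff, Set.singleton_subset_iff]
    refine mem_bounded.mpr ⟨1, ?_⟩
    rw [pow_one, hgh₀]
    exact one_mem _
  obtain ⟨m, hm⟩ := hbd hρmem
  have hh₀' : h₀ ∈ A a ⊔ A b := sup_le_sup (hBA a) (hBA b) hh₀
  have hpow : ∀ n, g₀ ^ n * h₀ ^ n = 1 := fun n => by rw [← mul_pow, hgh₀, one_pow]
  refine ⟨g₀ * (g₀ ^ m * ρ), mul_mem (hBA a hg₀) hm, h₀ * (h₀ ^ m * (ρ⁻¹ : Qˣ)), ?_, ?_, ?_⟩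
  · refine mul_mem hh₀' (mul_mem (pow_mem hh₀' _) ?_)
    rw [hρ, inv_div]
    exact key2 b a _ le_sup_right ((hBA a).trans le_sup_left)
  · calc g₀ * (g₀ ^ m * ρ) * (h₀ * (h₀ ^ m * (ρ⁻¹ : Qˣ)))
        = (g₀ * h₀) * (g₀ ^ m * h₀ ^ m) * (ρ * (ρ⁻¹ : Qˣ)) := by ring
      _ = 1 := by rw [hgh₀, hpow, Units.mul_inv]; simp
  · set h := h₀ * (h₀ ^ m * ((ρ⁻¹ : Qˣ) : Q)) with hh
    set T := A a ⊔ Algebra.adjoin k {h} with hT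
    have haT : A a ≤ T := le_sup_left
    have hhT : h ∈ T := (le_sup_right : _ ≤ T) (Algebra.subset_adjoin (by simp))
    have hh₀T : h₀ ∈ T := by
      have : h₀ = h * (g₀ ^ m * ρ) := by
        calc h₀ = h₀ * (g₀ ^ m * h₀ ^ m) * (ρ * (ρ⁻¹ : Qˣ)) := by
              rw [hpow, Units.mul_inv]; simp
          _ = h * (g₀ ^ m * ρ) := by rw [hh]; ring
      rw [this]
      exact mul_mem hhT (haT hm)
    have hρT : ((ρ⁻¹ : Qˣ) : Q) ∈ T := by
      have : ((ρ⁻¹ : Qˣ) : Q) = h * (g₀ * g₀ ^ m) := by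
        calc ((ρ⁻¹ : Qˣ) : Q) = (g₀ * h₀) * (g₀ ^ m * h₀ ^ m) * (ρ⁻¹ : Qˣ) := by
              rw [hpow, hgh₀]; simp
          _ = h * (g₀ * g₀ ^ m) := by rw [hh]; ring
      rw [this]
      exact mul_mem hhT (mul_mem (haT (hBA a hg₀)) (pow_mem (haT (hBA a hg₀)) _))
    have hbT : B b.1 ≤ T := hle₀.trans (sup_le ((hBA a).trans haT) (by
      rw [Algebra.adjoin_le_iff, Set.singleton_subset_iff]; exact hh₀T))
    have hsupT : B a.1 ⊔ B b.1 ≤ T := sup_le ((hBA a).trans haT) hbT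
    have hk := key1 a b T haT hbT
    refine sup_le (sup_le hbT ?_) ?_
    · rw [Algebra.adjoin_le_iff]
      rintro x (rfl | rfl)
      · have : δ b.1 / frameSection δ f b = δ b.1 / frameSection δ f a * ρ⁻¹ := by
          rw [hρ, inv_div, div_mul_div_cancel]
        rw [this, Units.val_mul]
        exact mul_mem hk.1 hρT
      · have : f b.1 / frameSection δ f b = f b.1 / frameSection δ f a * ρ⁻¹ := by
          rw [hρ, inv_div, div_mul_div_cancel]
        rw [this, Units.val_mul]
        exact mul_mem hk.2 hρT
    · rw [Algebra.adjoin_le_iff, Set.singleton_subset_iff]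
      have : μ b.1 / frameSection δ f b ^ r =
          μ a.1 / frameSection δ f a ^ r * (μ b.1 / μ a.1) * (ρ⁻¹) ^ r := by
        rw [hρ, inv_div, div_pow, mul_comm (μ a.1 / _), div_mul_div_cancel, div_mul_div_cancel]
      rw [this, Units.val_mul, Units.val_mul, ← mul_assoc, ← mul_assoc, Units.val_pow_eq_pow_val]
      exact mul_mem (mul_mem (haT (hsA a)) (hsupT (hμ _ _))) (pow_mem hρT _)

lemma IsAtlas.projChart {B : κ → Subalgebra k Q} (hB : IsAtlas B) {δ f : κ → Qˣ}
    (hδ : ∀ i j, ((δ j / δ i : Qˣ) : Q) ∈ B i ⊔ B j)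
    (hf : ∀ i j, ((f j : Q) - f i) * ((δ i)⁻¹ : Qˣ) ∈ B i ⊔ B j) :
    IsAtlas (projChart B δ f) := by
  have h := hB.coverChart (μ := δ) hδ hδ hf 0 0
  have h' : Atlas.coverChart B δ f δ 0 0 = Atlas.projChart B δ f := by
    funext a
    rw [Atlas.coverChart, zero_mul]
    exact sup_eq_left.mpr (Algebra.adjoin_le (by simp))
  rwa [h'] at h

end Atlas

/-! ## The Tango–Raynaud curve, the bundle `ℙ(ℰ)` and its cyclic cover -/

namespace TangoRaynaud
open MvPolynomial

variable (k : Type u) [Field k] (p e : ℕ)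

/-- The affine equation `y ^ (p e) - y = z ^ (p e - 1)`, `y = Y / X`, `z = Z / X`, of the plane curve
`C : Y ^ (p e) - Y X ^ (p e - 1) = Z ^ (p e - 1) X` on `U = C ∩ {X ≠ 0}`. -/
noncomputable def curveIdeal : Ideal (MvPolynomial (Fin 2) k) :=
  Ideal.span {X 0 ^ (p * e) - X 0 - X 1 ^ (p * e - 1)}

/-- The coordinate ring of `U = C ∩ {X ≠ 0}`. -/
def CurveRing : Type u := MvPolynomial (Fin 2) k ⧸ curveIdeal k p e

noncomputable instance : CommRing (CurveRing k p e) :=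
  inferInstanceAs (CommRing (MvPolynomial (Fin 2) k ⧸ curveIdeal k p e))

noncomputable instance : Algebra k (CurveRing k p e) :=
  inferInstanceAs (Algebra k (MvPolynomial (Fin 2) k ⧸ curveIdeal k p e))

/-- The quotient map. -/
noncomputable def toCurveRing : MvPolynomial (Fin 2) k →ₐ[k] CurveRing k p e :=
  Ideal.Quotient.mkₐ k (curveIdeal k p e)

/-- The coordinate `y` on `U`. -/
noncomputable def yAff : CurveRing k p e := toCurveRing k p e (X 0)

/-- The coordinate `z` on `U`. -/
noncomputable def zAff : CurveRing k p e := toCurveRing k p e (X 1)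

/-- The coordinate ring of `U ∩ V`, where `V = C ∩ {Z ≠ 0}`. On `U` the equation
`y (y ^ (p e - 1) - 1) = z ^ (p e - 1)` shows that `z ≠ 0` implies `y ≠ 0`. -/
def PuncturedRing : Type u := Localization.Away (yAff k p e * zAff k p e)

noncomputable instance : CommRing (PuncturedRing k p e) :=
  inferInstanceAs (CommRing (Localization.Away (yAff k p e * zAff k p e)))

noncomputable instance : Algebra (CurveRing k p e) (PuncturedRing k p e) :=
  inferInstanceAs (Algebra _ (Localization.Away (yAff k p e * zAff k p e)))

noncomputable instance : Algebra k (PuncturedRing k p e) :=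
  inferInstanceAs (Algebra k (Localization.Away (yAff k p e * zAff k p e)))

instance : IsScalarTower k (CurveRing k p e) (PuncturedRing k p e) :=
  inferInstanceAs (IsScalarTower k _ (Localization.Away (yAff k p e * zAff k p e)))

instance : IsLocalization.Away (yAff k p e * zAff k p e) (PuncturedRing k p e) :=
  inferInstanceAs (IsLocalization.Away _ (Localization.Away (yAff k p e * zAff k p e)))

lemma curve_eq : yAff k p e ^ (p * e) - yAff k p e = zAff k p e ^ (p * e - 1) := by
  rw [yAff, zAff, ← map_pow, ← map_sub, ← map_pow]
  exact Ideal.Quotient.eq.mpr (Ideal.subset_span rfl)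

lemma isUnit_yz :
    IsUnit (algebraMap (CurveRing k p e) (PuncturedRing k p e) (yAff k p e)) ∧
    IsUnit (algebraMap (CurveRing k p e) (PuncturedRing k p e) (zAff k p e)) := by
  have h := IsLocalization.Away.algebraMap_isUnit (S := PuncturedRing k p e)
    (yAff k p e * zAff k p e)
  rw [map_mul] at h
  exact ⟨isUnit_of_mul_isUnit_left h, isUnit_of_mul_isUnit_right h⟩

/-- `y = Y / X` on `U ∩ V`. -/
noncomputable def y : (PuncturedRing k p e)ˣ := (isUnit_yz k p e).1.unit

/-- `z = Z / X` on `U ∩ V`. -/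
noncomputable def z : (PuncturedRing k p e)ˣ := (isUnit_yz k p e).2.unit

/-- `x = X / Z` on `U ∩ V`. -/
noncomputable def x : (PuncturedRing k p e)ˣ := (z k p e)⁻¹

/-- `t = Y / Z` on `U ∩ V`. On `V`, where `t ^ (p e) - t x ^ (p e - 1) = x`, the function `t` has a
simple zero at `∞ = [0, 0, 1]` and no other zero. -/
noncomputable def t : (PuncturedRing k p e)ˣ := y k p e / z k p e

/-- The two patches `U = C ∩ {X ≠ 0}` and `V = C ∩ {Z ≠ 0}`, which cover `C`; `∞ ∈ V`, `∞ ∉ U`. -/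
inductive Patch : Type
  | U
  | V

/-- The coordinate rings `k[y, z]` of `U` and `k[x, t]` of `V`, inside that of `U ∩ V`. -/
noncomputable def curveChart : Patch → Subalgebra k (PuncturedRing k p e)
  | .U => Algebra.adjoin k {(y k p e : PuncturedRing k p e), (z k p e : PuncturedRing k p e)}
  | .V => Algebra.adjoin k {(x k p e : PuncturedRing k p e), (t k p e : PuncturedRing k p e)}

lemma yz_eq : (y k p e : PuncturedRing k p e) ^ (p * e) - y k p e = z k p e ^ (p * e - 1) := by
  have := congrArg (algebraMap (CurveRing k p e) (PuncturedRing k p e)) (curve_eq k p e)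
  rw [map_sub, map_pow, map_pow] at this
  exact this

lemma zx : (z k p e : PuncturedRing k p e) * x k p e = 1 := by simp [x]

lemma t_eq : (t k p e : PuncturedRing k p e) = y k p e * x k p e := by
  simp [t, x, div_eq_mul_inv]

lemma y_eq : (y k p e : PuncturedRing k p e) = t k p e * z k p e := by
  rw [t, ← Units.val_mul, div_mul_cancel]

lemma isAtlas_curveChart : Atlas.IsAtlas (curveChart k p e) := by
  have hU : ∀ a ∈ ({(y k p e : PuncturedRing k p e), (z k p e : PuncturedRing k p e)} : Set _),
      a ∈ curveChart k p e .U := fun a ha => Algebra.subset_adjoin ha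
  have hV : ∀ a ∈ ({(x k p e : PuncturedRing k p e), (t k p e : PuncturedRing k p e)} : Set _),
      a ∈ curveChart k p e .V := fun a ha => Algebra.subset_adjoin ha
  rintro (_ | _) (_ | _)
  · exact ⟨1, one_mem _, 1, one_mem _, one_mul 1, le_sup_left⟩
  · refine ⟨z k p e, hU _ (by simp), x k p e, (le_sup_right : curveChart k p e .V ≤ _)
      (hV _ (by simp)), zx k p e, ?_⟩
    have hx : (x k p e : PuncturedRing k p e) ∈
        curveChart k p e .U ⊔ Algebra.adjoin k {(x k p e : PuncturedRing k p e)} :=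
      (le_sup_right : Algebra.adjoin k {(x k p e : PuncturedRing k p e)} ≤ _)
        (Algebra.subset_adjoin rfl)
    refine Algebra.adjoin_le ?_
    rintro a (rfl | rfl)
    · exact hx
    · rw [SetLike.mem_coe, t_eq]
      exact mul_mem ((le_sup_left : curveChart k p e .U ≤ _) (hU _ (by simp))) hx
  · refine ⟨x k p e, hV _ (by simp), z k p e, (le_sup_right : curveChart k p e .U ≤ _)
      (hU _ (by simp)), by rw [mul_comm]; exact zx k p e, ?_⟩
    have hx : (z k p e : PuncturedRing k p e) ∈
        curveChart k p e .V ⊔ Algebra.adjoin k {(z k p e : PuncturedRing k p e)} :=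
      (le_sup_right : Algebra.adjoin k {(z k p e : PuncturedRing k p e)} ≤ _)
        (Algebra.subset_adjoin rfl)
    refine Algebra.adjoin_le ?_
    rintro a (rfl | rfl)
    · rw [SetLike.mem_coe, y_eq]
      exact mul_mem ((le_sup_left : curveChart k p e .V ≤ _) (hV _ (by simp))) hx
    · exact hx
  · exact ⟨1, one_mem _, 1, one_mem _, one_mul 1, le_sup_left⟩

lemma curveChart_sup [Fact p.Prime] [NeZero e] :
    curveChart k p e .U ⊔ curveChart k p e .V = ⊤ := by
  have hn : p * e ≠ 0 := mul_ne_zero (Fact.out : p.Prime).ne_zero (NeZero.ne e)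
  have hU : curveChart k p e .U ≤ curveChart k p e .U ⊔ curveChart k p e .V := le_sup_left
  have hV : curveChart k p e .V ≤ curveChart k p e .U ⊔ curveChart k p e .V := le_sup_right
  have hy := hU (Algebra.subset_adjoin (Set.mem_insert _ _))
  have hz := hU (Algebra.subset_adjoin (Set.mem_insert_of_mem _ rfl))
  have hx := hV (Algebra.subset_adjoin (Set.mem_insert _ _))
  have hyinv : (((y k p e)⁻¹ : (PuncturedRing k p e)ˣ) : PuncturedRing k p e) =
      (y k p e ^ (p * e - 1) - 1) * x k p e ^ (p * e - 1) := by
    have h1 := yz_eq k p e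
    have h2 : (z k p e : PuncturedRing k p e) ^ (p * e - 1) * x k p e ^ (p * e - 1) = 1 := by
      rw [← mul_pow, zx, one_pow]
    have h3 : (y k p e : PuncturedRing k p e) ^ (p * e) = y k p e ^ (p * e - 1) * y k p e :=
      (pow_sub_one_mul hn _).symm
    rw [← Units.mul_right_inj (y k p e), Units.mul_inv]
    rw [h3] at h1
    linear_combination -h2 - x k p e ^ (p * e - 1) * h1
  rw [eq_top_iff]
  rintro q -
  obtain ⟨a, ⟨_, m, rfl⟩, rfl⟩ := IsLocalization.exists_mk'_eq (Submonoid.powers (yAff k p e * zAff k p e)) q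
  have ha : algebraMap (CurveRing k p e) (PuncturedRing k p e) a ∈
      curveChart k p e .U ⊔ curveChart k p e .V := by
    obtain ⟨P, rfl⟩ : ∃ P, toCurveRing k p e P = a := Ideal.Quotient.mk_surjective a
    induction P using MvPolynomial.induction_on with
    | C c =>
      rw [← MvPolynomial.algebraMap_eq, AlgHom.commutes, ← IsScalarTower.algebraMap_apply]
      exact Subalgebra.algebraMap_mem _ c
    | add P R hP hR => rw [map_add, map_add]; exact add_mem hP hR
    | mul_X P i hP =>
      rw [map_mul, map_mul]
      refine mul_mem hP ?_
      fin_cases i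
      · exact hy
      · exact hz
  have hinv : IsLocalization.mk' (PuncturedRing k p e) a
      (⟨_, m, rfl⟩ : Submonoid.powers (yAff k p e * zAff k p e)) =
      algebraMap (CurveRing k p e) (PuncturedRing k p e) a *
        (((y k p e)⁻¹ : (PuncturedRing k p e)ˣ) * x k p e) ^ m := by
    rw [IsLocalization.mk'_eq_iff_eq_mul]
    have : algebraMap (CurveRing k p e) (PuncturedRing k p e) ((yAff k p e * zAff k p e) ^ m) =
        ((y k p e : PuncturedRing k p e) * z k p e) ^ m := by
      rw [map_pow, map_mul]; rfl
    change _ = _ * algebraMap (CurveRing k p e) (PuncturedRing k p e) ((yAff k p e * zAff k p e) ^ m)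
    rw [this, mul_assoc, ← mul_pow]
    have h1 : ((((y k p e)⁻¹ : (PuncturedRing k p e)ˣ) : PuncturedRing k p e) * x k p e) *
        ((y k p e : PuncturedRing k p e) * z k p e) = 1 := by
      linear_combination (z k p e : PuncturedRing k p e) * x k p e * (y k p e).inv_mul + zx k p e
    rw [h1, one_pow, mul_one]
  rw [hinv]
  refine mul_mem ha (pow_mem (mul_mem ?_ hx) _)
  rw [hyinv]
  exact mul_mem (sub_mem (pow_mem hy _) (one_mem _)) (pow_mem hx _)

/-- The curve `C`. -/
noncomputable def curve : Scheme.{u} := Atlas.glue (curveChart k p e) (isAtlas_curveChart k p e)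

/-- The generators on `U` and on `V` of the ideal sheaf `𝒪_C(-n ∞)`. -/
noncomputable def idealGen (n : ℕ) : Patch → (PuncturedRing k p e)ˣ
  | .U => 1
  | .V => t k p e ^ n

/-- A Čech representative `c`, for the covering `C = U ∪ V`, of the class `ξ ∈ H¹(C, 𝒪_C(-D))`,
`D = e (p e - 3) ∞`, that `dz ∈ H⁰(C, ℬ¹(-D))` induces through the sequence
`0 ⟶ 𝒪_C(-D) ⟶ F_* 𝒪_C(-p D) ⟶ ℬ¹(-D) ⟶ 0`, in which the first map is the `p`-th power and the
second one is `d`: local lifts `aU ∈ Γ(U, 𝒪_C(-p D))` and `aV ∈ Γ(V, 𝒪_C(-p D))` of `dz`, and `c`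
with `c ^ p = aU - aV`. -/
structure TangoCocycle where
  /-- The cocycle on `U ∩ V`. -/
  c : PuncturedRing k p e
  /-- The lift of `dz` on `U`. -/
  aU : PuncturedRing k p e
  /-- The lift of `dz` on `V`. -/
  aV : PuncturedRing k p e
  aU_mem : aU ∈ curveChart k p e .U
  aV_mem : ∃ b ∈ curveChart k p e .V, aV = t k p e ^ (p * (e * (p * e - 3))) * b
  d_aU : KaehlerDifferential.D k (PuncturedRing k p e) aU =
    KaehlerDifferential.D k (PuncturedRing k p e) (z k p e)
  d_aV : KaehlerDifferential.D k (PuncturedRing k p e) aV =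
    KaehlerDifferential.D k (PuncturedRing k p e) (z k p e)
  c_pow : c ^ p = aU - aV

/-- Such representatives exist: `aU = z`, `c = (z / y) ^ e`. -/
theorem nonempty_tangoCocycle [Fact p.Prime] [CharP k p] (h : 3 ≤ p * e) :
    Nonempty (TangoCocycle k p e) := by
  obtain ⟨n, hn⟩ : ∃ n, p * e = n + 3 := ⟨p * e - 3, by omega⟩
  have key : ∀ (R : Type u) [CommRing R] [Algebra k R] (y z : Rˣ),
      (y : R) ^ (n + 3) - y = z ^ (n + 2) →
      ∃ b ∈ Algebra.adjoin k {((z⁻¹ : Rˣ) : R), ((y / z : Rˣ) : R)},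
        (z : R) - ((z / y : Rˣ) : R) ^ (n + 3) = ((y / z : Rˣ) : R) ^ ((n + 3) * n) * b := by
    intro R _ _ y z h
    set x : R := ((z⁻¹ : Rˣ) : R) with hx
    set t : R := ((y / z : Rˣ) : R) with ht
    set t' : R := ((z / y : Rˣ) : R) with ht'
    have hzx : (z : R) * x = 1 := z.mul_inv
    have htx : t = y * x := by rw [ht, div_eq_mul_inv, Units.val_mul]
    have htt : t * t' = 1 := by rw [ht, ht', ← Units.val_mul, div_mul_div_cancel, div_self', Units.val_one]
    have hxt : t ^ (n + 3) - t * x ^ (n + 2) = x := by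
      have h2 : (z : R) ^ (n + 2) * x ^ (n + 2) = 1 := by rw [← mul_pow, hzx, one_pow]
      rw [htx]
      linear_combination x ^ (n + 3) * h + x * h2
    set u : R := 1 + t * x ^ (n + 1) with hu
    have hxu : x * u = t ^ (n + 3) := by rw [hu]; linear_combination -hxt
    set v : R := (∑ i ∈ Finset.range (n + 3), (-(t * x ^ (n + 1))) ^ i) +
      (-1) ^ (n + 3) * x ^ ((n + 1) * (n + 3) + 1) with hv
    have huv : u * v = 1 := by
      have h3 := mul_neg_geom_sum (-(t * x ^ (n + 1))) (n + 3)
      have h4 : (-(t * x ^ (n + 1))) ^ (n + 3) =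
          (-1) ^ (n + 3) * (x * u) * x ^ ((n + 1) * (n + 3)) := by
        rw [hxu, neg_pow, mul_pow, ← pow_mul]; ring
      rw [h4, sub_neg_eq_add, ← hu] at h3
      rw [hv]
      linear_combination h3
    have hxmem : x ∈ Algebra.adjoin k {x, t} := Algebra.subset_adjoin (by simp)
    have htmem : t ∈ Algebra.adjoin k {x, t} := Algebra.subset_adjoin (by simp)
    have hvmem : v ∈ Algebra.adjoin k {x, t} := by
      refine add_mem (sum_mem fun i _ => pow_mem (neg_mem (mul_mem htmem (pow_mem hxmem _))) _) ?_
      exact mul_mem (pow_mem (neg_mem (one_mem _)) _) (pow_mem hxmem _)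
    refine ⟨t * v ^ (n + 1), mul_mem htmem (pow_mem hvmem _), ?_⟩
    have hxv : x = t ^ (n + 3) * v := by rw [← hxu, mul_assoc, huv, mul_one]
    have htt' : t ^ (n + 3) * t' ^ (n + 3) = 1 := by rw [← mul_pow, htt, one_pow]
    have hz : (z : R) = u * t' ^ (n + 3) := by
      linear_combination -(z : R) * htt' + u * t' ^ (n + 3) * hzx - z * t' ^ (n + 3) * hxu
    have hxp : x ^ (n + 1) = t ^ ((n + 3) * n) * t ^ (n + 3) * v ^ (n + 1) := by
      rw [hxv, mul_pow, ← pow_mul, ← pow_add]; ring_nf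
    rw [hz, hu]
    linear_combination t * t' ^ (n + 3) * hxp + t * t ^ ((n + 3) * n) * v ^ (n + 1) * htt'
  have hyz := yz_eq k p e
  obtain ⟨b, hb, hab⟩ := key (PuncturedRing k p e) (y k p e) (z k p e) (by
    simp only [hn] at hyz
    exact hyz)
  have hcp : (((z k p e / y k p e : (PuncturedRing k p e)ˣ) : PuncturedRing k p e) ^ e) ^ p =
      ((z k p e / y k p e : (PuncturedRing k p e)ˣ) : PuncturedRing k p e) ^ (n + 3) := by
    rw [← pow_mul, mul_comm e p]
    exact congrArg _ hn
  have hexp : p * (e * (p * e - 3)) = (n + 3) * n := by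
    rw [← mul_assoc, hn]; rfl
  refine ⟨⟨((z k p e / y k p e : (PuncturedRing k p e)ˣ) : PuncturedRing k p e) ^ e, z k p e,
    z k p e - (((z k p e / y k p e : (PuncturedRing k p e)ˣ) : PuncturedRing k p e) ^ e) ^ p,
    Algebra.subset_adjoin (by simp), ⟨b, hb, ?_⟩, rfl, ?_, by ring⟩⟩
  · rw [hcp, hab, hexp]; rfl
  · have hp : (p : PuncturedRing k p e) = 0 := by
      rw [← map_natCast (algebraMap k (PuncturedRing k p e)), CharP.cast_eq_zero, map_zero]
    rw [map_sub, Derivation.leibniz_pow, ← Nat.cast_smul_eq_nsmul (PuncturedRing k p e), hp,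
      zero_smul, sub_zero]

variable {k p e} (ξ : TangoCocycle k p e) (l : ℕ)

/-- Let `ℰ` be the extension of `𝒪_C` by `𝒪_C(-D)` with class `ξ`. It has the frames `(e₀, f_U)` on
`U` and `(t ^ n e₀, f_V)` on `V`, where `n = e (p e - 3)`, `e₀` generates `𝒪_C(-D)` on `U`, `f_U` and
`f_V` lift `1 ∈ 𝒪_C`, and `f_U - f_V = c e₀`. The section `F ⊂ ℙ(ℰ)` is `e₀ = 0`. The splitting map
`F_C^* ℰ ⟶ 𝒪_C(-p D)` has kernel generated by `f_U ^ p - aU e₀ ^ p = f_V ^ p - aV e₀ ^ p`, so this is the equation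
of `G`. With `e₀ = 1` and `f_U = w`, the divisor `G + F` of the section
`e₀ (f_U ^ p - aU e₀ ^ p)` of `(p + 1) T + g^* D` gives the cyclic cover `s ^ l = w ^ p - aU`. -/
noncomputable def coverPoly : Polynomial (Polynomial (PuncturedRing k p e)) :=
  .X ^ l - .C (.X ^ p - .C ξ.aU)

/-- The coordinate ring `𝒪(U ∩ V)[w, s] / (s ^ l - (w ^ p - aU))` of the part of the cover that lies
over `U ∩ V` and outside `F`. -/
def AffineCoverRing : Type u := AdjoinRoot (coverPoly ξ l)

noncomputable instance : CommRing (AffineCoverRing ξ l) :=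
  inferInstanceAs (CommRing (AdjoinRoot (coverPoly ξ l)))

noncomputable instance : Algebra k (AffineCoverRing ξ l) :=
  inferInstanceAs (Algebra k (AdjoinRoot (coverPoly ξ l)))

/-- The inclusion of `𝒪(U ∩ V)[w]`. -/
noncomputable def polyToAffineCover : Polynomial (PuncturedRing k p e) →ₐ[k] AffineCoverRing ξ l :=
  IsScalarTower.toAlgHom k (Polynomial (PuncturedRing k p e)) (AdjoinRoot (coverPoly ξ l))

/-- The root `s`. -/
noncomputable def sAff : AffineCoverRing ξ l := AdjoinRoot.root (coverPoly ξ l)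

/-- `f_U = w` and `f_V = w - c`. -/
noncomputable def fAff : Patch → AffineCoverRing ξ l
  | .U => polyToAffineCover ξ l .X
  | .V => polyToAffineCover ξ l (.X - .C ξ.c)

/-- The coordinate ring of the intersection of the four charts of the cover: the loci over `U` and
over `V` where one of the two members of the frame of `ℰ` does not vanish. -/
def CoverRing : Type u := Localization.Away (fAff ξ l .U * fAff ξ l .V)

noncomputable instance : CommRing (CoverRing ξ l) :=
  inferInstanceAs (CommRing (Localization.Away (fAff ξ l .U * fAff ξ l .V)))

noncomputable instance : Algebra (AffineCoverRing ξ l) (CoverRing ξ l) :=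
  inferInstanceAs (Algebra _ (Localization.Away (fAff ξ l .U * fAff ξ l .V)))

noncomputable instance : Algebra k (CoverRing ξ l) :=
  inferInstanceAs (Algebra k (Localization.Away (fAff ξ l .U * fAff ξ l .V)))

instance : IsScalarTower k (AffineCoverRing ξ l) (CoverRing ξ l) :=
  inferInstanceAs (IsScalarTower k _ (Localization.Away (fAff ξ l .U * fAff ξ l .V)))

instance : IsLocalization.Away (fAff ξ l .U * fAff ξ l .V) (CoverRing ξ l) :=
  inferInstanceAs (IsLocalization.Away _ (Localization.Away (fAff ξ l .U * fAff ξ l .V)))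

/-- The inclusion of `𝒪(U ∩ V)[w]`. -/
noncomputable def polyToCover : Polynomial (PuncturedRing k p e) →ₐ[k] CoverRing ξ l :=
  (IsScalarTower.toAlgHom k (AffineCoverRing ξ l) (CoverRing ξ l)).comp (polyToAffineCover ξ l)

/-- The inclusion of `𝒪(U ∩ V)`. -/
noncomputable def toCover : PuncturedRing k p e →ₐ[k] CoverRing ξ l :=
  (polyToCover ξ l).comp (IsScalarTower.toAlgHom k _ (Polynomial (PuncturedRing k p e)))

lemma isUnit_fAff (j : Patch) :
    IsUnit (algebraMap (AffineCoverRing ξ l) (CoverRing ξ l) (fAff ξ l j)) := by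
  have h := IsLocalization.Away.algebraMap_isUnit (S := CoverRing ξ l)
    (fAff ξ l .U * fAff ξ l .V)
  rw [map_mul] at h
  rcases j with _ | _
  · exact isUnit_of_mul_isUnit_left h
  · exact isUnit_of_mul_isUnit_right h

/-- The units `f_U = w` and `f_V = w - c`. -/
noncomputable def frame (j : Patch) : (CoverRing ξ l)ˣ := (isUnit_fAff ξ l j).unit

/-- The root `s`. -/
noncomputable def s : CoverRing ξ l := algebraMap (AffineCoverRing ξ l) (CoverRing ξ l) (sAff ξ l)

lemma frame_V : (frame ξ l .V : CoverRing ξ l) = frame ξ l .U - toCover ξ l ξ.c := by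
  rw [frame, frame, IsUnit.unit_spec, IsUnit.unit_spec, fAff, fAff, map_sub, map_sub]
  rfl

lemma s_pow : s ξ l ^ l = (frame ξ l .U : CoverRing ξ l) ^ p - toCover ξ l ξ.aU := by
  have h : sAff ξ l ^ l = polyToAffineCover ξ l (.X ^ p - .C ξ.aU) := by
    have h := AdjoinRoot.eval₂_root (coverPoly ξ l)
    rw [coverPoly, Polynomial.eval₂_sub, Polynomial.eval₂_pow, Polynomial.eval₂_X,
      Polynomial.eval₂_C, sub_eq_zero] at h
    exact h
  rw [s, frame, IsUnit.unit_spec, fAff, ← map_pow, h, map_sub, map_sub, map_pow, map_pow]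
  rfl

/-- The coordinate rings of `U` and `V`. -/
noncomputable def baseChart (j : Patch) : Subalgebra k (CoverRing ξ l) :=
  (curveChart k p e j).map (toCover ξ l)

/-- The generators of `𝒪_C(-n ∞)` on `U` and `V`. -/
noncomputable def gen (n : ℕ) (j : Patch) : (CoverRing ξ l)ˣ :=
  Units.map (toCover ξ l : PuncturedRing k p e →* CoverRing ξ l) (idealGen k p e n j)

lemma toCover_mem [Fact p.Prime] [NeZero e] (a : PuncturedRing k p e) :
    toCover ξ l a ∈ baseChart ξ l .U ⊔ baseChart ξ l .V := by
  rw [baseChart, baseChart, ← Algebra.map_sup, curveChart_sup]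
  exact ⟨a, trivial, rfl⟩

lemma isAtlas_baseChart : Atlas.IsAtlas (baseChart ξ l) :=
  (isAtlas_curveChart k p e).map (toCover ξ l)

lemma gen_div_mem [Fact p.Prime] [NeZero e] (n : ℕ) (i j : Patch) :
    ((gen ξ l n j / gen ξ l n i : (CoverRing ξ l)ˣ) : CoverRing ξ l) ∈
      baseChart ξ l i ⊔ baseChart ξ l j := by
  have : ((gen ξ l n j / gen ξ l n i : (CoverRing ξ l)ˣ) : CoverRing ξ l) =
      toCover ξ l ((idealGen k p e n j / idealGen k p e n i : (PuncturedRing k p e)ˣ)) := by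
    rw [gen, gen, ← map_div]; rfl
  rcases i with _ | _ <;> rcases j with _ | _
  · rw [div_self']; exact one_mem _
  · rw [this]; exact toCover_mem ξ l _
  · rw [this, sup_comm]; exact toCover_mem ξ l _
  · rw [div_self']; exact one_mem _

lemma frame_sub_mem [Fact p.Prime] [NeZero e] (n : ℕ) (i j : Patch) :
    ((frame ξ l j : CoverRing ξ l) - frame ξ l i) * ((gen ξ l n i)⁻¹ : (CoverRing ξ l)ˣ) ∈
      baseChart ξ l i ⊔ baseChart ξ l j := by
  have hg : (((gen ξ l n i)⁻¹ : (CoverRing ξ l)ˣ) : CoverRing ξ l) =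
      toCover ξ l (((idealGen k p e n i)⁻¹ : (PuncturedRing k p e)ˣ)) := by
    rw [gen, ← map_inv]; rfl
  rcases i with _ | _ <;> rcases j with _ | _
  · rw [sub_self, zero_mul]; exact zero_mem _
  · rw [hg, frame_V, sub_sub_cancel_left, ← map_neg, ← map_mul]; exact toCover_mem ξ l _
  · rw [hg, frame_V, sub_sub_cancel, ← map_mul, sup_comm]; exact toCover_mem ξ l _
  · rw [sub_self, zero_mul]; exact zero_mem _

/-- The charts of `P = ℙ(ℰ)`. -/
noncomputable def bundleChart : Patch × Bool → Subalgebra k (CoverRing ξ l) :=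
  Atlas.projChart (baseChart ξ l) (gen ξ l (e * (p * e - 3))) (frame ξ l)

/-- The charts of the cyclic cover `S` of `P` defined by `G + F ∼ l M`, `M = r T + g^* D'`, where
`r = (p + 1) / l` and `D' = (e / l) (p e - 3) ∞`. -/
noncomputable def surfaceChart : Patch × Bool → Subalgebra k (CoverRing ξ l) :=
  Atlas.coverChart (baseChart ξ l) (gen ξ l (e * (p * e - 3))) (frame ξ l)
    (gen ξ l (e / l * (p * e - 3))) (s ξ l) ((p + 1) / l)

/-- On every chart the root generating `S` over `P` is an `l`-th root of the local equation
of `G + F`. -/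
lemma root_pow (hle : l ∣ e) (hlp : l ∣ p + 1) (a : Patch × Bool) :
    (s ξ l * ((gen ξ l (e / l * (p * e - 3)) a.1 /
        Atlas.frameSection (gen ξ l (e * (p * e - 3))) (frame ξ l) a ^ ((p + 1) / l) :
          (CoverRing ξ l)ˣ) : CoverRing ξ l)) ^ l =
      ((frame ξ l .U : CoverRing ξ l) ^ p - toCover ξ l ξ.aU) *
        ((gen ξ l (e * (p * e - 3)) a.1 /
          Atlas.frameSection (gen ξ l (e * (p * e - 3))) (frame ξ l) a ^ (p + 1) :
          (CoverRing ξ l)ˣ) : CoverRing ξ l) := by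
  have hgen : gen ξ l (e / l * (p * e - 3)) a.1 ^ l = gen ξ l (e * (p * e - 3)) a.1 := by
    rw [gen, gen, ← map_pow]
    congr 1
    rcases a.1 with _ | _
    · exact one_pow l
    · change (t k p e ^ _) ^ l = t k p e ^ _
      rw [← pow_mul]
      congr 1
      rw [mul_right_comm, Nat.div_mul_cancel hle]
  rw [mul_pow, ← Units.val_pow_eq_pow_val, div_pow, hgen, ← pow_mul, Nat.div_mul_cancel hlp, s_pow]

lemma isAtlas_bundleChart [Fact p.Prime] [NeZero e] : Atlas.IsAtlas (bundleChart ξ l) :=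
  (isAtlas_baseChart ξ l).projChart (gen_div_mem ξ l _) (frame_sub_mem ξ l _)

lemma isAtlas_surfaceChart [Fact p.Prime] [NeZero e] : Atlas.IsAtlas (surfaceChart ξ l) :=
  (isAtlas_baseChart ξ l).coverChart (gen_div_mem ξ l _) (gen_div_mem ξ l _)
    (frame_sub_mem ξ l _) _ _

/-- The projective bundle `P = ℙ(ℰ)` over `C`. -/
noncomputable def bundle [Fact p.Prime] [NeZero e] : Scheme.{u} :=
  Atlas.glue (bundleChart ξ l) (isAtlas_bundleChart ξ l)

/-- The cyclic cover `S` of `P` of degree `l` branched along `G + F`. -/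
noncomputable def surface [Fact p.Prime] [NeZero e] : Scheme.{u} :=
  Atlas.glue (surfaceChart ξ l) (isAtlas_surfaceChart ξ l)

/-- The covering `π : S ⟶ P`. -/
noncomputable def coverMap [Fact p.Prime] [NeZero e] : surface ξ l ⟶ bundle ξ l :=
  Atlas.glueMap (isAtlas_bundleChart ξ l) (isAtlas_surfaceChart ξ l) fun _ => le_sup_left

/-- The structure morphism of `S` over `k`. -/
noncomputable def surfaceToBase [Fact p.Prime] [NeZero e] : surface ξ l ⟶ Spec (.of k) :=
  Atlas.toBase (surfaceChart ξ l) (isAtlas_surfaceChart ξ l)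

end TangoRaynaud

/-! ## Pluricanonical forms, ampleness of the canonical sheaf, Kodaira dimension -/

namespace Canonical

open scoped TensorProduct

section

variable (k : Type u) {K : Type u} [Field k] [Field K] [Algebra k K]

/-- Rational `n`-fold differential forms of top degree `d`, for a variety of dimension `d` with
function field `K`. -/
abbrev PluriForm (K : Type u) [Field K] [Algebra k K] (d n : ℕ) : Type u :=
  ⨂[K]^n (⋀[K]^d (Ω[K⁄k]))

/-- The stalk of `ω^{⊗ n}`, `ω = ⋀^d Ω`, at a smooth point with local ring `O`: the image of
`(⋀^d Ω_{O/k})^{⊗ n}` in the space of rational forms. -/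
noncomputable def stalkLattice (O : Subring K) (d n : ℕ) : Submodule O (PluriForm k K d n) :=
  Submodule.span O {η | ∃ a : Fin n → Fin d → O, η = PiTensorProduct.tprod K fun i =>
    exteriorPower.ιMulti K d fun j => KaehlerDifferential.D k K (a i j)}

/-- The dimension of the closure of the image of the rational map to projective space defined by a
space `H` of sections of a line bundle: its function field is generated by the quotients of
elements of `H`. -/
noncomputable def imageDim {V : Type u} [AddCommGroup V] [Module K V] (H : Set V) : ℕ∞ :=
  Cardinal.toENat (Algebra.trdeg k
    (IntermediateField.adjoin k {φ : K | ∃ s ∈ H, ∃ t ∈ H, t ≠ 0 ∧ s = φ • t}))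

end

variable {k : Type u} [Field k] {X : Scheme.{u}} [IsIntegral X] (f : X ⟶ Spec (.of k))

/-- The function field of a `k`-variety as a `k`-algebra. -/
noncomputable abbrev functionFieldAlgebra : Algebra k X.functionField :=
  ((Scheme.ΓSpecIso (.of k)).inv ≫ f.appTop ≫
    X.presheaf.germ ⊤ (genericPoint X) trivial).hom.toAlgebra

/-- The local ring at `x`, inside the function field. -/
noncomputable def localRing (x : X) : Subring X.functionField :=
  (algebraMap (X.presheaf.stalk x) X.functionField).range

/-- `H⁰(X, ω_X^{⊗ n})` for a smooth variety `X` of dimension `d` over `k`. -/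
noncomputable def pluriSections (d n : ℕ) :
    letI := functionFieldAlgebra f
    Set (PluriForm k X.functionField d n) :=
  letI := functionFieldAlgebra f
  {η | ∀ x : X, η ∈ stalkLattice k (localRing x) d n}

/-- `ω_X` is ample, for a smooth variety `X` of dimension `d`: `X` is quasi-compact and every point
lies in an affine open set of the form `X_η`, the set of points at which `η` generates
`ω_X^{⊗ n}`, for some `n ≥ 1` and `η ∈ H⁰(X, ω_X^{⊗ n})`. -/
def IsCanonicallyAmple (d : ℕ) : Prop :=
  letI := functionFieldAlgebra f
  CompactSpace X ∧ ∀ x : X, ∃ n > 0, ∃ η ∈ pluriSections f d n, ∃ W : X.Opens,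
    IsAffineOpen W ∧ x ∈ W ∧
      ∀ y : X, y ∈ W ↔ stalkLattice k (localRing y) d n = Submodule.span (localRing y) {η}

/-- The Kodaira dimension of a smooth variety `X` of dimension `d`: the largest dimension of the
image of `X` under a pluricanonical map, and `⊥` (that is, `-∞`) if there is no non-zero
pluricanonical form. -/
noncomputable def kodairaDim (d : ℕ) : WithBot ℕ∞ :=
  letI := functionFieldAlgebra f
  ⨆ n : {n : ℕ // 0 < n ∧ ∃ η ∈ pluriSections f d n, η ≠ 0},
    ((imageDim (K := X.functionField) k (pluriSections f d n) : ℕ∞) : WithBot ℕ∞)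

end Canonical

/-! Write r = (p + 1) / l and a = p - 1 - r (`coeffT`). From K_C = pD, det ℰ = 𝒪(-D) and K_S =
π^*(K_P + (l - 1)M) one expects K_S ~ π^*(aT + g^*(pD - D/l)), with a fibre part of degree `degK`.
The inclusion 𝒪(-D) → ℰ is a section of T + g^*D with divisor F, so F ~ T + g^*D and G ~ pT. Hence
K_S is the pull-back of aF + g^*(pD - D/l - aD), and pK_S that of aG + p g^*(pD - D/l). Both fibre
parts have positive degree, because a + 1 ≤ p and deg(D/l) < deg D (`degK_pos`). Moreover F and G
are disjoint.

If a > 0, the power pe of ω_S therefore has sections whose non-vanishing loci are the complement of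
F over a patch of C, and the complement of G over a patch. All of these are affine and together they
cover S, so K_S is ample. If a = 0, then K_S comes from a divisor of positive degree on C;
pluricanonical forms are functions on C times a fixed form, and κ(S) = 1. Finally a = 0 exactly when
(p + 1) / l = p - 1, that is, when {l, p} = {2, 3} (`coeffT_eq_zero_iff`).

The argument takes place inside the function field. The lift aU is no p-th power, since d aU = dz ≠
0 (`aU_ne_pow`); so w^p - aU is prime over the function field of C, s^l - (w^p - aU) is Eisenstein
at it, and `CoverRing` is a domain. Every local ring is then a subring O of the function field, and
a point lies in a chart as soon as O contains the coordinate ring of that chart (`Dominates`).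
Instead of the adjunction formula, `stalkLattice_eq` computes a generator of ω_S on each chart: ε^a
τ^(-degK) dw ∧ ds, where ε generates 𝒪(1) and τ generates 𝒪_C(-∞). It rests on the two local models
`CyclicData.stalkLattice_affine` and `CyclicData.stalkLattice_infinity`. All questions about forms
become questions about membership and invertibility of rational functions in O.

Ampleness is carried by `exists_section_affine`, `exists_section_branch`, `exists_branch_affine` and
`Dominates.affine_or_branch`. The bound κ(S) ≤ 1 comes from `mem_range_toCover`: functions on the
part of S over U are functions on the curve. -/

/-! ## Local rings of an integral scheme inside its function field -/

namespace Canonical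

section

variable {X : Scheme.{u}} {R : CommRingCat.{u}}

/-- The prime ideal of a point of an affine scheme. -/
def primeIdeal (q : Spec R) : Ideal R := PrimeSpectrum.asIdeal q

instance (q : Spec R) : (primeIdeal q).IsPrime := PrimeSpectrum.isPrime q

/-- The map from the coordinate ring of an affine open subscheme to the stalk at one of its
points. -/
noncomputable def toStalk (j : Spec R ⟶ X) [IsOpenImmersion j] (q : Spec R) :
    R ⟶ X.presheaf.stalk (j q) :=
  (Scheme.ΓSpecIso R).inv ≫ (Spec R).presheaf.germ ⊤ q trivial ≫ inv (j.stalkMap q)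

lemma specMap_toStalk (j : Spec R ⟶ X) [IsOpenImmersion j] (q : Spec R) :
    Spec.map (toStalk j q) ≫ j = X.fromSpecStalk (j q) := by
  have h := Scheme.SpecMap_stalkMap_fromSpecStalk j (x := q)
  rw [Spec.fromSpecStalk_eq R q] at h
  rw [toStalk, ← Category.assoc, Spec.map_comp, Category.assoc, ← h, ← Category.assoc,
    ← Spec.map_comp, IsIso.hom_inv_id, Spec.map_id, Category.id_comp]

lemma isLocalization_toStalk (j : Spec R ⟶ X) [IsOpenImmersion j] (q : Spec R) :
    let _ := (toStalk j q).hom.toAlgebra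
    IsLocalization.AtPrime (X.presheaf.stalk (j q)) (primeIdeal q) := by
  let _ := (toStalk j q).hom.toAlgebra
  let _ : Algebra R ((Spec R).presheaf.stalk q) :=
    ((Scheme.ΓSpecIso R).inv ≫ (Spec R).presheaf.germ ⊤ q trivial).hom.toAlgebra
  let e : (Spec R).presheaf.stalk q ≃ₐ[R] X.presheaf.stalk (j q) :=
    { (asIso (j.stalkMap q)).symm.commRingCatIsoToRingEquiv with
      commutes' := fun r => rfl }
  have : IsLocalization.AtPrime ((Spec R).presheaf.stalk q) (primeIdeal q) :=
    StructureSheaf.IsLocalization.to_stalk R q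
  exact IsLocalization.isLocalization_of_algEquiv (primeIdeal q).primeCompl e

variable [IsIntegral X]

/-- The inclusion of the coordinate ring of an affine open subscheme in the function field. -/
noncomputable def toFunctionField [IsDomain R] (j : Spec R ⟶ X) [IsOpenImmersion j] :
    R ⟶ X.functionField :=
  toStalk j (genericPoint (Spec R)) ≫
    X.presheaf.stalkSpecializes ((genericPoint_spec X).specializes trivial)

lemma specMap_toFunctionField [IsDomain R] (j : Spec R ⟶ X) [IsOpenImmersion j] :
    Spec.map (toFunctionField j) ≫ j = X.fromSpecStalk (genericPoint X) := by
  rw [toFunctionField, Spec.map_comp, Category.assoc, specMap_toStalk,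
    Scheme.SpecMap_stalkSpecializes_fromSpecStalk]

/-- An open immersion is a monomorphism, so the factorization of the generic point through the chart
is unique. All compatibilities of `toFunctionField` below are deduced from this uniqueness. -/
lemma eq_toFunctionField [IsDomain R] (j : Spec R ⟶ X) [IsOpenImmersion j]
    (g : R ⟶ X.functionField)
    (hg : Spec.map g ≫ j = X.fromSpecStalk (genericPoint X)) : g = toFunctionField j := by
  rw [← specMap_toFunctionField j, cancel_mono] at hg
  exact Spec.map_injective hg

lemma algebraMap_toStalk [IsDomain R] (j : Spec R ⟶ X) [IsOpenImmersion j] (q : Spec R) (a : R) :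
    algebraMap (X.presheaf.stalk (j q)) X.functionField (toStalk j q a) =
      toFunctionField j a := by
  rw [← eq_toFunctionField j (toStalk j q ≫
    X.presheaf.stalkSpecializes ((genericPoint_spec X).specializes trivial))]
  · rfl
  · rw [Spec.map_comp, Category.assoc, specMap_toStalk,
      Scheme.SpecMap_stalkSpecializes_fromSpecStalk]

lemma toFunctionField_injective [IsDomain R] (j : Spec R ⟶ X) [IsOpenImmersion j] :
    Function.Injective (toFunctionField j) := by
  let q : Spec R := genericPoint (Spec R)
  let _ := (toStalk j q).hom.toAlgebra
  have := isLocalization_toStalk j q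
  have h1 : Function.Injective (algebraMap R (X.presheaf.stalk (j q))) :=
    IsLocalization.injective _ (primeIdeal q).primeCompl_le_nonZeroDivisors
  have h2 := IsFractionRing.injective (X.presheaf.stalk (j q)) X.functionField
  intro a b hab
  rw [← algebraMap_toStalk j q, ← algebraMap_toStalk j q] at hab
  exact h1 (h2 hab)

lemma mem_localRing_iff [IsDomain R] (j : Spec R ⟶ X) [IsOpenImmersion j] (q : Spec R)
    (φ : X.functionField) :
    φ ∈ localRing (j q) ↔ ∃ a b : R, b ∉ primeIdeal q ∧
      φ * toFunctionField j b = toFunctionField j a := by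
  let _ := (toStalk j q).hom.toAlgebra
  have := isLocalization_toStalk j q
  have key : ∀ a, algebraMap (X.presheaf.stalk (j q)) X.functionField (algebraMap R _ a) =
    toFunctionField j a := algebraMap_toStalk j q
  constructor
  · rintro ⟨ψ, rfl⟩
    obtain ⟨⟨a, b⟩, h⟩ := IsLocalization.surj (primeIdeal q).primeCompl ψ
    refine ⟨a, b, b.2, ?_⟩
    rw [← key, ← key, ← map_mul, h]
  · rintro ⟨a, b, hb, h⟩
    refine ⟨IsLocalization.mk' _ a (⟨b, hb⟩ : (primeIdeal q).primeCompl), ?_⟩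
    have hb0 : toFunctionField j b ≠ 0 := by
      intro h0
      rw [← map_zero (toFunctionField j).hom] at h0
      exact hb (toFunctionField_injective j h0 ▸ zero_mem _)
    refine mul_right_cancel₀ hb0 ?_
    rw [h, ← key, ← key, ← map_mul]
    exact congrArg _ (IsLocalization.mk'_spec _ a (⟨b, hb⟩ : (primeIdeal q).primeCompl))

lemma toFunctionField_comp {S : CommRingCat.{u}} [IsDomain R] [IsDomain S]
    (g : R ⟶ S) (j : Spec R ⟶ X) [IsOpenImmersion j] (j' : Spec S ⟶ X)
    [IsOpenImmersion j'] (h : Spec.map g ≫ j = j') (a : R) :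
    toFunctionField j' (g a) = toFunctionField j a := by
  rw [← eq_toFunctionField j (g ≫ toFunctionField j')]
  · rfl
  · rw [Spec.map_comp, Category.assoc, h, specMap_toFunctionField]

lemma toFunctionField_algebraMap {k : Type u} [Field k] [IsDomain R] [Algebra k R]
    (f : X ⟶ Spec (.of k)) (j : Spec R ⟶ X) [IsOpenImmersion j]
    (h : j ≫ f = Spec.map (CommRingCat.ofHom (algebraMap k R))) (c : k) :
    toFunctionField j (algebraMap k R c) = (functionFieldAlgebra f).algebraMap c := by
  have h1 : CommRingCat.ofHom (algebraMap k R) ≫ toFunctionField j =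
      (Scheme.ΓSpecIso (.of k)).inv ≫ f.appTop ≫
        X.presheaf.germ ⊤ (genericPoint X) trivial := by
    apply Spec.map_injective
    rw [Spec.map_comp, ← h, ← Category.assoc, specMap_toFunctionField, Spec.map_comp,
      Spec.map_comp, ← Scheme.fromSpecStalk_toSpecΓ, Category.assoc, Category.assoc]
    congr 1
    rw [← Scheme.toSpecΓ_naturality_assoc]
    simp
  exact congrArg (fun g => g.hom c) h1

/-- Near each point the rational function comes from a section. Two such sections agree on the
overlap because sections over a non-empty open set inject into the function field, so they glue. -/
lemma exists_section_of_mem_localRing {W : X.Opens} [Nonempty W] (φ : X.functionField)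
    (h : ∀ x ∈ W, φ ∈ localRing x) : ∃ f : Γ(X, W), X.germToFunctionField W f = φ := by
  have h' : ∀ x : W, ∃ (U : X.Opens) (_ : x.1 ∈ U) (_ : U ≤ W) (_ : Nonempty U) (g : Γ(X, U)),
      X.germToFunctionField U g = φ := by
    rintro ⟨x, hx⟩
    obtain ⟨ψ, rfl⟩ := h x hx
    obtain ⟨U, hU, g, rfl⟩ := X.presheaf.exists_germ_eq ψ
    let V : X.Opens := U ⊓ W
    have hxV : x ∈ V := ⟨hU, hx⟩
    have : Nonempty V := ⟨⟨x, hxV⟩⟩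
    refine ⟨V, hxV, inf_le_right, this,
      X.presheaf.map (homOfLE (inf_le_left : V ≤ U)).op g, ?_⟩
    rw [← Scheme.algebraMap_germ_eq_germToFunctionField _ hxV, X.presheaf.germ_res_apply]
  choose U hxU hUW hne g hg using h'
  obtain ⟨f, hf, -⟩ := X.sheaf.existsUnique_gluing' U W (fun x => homOfLE (hUW x))
    (fun x hx => TopologicalSpace.Opens.mem_iSup.mpr ⟨⟨x, hx⟩, hxU _⟩) g (by
      intro x y
      let V : X.Opens := U x ⊓ U y
      by_cases hxy : Nonempty V
      · apply X.germToFunctionField_injective V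
        erw [X.presheaf.germ_res_apply, X.presheaf.germ_res_apply]
        exact (hg x).trans (hg y).symm
      -- On an empty overlap there is nothing to compare: the ring of sections is zero.
      · have hbot : V = ⊥ := by
          ext z
          simp only [TopologicalSpace.Opens.coe_bot, Set.mem_empty_iff_false, iff_false]
          exact fun hz => hxy ⟨⟨z, hz⟩⟩
        have : Subsingleton Γ(X, V) := by
          rw [hbot]
          exact CommRingCat.subsingleton_of_isTerminal X.sheaf.isTerminalOfEmpty
        exact this.elim _ _)
  refine ⟨f, ?_⟩
  obtain ⟨x⟩ := ‹Nonempty W›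
  rw [← hg x, ← hf x]
  exact (X.presheaf.germ_res_apply (homOfLE (hUW x)) _ _ f).symm

lemma mem_basicOpen_iff {W : X.Opens} [Nonempty W] (f : Γ(X, W)) (x : X) :
    x ∈ X.basicOpen f ↔ x ∈ W ∧ ∃ ψ ∈ localRing x, X.germToFunctionField W f * ψ = 1 := by
  constructor
  · intro hx
    have hxW := X.basicOpen_le f hx
    refine ⟨hxW, ?_⟩
    rw [Scheme.mem_basicOpen _ _ _ hxW] at hx
    obtain ⟨v, hv⟩ := hx.exists_right_inv
    refine ⟨algebraMap _ _ v, ⟨v, rfl⟩, ?_⟩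
    rw [← Scheme.algebraMap_germ_eq_germToFunctionField _ hxW, ← map_mul, hv, map_one]
  · rintro ⟨hxW, _, ⟨v, rfl⟩, hv⟩
    rw [Scheme.mem_basicOpen _ _ _ hxW]
    refine IsUnit.of_mul_eq_one v (IsFractionRing.injective (X.presheaf.stalk x) X.functionField ?_)
    rw [map_mul, Scheme.algebraMap_germ_eq_germToFunctionField, hv, map_one]

/-- An open set is affine if two rational functions `f`, `g` that are regular on it generate the
unit ideal and the loci where they are invertible are affine. -/
lemma isAffineOpen_of_regular_pair {W : X.Opens} [Nonempty W] {W' : Bool → X.Opens}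
    (hW' : ∀ i, IsAffineOpen (W' i)) {φ : Bool → X.functionField}
    (hφ : ∀ i, ∀ x ∈ W, φ i ∈ localRing x) {b : X.functionField} (hb : ∀ x ∈ W, b ∈ localRing x)
    (hone : φ true - b * φ false = 1)
    (h : ∀ i x, x ∈ W' i ↔ x ∈ W ∧ ∃ ψ ∈ localRing x, φ i * ψ = 1) : IsAffineOpen W := by
  choose f hf using fun i => exists_section_of_mem_localRing (φ i) (hφ i)
  obtain ⟨β, hβ⟩ := exists_section_of_mem_localRing b hb
  refine isAffineOpen_of_isAffineOpen_basicOpen W (Set.range f) ?_ ?_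
  · rw [Ideal.eq_top_iff_one]
    have : (1 : Γ(X, W)) = f true - β * f false := by
      apply X.germToFunctionField_injective W
      rw [map_sub, map_mul, hf, hf, hβ, hone, map_one]
    rw [this]
    exact sub_mem (Ideal.subset_span ⟨_, rfl⟩) (Ideal.mul_mem_left _ _ (Ideal.subset_span ⟨_, rfl⟩))
  · rintro _ ⟨i, rfl⟩
    convert hW' i
    ext x
    exact (mem_basicOpen_iff (f i) x).trans (by rw [hf i]; exact (h i x).symm)

lemma isLocalRing_localRing (x : X) : IsLocalRing (localRing x) :=
  IsLocalRing.of_surjective' (algebraMap (X.presheaf.stalk x) X.functionField).rangeRestrict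
    (RingHom.rangeRestrict_surjective _)

end

end Canonical

/-! ### Charts, integrality and local rings of a glued scheme -/

namespace Atlas

section

variable {k Q : Type u} [CommRing k] [CommRing Q] [Algebra k Q] {ι : Type}
  {A : ι → Subalgebra k Q} (hA : IsAtlas A)

/-- The inclusion of a finite intersection of charts in the glued scheme. -/
noncomputable def overlapMap (I : Index ι) :
    Spec (.of (overlap A I.ofDual.1)) ⟶ glue A hA :=
  haveI := fun {I J : Index ι} (f : I ⟶ J) => hA.isOpenImmersion f
  haveI := hA.isLocallyDirected
  colimit.ι (diagram A) I

instance (I : Index ι) : IsOpenImmersion (overlapMap hA I) := by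
  have := fun {I J : Index ι} (f : I ⟶ J) => hA.isOpenImmersion f
  have := hA.isLocallyDirected
  exact inferInstanceAs (IsOpenImmersion (colimit.ι (diagram A) I))

lemma specIncl_overlapMap {I J : Index ι} (h : J.ofDual.1 ⊆ I.ofDual.1) :
    specIncl (overlap_mono A h) ≫ overlapMap hA J = overlapMap hA I := by
  have := fun {I J : Index ι} (f : I ⟶ J) => hA.isOpenImmersion f
  have := hA.isLocallyDirected
  exact colimit.w (diagram A) (homOfLE (show I ≤ J from h))

lemma overlapMap_toBase (I : Index ι) : overlapMap hA I ≫ toBase A hA =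
    Spec.map (CommRingCat.ofHom (algebraMap k (overlap A I.ofDual.1))) := by
  have := fun {I J : Index ι} (f : I ⟶ J) => hA.isOpenImmersion f
  have := hA.isLocallyDirected
  exact colimit.ι_desc _ _

lemma exists_overlapMap_eq (x : glue A hA) : ∃ I q, overlapMap hA I q = x := by
  have := fun {I J : Index ι} (f : I ⟶ J) => hA.isOpenImmersion f
  have := hA.isLocallyDirected
  exact Scheme.IsLocallyDirected.ι_jointly_surjective (diagram A) x

/-- A single chart, as a member of the diagram of all intersections. -/
def single (i : ι) : Index ι := OrderDual.toDual ⟨{i}, Finset.singleton_nonempty i⟩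

lemma overlap_single (i : ι) : overlap A (single i).ofDual.1 = A i := by
  simp [overlap, single]

/-- The inclusion of a chart in the glued scheme. -/
noncomputable def chart (i : ι) : Spec (.of (A i)) ⟶ glue A hA :=
  specIncl (overlap_single i).le ≫ overlapMap hA (single i)

/-- The overlap of a single chart equals the chart as a subalgebra, but not by definition.
Inclusions in both directions avoid transport along that equality. -/
instance isIso_specIncl {B C : Subalgebra k Q} (h : B ≤ C) [hCB : Fact (C ≤ B)] :
    IsIso (specIncl h) :=
  ⟨specIncl hCB.out, by rw [specIncl_comp, specIncl_refl], by rw [specIncl_comp, specIncl_refl]⟩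

instance (i : ι) : IsOpenImmersion (chart hA i) := by
  have : Fact (A i ≤ overlap A (single i).ofDual.1) := ⟨(overlap_single i).ge⟩
  rw [chart]
  infer_instance

lemma specIncl_chart {I : Index ι} {i : ι} (h : i ∈ I.ofDual.1) :
    specIncl (le_overlap A h) ≫ chart hA i = overlapMap hA I := by
  rw [chart, ← Category.assoc, specIncl_comp,
    specIncl_overlapMap hA (J := single i) (Finset.singleton_subset_iff.mpr h)]

lemma chart_toBase (i : ι) :
    chart hA i ≫ toBase A hA = Spec.map (CommRingCat.ofHom (algebraMap k (A i))) := by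
  rw [chart, Category.assoc, overlapMap_toBase, specIncl_algebraMap]

lemma exists_chart_eq (x : glue A hA) : ∃ i q, chart hA i q = x := by
  obtain ⟨I, q, rfl⟩ := exists_overlapMap_eq hA x
  obtain ⟨i, hi⟩ := I.ofDual.2
  exact ⟨i, specIncl (le_overlap A hi) q, by rw [← specIncl_chart hA hi]; rfl⟩

/-- The charts form an open cover. -/
noncomputable def cover : (glue A hA).OpenCover :=
  haveI := fun {I J : Index ι} (f : I ⟶ J) => hA.isOpenImmersion f
  haveI := hA.isLocallyDirected
  Scheme.IsLocallyDirected.openCover (diagram A)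

lemma compactSpace_glue [Finite ι] : CompactSpace (glue A hA) := by
  have h : (Set.univ : Set (glue A hA)) = ⋃ i, Set.range (chart hA i) := by
    symm
    rw [Set.eq_univ_iff_forall]
    intro x
    obtain ⟨i, q, rfl⟩ := exists_chart_eq hA x
    exact Set.mem_iUnion.mpr ⟨i, q, rfl⟩
  rw [← isCompact_univ_iff, h]
  exact isCompact_iUnion fun i => isCompact_range (chart hA i).continuous

/-- The generic point of the intersection of all charts maps to the generic point of every chart,
hence is dense in the glued scheme; reducedness is checked on the cover. -/
theorem isIntegral_glue [IsDomain Q] [Nonempty ι] [Finite ι] : IsIntegral (glue A hA) := by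
  classical
  cases nonempty_fintype ι
  have : IsReduced (glue A hA) := by
    have : ∀ i, IsReduced ((cover hA).X i) := fun I =>
      inferInstanceAs (IsReduced (Spec (.of (overlap A I.ofDual.1))))
    exact IsReduced.of_openCover _ (cover hA)
  let I : Index ι := OrderDual.toDual ⟨Finset.univ, Finset.univ_nonempty⟩
  let η : glue A hA := overlapMap hA I (genericPoint (Spec (.of (overlap A I.ofDual.1))))
  have hη : ∀ x, x ∈ closure {η} := by
    intro x
    obtain ⟨i, q, rfl⟩ := exists_chart_eq hA x
    have hi : i ∈ I.ofDual.1 := Finset.mem_univ i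
    have : IsOpenImmersion (specIncl (le_overlap A hi) ≫ chart hA i) := by
      rw [specIncl_chart hA hi]; infer_instance
    have := IsOpenImmersion.of_comp (specIncl (le_overlap A hi)) (chart hA i)
    have h1 : η = chart hA i (genericPoint (Spec (.of (A i)))) := by
      rw [← genericPoint_eq_of_isOpenImmersion (specIncl (le_overlap A hi)),
        ← Scheme.Hom.comp_apply, specIncl_chart hA hi]
    rw [h1]
    exact (((genericPoint_spec (Spec (.of (A i)))).specializes trivial).map
      (chart hA i).continuous).mem_closure
  have : IrreducibleSpace (glue A hA) := by
    have h : IsIrreducible (closure {η}) := isIrreducible_singleton.closure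
    rw [Set.eq_univ_iff_forall.mpr hη] at h
    exact { isPreirreducible_univ := h.2, toNonempty := ⟨η⟩ }
  exact isIntegral_of_irreducibleSpace_of_isReduced _

end

section

open Canonical

variable {k Q : Type u} [Field k] [CommRing Q] [IsDomain Q] [Algebra k Q] {ι : Type} [Fintype ι]
  [Nonempty ι] {A : ι → Subalgebra k Q} (hA : IsAtlas A) (htop : overlap A Finset.univ = ⊤)
  [IsIntegral (glue A hA)]

/-- The intersection of all charts, as a member of the diagram of intersections. -/
def whole (ι : Type) [Fintype ι] [Nonempty ι] : Index ι :=
  OrderDual.toDual ⟨Finset.univ, Finset.univ_nonempty⟩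

/-- The inclusion in the function field of the ring that contains the coordinate rings of the
charts, when it is generated by them. -/
noncomputable def rational : Q →+* (glue A hA).functionField :=
  (toFunctionField (overlapMap hA (whole ι))).hom.comp
    ((Subalgebra.inclusion (htop.ge : ⊤ ≤ overlap A (whole ι).ofDual.1)).comp
      Subalgebra.topEquiv.symm.toAlgHom).toRingHom

lemma rational_injective : Function.Injective (rational hA htop) := by
  refine (toFunctionField_injective _).comp ?_
  exact (Subalgebra.inclusion_injective htop.ge).comp Subalgebra.topEquiv.symm.injective

lemma toFunctionField_chart (i : ι) (a : A i) :
    toFunctionField (chart hA i) a = rational hA htop a :=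
  have hi : i ∈ (whole ι).ofDual.1 := Finset.mem_univ i
  (toFunctionField_comp (CommRingCat.ofHom (Subalgebra.inclusion (le_overlap A hi)).toRingHom)
    (chart hA i) _ (specIncl_chart hA hi) a).symm

lemma rational_algebraMap (c : k) : rational hA htop (algebraMap k Q c) =
    (functionFieldAlgebra (toBase A hA)).algebraMap c := by
  obtain ⟨i⟩ := ‹Nonempty ι›
  exact (toFunctionField_chart hA htop i (algebraMap k (A i) c)).symm.trans
    (toFunctionField_algebraMap (R := .of (A i)) (toBase A hA) (chart hA i)
      (chart_toBase hA i) c)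

lemma mem_localRing_chart_iff (i : ι) (q : Spec (.of (A i))) (φ : (glue A hA).functionField) :
    φ ∈ localRing (chart hA i q) ↔ ∃ a b : A i, b ∉ primeIdeal q ∧
      φ * rational hA htop b = rational hA htop a := by
  rw [mem_localRing_iff]
  simp only [← toFunctionField_chart hA htop i]

lemma rational_mem_localRing {i : ι} (q : Spec (.of (A i))) {a : Q} (ha : a ∈ A i) :
    rational hA htop a ∈ localRing (chart hA i q) :=
  (mem_localRing_chart_iff hA htop i q _).mpr
    ⟨⟨a, ha⟩, 1, (Ideal.ne_top_iff_one _).mp (PrimeSpectrum.isPrime q).ne_top, by simp⟩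

lemma exists_mul_rational_eq_one_iff {i : ι} (q : Spec (.of (A i))) {a : Q} (ha : a ∈ A i) :
    (∃ ψ ∈ localRing (chart hA i q), rational hA htop a * ψ = 1) ↔
      (⟨a, ha⟩ : A i) ∉ primeIdeal q := by
  have hinj := rational_injective hA htop
  constructor
  · rintro ⟨ψ, hψ, h⟩ haq
    obtain ⟨c, d, hd, hcd⟩ := (mem_localRing_chart_iff hA htop i q _).mp hψ
    apply hd
    have : d = ⟨a, ha⟩ * c := by
      apply Subtype.ext
      apply hinj
      rw [MulMemClass.coe_mul, map_mul, ← hcd, ← mul_assoc, h, one_mul]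
    rw [this]
    exact Ideal.mul_mem_right _ _ haq
  · intro h
    have h0 : rational hA htop a ≠ 0 := by
      rw [Ne, map_eq_zero_iff _ hinj]
      rintro rfl
      exact h (zero_mem _)
    exact ⟨(rational hA htop a)⁻¹, (mem_localRing_chart_iff hA htop i q _).mpr
      ⟨1, ⟨a, ha⟩, h, by simp [inv_mul_cancel₀ h0]⟩, mul_inv_cancel₀ h0⟩

lemma exists_eq_div (i : ι) (q : Spec (.of (A i))) {φ : (glue A hA).functionField}
    (hφ : φ ∈ localRing (chart hA i q)) : ∃ a ∈ A i, ∃ b ∈ A i,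
      ∃ ψ ∈ localRing (chart hA i q), rational hA htop b * ψ = 1 ∧ φ = rational hA htop a * ψ := by
  obtain ⟨a, b, hb, h⟩ := (mem_localRing_chart_iff hA htop i q _).mp hφ
  obtain ⟨ψ, hψ, hbψ⟩ := (exists_mul_rational_eq_one_iff hA htop q b.2).mpr hb
  exact ⟨a, a.2, b, b.2, ψ, hψ, hbψ, by rw [← h, mul_assoc, hbψ, mul_one]⟩

/-- A point lies in a chart if the coordinate ring of the chart is contained in its local ring. -/
lemma mem_range_chart (i : ι) (x : glue A hA)
    (h : ∀ a ∈ A i, rational hA htop a ∈ localRing x) : x ∈ Set.range (chart hA i) := by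
  classical
  obtain ⟨j, q, rfl⟩ := exists_chart_eq hA x
  obtain ⟨g, hg, g', hg', hgg', hle⟩ := hA j i
  have hsup : A j ⊔ A i ≤ ({ (localRing (chart hA j q)).comap (rational hA htop) with
      algebraMap_mem' := fun c => rational_mem_localRing hA htop q
        (Subalgebra.algebraMap_mem (A j) c) } : Subalgebra k Q) :=
    sup_le (fun a ha => rational_mem_localRing hA htop q ha) h
  -- Both coordinate rings lie in the local ring, hence so does the inverse g' of g. Thus g does not
  -- vanish at q, and q lies in the basic open set Spec (A j ⊔ A i).
  have hgq := (exists_mul_rational_eq_one_iff hA htop q hg).mp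
    ⟨_, hsup hg', by rw [← map_mul, hgg', map_one]⟩
  let I : Index ι := OrderDual.toDual ⟨{j, i}, Finset.insert_nonempty _ _⟩
  have hj : j ∈ I.ofDual.1 := by simp [I]
  have hi : i ∈ I.ofDual.1 := by simp [I]
  have hI : overlap A I.ofDual.1 = A j ⊔ A i := by
    simp only [overlap, I, OrderDual.ofDual_toDual, Finset.mem_insert, Finset.mem_singleton,
      iSup_or, iSup_sup_eq, iSup_iSup_eq_left]
  have hb : overlap A I.ofDual.1 ≤ bounded (A j) g hg := by
    rw [hI]
    refine sup_le (fun a ha => ⟨0, by simpa using ha⟩) (hle.trans (sup_le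
      (fun a ha => ⟨0, by simpa using ha⟩) ?_))
    rw [Algebra.adjoin_le_iff, Set.singleton_subset_iff]
    exact ⟨1, by rw [pow_one, hgg']; exact one_mem _⟩
  obtain ⟨q', rfl⟩ := (mem_range_specIncl (le_overlap A hj) hg (hI ▸ hg') hgg' hb q).mpr hgq
  rw [← Scheme.Hom.comp_apply, specIncl_chart hA hj, ← specIncl_chart hA hi]
  exact ⟨_, rfl⟩

end
end Atlas

/-! ## The coordinate rings are domains -/

open Polynomial in
-- Eisenstein's criterion at ϖ. It is used at ϖ = y for the curve and at ϖ = w^p - aU for the cyclic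
-- cover.
lemma Polynomial.irreducible_X_pow_sub_C_of_prime {R : Type*} [CommRing R] [IsDomain R] {ϖ a : R}
    (hϖ : Prime ϖ) (h1 : ϖ ∣ a) (h2 : ¬ ϖ ^ 2 ∣ a) {n : ℕ} (hn : 0 < n) :
    Irreducible (X ^ n - C a : R[X]) := by
  have hprime : (Ideal.span {ϖ}).IsPrime := (Ideal.span_singleton_prime hϖ.ne_zero).mpr hϖ
  have hmonic : (X ^ n - C a : R[X]).Monic := monic_X_pow_sub_C a hn.ne'
  have hdeg : (X ^ n - C a : R[X]).natDegree = n := natDegree_X_pow_sub_C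
  refine IsEisensteinAt.irreducible (𝓟 := Ideal.span {ϖ}) ⟨?_, ?_, ?_⟩ hprime hmonic.isPrimitive
    (by rwa [hdeg])
  · rw [hmonic.leadingCoeff]
    exact fun h => hprime.ne_top ((Ideal.eq_top_iff_one _).mpr h)
  · intro m hm
    rw [hdeg] at hm
    rw [coeff_sub, coeff_X_pow, if_neg hm.ne, coeff_C]
    split_ifs
    · rw [zero_sub, neg_mem_iff]
      exact Ideal.mem_span_singleton.mpr h1
    · simp
  · rw [coeff_sub, coeff_X_pow, if_neg hn.ne, coeff_C_zero, zero_sub, neg_mem_iff,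
      Ideal.span_singleton_pow, Ideal.mem_span_singleton]
    exact h2

/-- Algebra homomorphisms to the dual numbers identify elements with equal differentials. -/
lemma DualNumber.snd_eq_of_D_eq {k R M : Type*} [CommRing k] [CommRing R] [CommRing M]
    [Algebra k R] [Algebra k M] (Φ : R →ₐ[k] DualNumber M) {a b : R}
    (h : KaehlerDifferential.D k R a = KaehlerDifferential.D k R b) :
    (Φ a).snd = (Φ b).snd := by
  -- The ε-component of Φ is a derivation for the R-module structure on M given by the first
  -- component, so it factors through the Kähler differentials.
  let g : R →ₐ[k] M := (TrivSqZeroExt.fstHom k M M).comp Φ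
  let _ : Algebra R M := g.toRingHom.toAlgebra
  have : IsScalarTower k R M := IsScalarTower.of_algebraMap_eq' g.comp_algebraMap.symm
  let D : Derivation k R M := Derivation.mk' ((TrivSqZeroExt.sndHom M M).restrictScalars k ∘ₗ
    Φ.toLinearMap) (by
      intro a b
      change (Φ (a * b)).snd = (Φ a).fst * (Φ b).snd + (Φ b).fst * (Φ a).snd
      rw [map_mul, TrivSqZeroExt.snd_mul, smul_eq_mul, MulOpposite.smul_eq_mul_unop,
        MulOpposite.unop_op]
      ring)
  have hD : ∀ x, D x = D.liftKaehlerDifferential (KaehlerDifferential.D k R x) := fun x =>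
    (D.liftKaehlerDifferential_comp_D x).symm
  exact (hD a).trans ((congrArg _ h).trans (hD b).symm)

/-! ### Integrality, points and vector fields of the curve -/

namespace TangoRaynaud

section Curve

variable (k : Type u) [Field k] (p e : ℕ)

/-- With z as main variable the equation is z^(pe - 1) - (y^(pe) - y) up to sign, which is
Eisenstein at y. The swap of variables is needed because `finSuccEquiv` singles out variable 0. -/
lemma curve_poly_prime [Fact p.Prime] [NeZero e] (h : 2 ≤ p * e) :
    Prime (MvPolynomial.X 0 ^ (p * e) - MvPolynomial.X 0 - MvPolynomial.X 1 ^ (p * e - 1) :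
      MvPolynomial (Fin 2) k) := by
  let E : MvPolynomial (Fin 2) k ≃ₐ[k] Polynomial (MvPolynomial (Fin 1) k) :=
    (MvPolynomial.renameEquiv k (Equiv.swap 0 1)).trans (MvPolynomial.finSuccEquiv k 1)
  have hE0 : E (MvPolynomial.X 0) = Polynomial.C (MvPolynomial.X 0) := by
    simp only [E, AlgEquiv.trans_apply, MvPolynomial.renameEquiv_apply, MvPolynomial.rename_X,
      Equiv.swap_apply_left]
    exact MvPolynomial.finSuccEquiv_X_succ (j := 0)
  have hE1 : E (MvPolynomial.X 1) = Polynomial.X := by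
    simp only [E, AlgEquiv.trans_apply, MvPolynomial.renameEquiv_apply, MvPolynomial.rename_X,
      Equiv.swap_apply_right]
    exact MvPolynomial.finSuccEquiv_X_zero
  rw [← MulEquiv.prime_iff E.toMulEquiv, ← irreducible_iff_prime,
    ← (Associated.refl _).neg_left.irreducible_iff]
  have hval : -(E.toMulEquiv (MvPolynomial.X 0 ^ (p * e) - MvPolynomial.X 0 -
      MvPolynomial.X 1 ^ (p * e - 1))) = Polynomial.X ^ (p * e - 1) -
        Polynomial.C (MvPolynomial.X 0 ^ (p * e) - MvPolynomial.X 0) := by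
    change -(E _) = _
    rw [map_sub, map_sub, map_pow, map_pow, hE0, hE1, Polynomial.C_sub, Polynomial.C_pow]
    ring
  rw [hval]
  obtain ⟨m, hm⟩ : ∃ m, p * e = m + 2 := ⟨p * e - 2, by omega⟩
  refine Polynomial.irreducible_X_pow_sub_C_of_prime (MvPolynomial.X_prime (i := (0 : Fin 1)))
    ?_ ?_ (by omega)
  · exact dvd_sub (dvd_pow_self _ (by omega)) dvd_rfl
  -- If y² divided y^(pe) - y, then y would divide y^(pe - 1) - 1, whose value at y = 0 is -1.
  · rintro ⟨c, hc⟩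
    have h1 : (MvPolynomial.X 0 : MvPolynomial (Fin 1) k) ^ (m + 1) - 1 = MvPolynomial.X 0 * c := by
      apply mul_left_cancel₀ (MvPolynomial.X_ne_zero (R := k) (0 : Fin 1))
      rw [hm] at hc
      linear_combination hc
    have h2 := congrArg (MvPolynomial.eval (fun _ => (0 : k))) h1
    simp at h2

variable {k p e}

/-- Homomorphisms from the coordinate ring of `U`. -/
noncomputable def curveLift {M : Type*} [CommRing M] [Algebra k M] (a b : M)
    (h : a ^ (p * e) - a = b ^ (p * e - 1)) : CurveRing k p e →ₐ[k] M :=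
  Ideal.Quotient.liftₐ (curveIdeal k p e) (MvPolynomial.aeval ![a, b]) (by
    intro x hx
    obtain ⟨c, rfl⟩ := Ideal.mem_span_singleton.mp hx
    simp [h])

lemma curveLift_yAff {M : Type*} [CommRing M] [Algebra k M] (a b : M)
    (h : a ^ (p * e) - a = b ^ (p * e - 1)) : curveLift a b h (yAff k p e) = a := by
  change MvPolynomial.aeval ![a, b] (MvPolynomial.X 0) = a
  simp

lemma curveLift_zAff {M : Type*} [CommRing M] [Algebra k M] (a b : M)
    (h : a ^ (p * e) - a = b ^ (p * e - 1)) : curveLift a b h (zAff k p e) = b := by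
  change MvPolynomial.aeval ![a, b] (MvPolynomial.X 1) = b
  simp

lemma curve_hom_ext {M : Type*} [CommRing M] [Algebra k M] {f g : CurveRing k p e →ₐ[k] M}
    (hy : f (yAff k p e) = g (yAff k p e)) (hz : f (zAff k p e) = g (zAff k p e)) : f = g := by
  apply Ideal.Quotient.algHom_ext
  apply MvPolynomial.algHom_ext
  intro i
  fin_cases i
  · exact hy
  · exact hz

lemma punctured_hom_ext {M : Type*} [CommRing M] [Algebra k M]
    {f g : PuncturedRing k p e →ₐ[k] M} (hy : f (y k p e) = g (y k p e))
    (hz : f (z k p e) = g (z k p e)) : f = g := by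
  have h : f.comp (IsScalarTower.toAlgHom k (CurveRing k p e) (PuncturedRing k p e)) =
      g.comp (IsScalarTower.toAlgHom k (CurveRing k p e) (PuncturedRing k p e)) :=
    curve_hom_ext hy hz
  apply AlgHom.coe_ringHom_injective
  apply IsLocalization.ringHom_ext (Submonoid.powers (yAff k p e * zAff k p e))
  exact congrArg (fun φ : CurveRing k p e →ₐ[k] M => (φ : CurveRing k p e →+* M)) h

lemma isDomain_curveRing [Fact p.Prime] [NeZero e] (h : 2 ≤ p * e) : IsDomain (CurveRing k p e) := by
  have : (curveIdeal k p e).IsPrime := by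
    rw [curveIdeal, Ideal.span_singleton_prime (curve_poly_prime k p e h).ne_zero]
    exact curve_poly_prime k p e h
  exact inferInstanceAs (IsDomain (MvPolynomial (Fin 2) k ⧸ curveIdeal k p e))

section

variable [IsAlgClosed k]

lemma exists_point (h : 2 ≤ p * e) (c : k) :
    ∃ f : CurveRing k p e →ₐ[k] k, f (zAff k p e) = c := by
  obtain ⟨a, ha⟩ := IsAlgClosed.exists_root
    (Polynomial.X ^ (p * e) - Polynomial.X - Polynomial.C (c ^ (p * e - 1)) : Polynomial k) (by
      have hdeg := FiniteField.X_pow_card_sub_X_natDegree_eq k (p := p * e) (by omega)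
      intro h0
      have := Polynomial.natDegree_eq_of_degree_eq_some h0
      rw [Polynomial.natDegree_sub_C, hdeg] at this
      have h2 : p * e = 0 := this
      clear this
      omega)
  refine ⟨curveLift a c ?_, curveLift_zAff _ _ _⟩
  simpa [sub_eq_zero] using ha

/-- Every value c ∈ k of z is attained at a k-point, so a polynomial relation for z would vanish on
all of the infinite field k. -/
lemma transcendental_zAff (h : 2 ≤ p * e) : Transcendental k (zAff k p e) := by
  rw [transcendental_iff]
  intro P hP
  have : Infinite k := IsAlgClosed.instInfinite
  refine Polynomial.funext fun c => ?_
  obtain ⟨f, hf⟩ := exists_point (p := p) (e := e) h c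
  have := congrArg f hP
  rw [map_zero, ← Polynomial.aeval_algHom_apply, hf] at this
  simpa using this

variable [Fact p.Prime] [NeZero e]

lemma yz_powers_le (h : 2 ≤ p * e) :
    Submonoid.powers (yAff k p e * zAff k p e) ≤ nonZeroDivisors (CurveRing k p e) := by
  have := isDomain_curveRing (k := k) h
  refine powers_le_nonZeroDivisors_of_noZeroDivisors (mul_ne_zero ?_ ?_)
  · intro h0
    have := congrArg (curveLift (1 : k) 0 (by rw [one_pow, zero_pow (by omega)]; simp)) h0
    rw [curveLift_yAff, map_zero] at this
    exact one_ne_zero this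
  · intro h0
    exact transcendental_zAff (k := k) h (h0 ▸ isAlgebraic_zero)

lemma isDomain_puncturedRing (h : 2 ≤ p * e) : IsDomain (PuncturedRing k p e) := by
  have := isDomain_curveRing (k := k) h
  exact IsLocalization.isDomain_of_le_nonZeroDivisors (M := Submonoid.powers (yAff k p e * zAff k p e))
    (PuncturedRing k p e) (yz_powers_le h)

lemma transcendental_z (h : 2 ≤ p * e) : Transcendental k (z k p e : PuncturedRing k p e) :=
  (transcendental_algebraMap_iff
    (IsLocalization.injective (PuncturedRing k p e) (yz_powers_le (k := k) h))).mpr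
      (transcendental_zAff h)

end

section

variable [CharP k p]

lemma natCast_mul_eq_zero {M : Type*} [CommRing M] [Algebra k M] : ((p * e : ℕ) : M) = 0 := by
  rw [← map_natCast (algebraMap k M), Nat.cast_mul, CharP.cast_eq_zero, zero_mul, map_zero]

variable [Fact p.Prime] [NeZero e]

lemma natCast_sub_one {M : Type*} [CommRing M] [Algebra k M] : ((p * e - 1 : ℕ) : M) = -1 := by
  have hn : 1 ≤ p * e := Nat.one_le_iff_ne_zero.mpr
    (mul_ne_zero (Fact.out : p.Prime).ne_zero (NeZero.ne e))
  rw [Nat.cast_sub hn, natCast_mul_eq_zero (k := k), Nat.cast_one, zero_sub]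

/-- The vector field on `U ∩ V` with a given value on `z`. -/
lemma exists_dual_lift {M : Type*} [CommRing M] [Algebra k M] (g : PuncturedRing k p e →ₐ[k] M)
    (γ : M) : ∃ Φ : PuncturedRing k p e →ₐ[k] DualNumber M,
      (∀ a, (Φ a).fst = g a) ∧ (Φ (z k p e)).snd = γ := by
  -- In characteristic p the differential of the equation is -dy = -z^(pe - 2) dz. The value γ on z
  -- is therefore free and forces the value z^(pe - 2) γ on y.
  let a : DualNumber M := TrivSqZeroExt.inl (g (y k p e)) +
    TrivSqZeroExt.inr (g (z k p e) ^ (p * e - 2) * γ)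
  let b : DualNumber M := TrivSqZeroExt.inl (g (z k p e)) + TrivSqZeroExt.inr γ
  have hab : a ^ (p * e) - a = b ^ (p * e - 1) := by
    ext
    · simp only [a, b, TrivSqZeroExt.fst_sub, TrivSqZeroExt.fst_pow, TrivSqZeroExt.fst_add,
        TrivSqZeroExt.fst_inl, TrivSqZeroExt.fst_inr, add_zero]
      rw [← map_pow, ← map_sub, yz_eq, map_pow]
    · simp only [a, b, TrivSqZeroExt.snd_sub, TrivSqZeroExt.snd_pow, TrivSqZeroExt.fst_add,
        TrivSqZeroExt.fst_inl, TrivSqZeroExt.fst_inr, add_zero, TrivSqZeroExt.snd_add,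
        TrivSqZeroExt.snd_inl, TrivSqZeroExt.snd_inr, zero_add, smul_eq_mul]
      rw [nsmul_eq_mul, nsmul_eq_mul, natCast_mul_eq_zero (k := k), natCast_sub_one (k := k),
        Nat.pred_eq_sub_one, Nat.pred_eq_sub_one, Nat.sub_sub]
      ring
  let Φ₀ : CurveRing k p e →ₐ[k] DualNumber M := curveLift a b hab
  have hunit : ∀ q : Submonoid.powers (yAff k p e * zAff k p e), IsUnit (Φ₀ q) := by
    rintro ⟨_, m, rfl⟩
    have : IsUnit (Φ₀ (yAff k p e * zAff k p e)) := by
      rw [TrivSqZeroExt.isUnit_iff_isUnit_fst, map_mul, TrivSqZeroExt.fst_mul, curveLift_yAff,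
        curveLift_zAff]
      simp only [a, b, TrivSqZeroExt.fst_add, TrivSqZeroExt.fst_inl, TrivSqZeroExt.fst_inr,
        add_zero]
      exact ((y k p e).isUnit.map g).mul ((z k p e).isUnit.map g)
    simpa using this.pow m
  let Φ : PuncturedRing k p e →ₐ[k] DualNumber M :=
    IsLocalization.liftAlgHom (M := Submonoid.powers (yAff k p e * zAff k p e)) (f := Φ₀) hunit
  have hΦ : ∀ q, Φ (algebraMap (CurveRing k p e) (PuncturedRing k p e) q) = Φ₀ q := fun q =>
    IsLocalization.lift_eq _ q
  have hy : Φ (y k p e) = a := (hΦ _).trans (curveLift_yAff _ _ _)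
  have hz : Φ (z k p e) = b := (hΦ _).trans (curveLift_zAff _ _ _)
  refine ⟨Φ, fun q => ?_, by rw [hz]; simp [b]⟩
  have : (TrivSqZeroExt.fstHom k M M).comp Φ = g := by
    refine punctured_hom_ext ?_ ?_
    · change (Φ (y k p e)).fst = _
      rw [hy]; simp [a]
    · change (Φ (z k p e)).fst = _
      rw [hz]; simp [b]
  exact DFunLike.congr_fun this q

end

end Curve

end TangoRaynaud

/-! ### Integrality of the cyclic cover -/

namespace TangoRaynaud

section Cover

variable {k : Type u} [Field k] {p e : ℕ} (ξ : TangoCocycle k p e) (l : ℕ)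

/-- The quotient map `𝒪(U ∩ V)[w, s] → 𝒪(U ∩ V)[w, s] / (s ^ l - (w ^ p - aU))`, followed by the
localization. -/
noncomputable def bivariateToCover :
    Polynomial (Polynomial (PuncturedRing k p e)) →+* CoverRing ξ l :=
  (algebraMap (AffineCoverRing ξ l) (CoverRing ξ l)).comp (AdjoinRoot.mk (coverPoly ξ l))

lemma coverPoly_monic (hl : 0 < l) : (coverPoly ξ l).Monic :=
  Polynomial.monic_X_pow_sub_C _ hl.ne'

/-- The polynomial defining the cover is monic of degree l in s, so remainders of degree less than l
are unique. -/
lemma sum_root_injective [Nontrivial (PuncturedRing k p e)] (hl : 0 < l)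
    {P P' : Polynomial (Polynomial (PuncturedRing k p e))}
    (hP : P.degree < l) (hP' : P'.degree < l)
    (h : AdjoinRoot.mk (coverPoly ξ l) P = AdjoinRoot.mk (coverPoly ξ l) P') : P = P' := by
  have hmonic := coverPoly_monic ξ l hl
  rw [AdjoinRoot.mk_eq_mk] at h
  by_contra hne
  have hlt : (P - P').degree < (coverPoly ξ l).degree := by
    rw [coverPoly, Polynomial.degree_X_pow_sub_C hl]
    exact (Polynomial.degree_sub_le _ _).trans_lt (max_lt hP hP')
  exact hmonic.not_dvd_of_degree_lt (sub_ne_zero.mpr hne) hlt h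

lemma polyToAffineCover_injective [Nontrivial (PuncturedRing k p e)] (hl : 0 < l) :
    Function.Injective (polyToAffineCover ξ l) := by
  intro P P' h
  have hdeg : ∀ P : Polynomial (PuncturedRing k p e), (Polynomial.C P).degree < l := fun P =>
    Polynomial.degree_C_le.trans_lt (by exact_mod_cast hl)
  exact Polynomial.C_injective (sum_root_injective ξ l hl (hdeg P) (hdeg P') h)

lemma fAff_ne_zero [Nontrivial (PuncturedRing k p e)] (hl : 0 < l) (j : Patch) :
    fAff ξ l j ≠ 0 := by
  have h := polyToAffineCover_injective ξ l hl
  rcases j with _ | _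
  · rw [fAff, Ne, map_eq_zero_iff _ h]
    exact Polynomial.X_ne_zero
  · rw [fAff, Ne, map_eq_zero_iff _ h]
    exact Polynomial.X_sub_C_ne_zero _

variable [IsAlgClosed k] [Fact p.Prime] [CharP k p] [NeZero e]

/-- If aU = (a / b)^p, then a^p = aU b^p. A derivation with value 1 on z kills p-th powers and takes
the value 1 on aU because d aU = dz; it would give b^p = 0. This is where the inseparability of G
over C enters. -/
lemma aU_ne_pow (h : 2 ≤ p * e) {K₀ : Type*} [Field K₀] [Algebra (PuncturedRing k p e) K₀]
    [IsFractionRing (PuncturedRing k p e) K₀] (β : K₀) :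
    β ^ p ≠ algebraMap (PuncturedRing k p e) K₀ ξ.aU := by
  have := isDomain_puncturedRing (k := k) h
  have hp : (p : PuncturedRing k p e) = 0 := by
    rw [← map_natCast (algebraMap k (PuncturedRing k p e)), CharP.cast_eq_zero, map_zero]
  intro hβ
  obtain ⟨a, b, hb, rfl⟩ := IsFractionRing.div_surjective (A := PuncturedRing k p e) β
  have hb0 : b ≠ 0 := nonZeroDivisors.ne_zero hb
  have hinj := IsFractionRing.injective (PuncturedRing k p e) K₀
  have hab : a ^ p = ξ.aU * b ^ p := by
    apply hinj
    have hb' : algebraMap (PuncturedRing k p e) K₀ b ≠ 0 := by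
      rwa [Ne, map_eq_zero_iff _ hinj]
    rw [map_mul, map_pow, map_pow, ← hβ, div_pow, div_mul_cancel₀ _ (pow_ne_zero _ hb')]
  obtain ⟨Φ, hΦ, hz⟩ := exists_dual_lift (AlgHom.id k (PuncturedRing k p e)) 1
  have hpow : ∀ c, (Φ (c ^ p)).snd = 0 := by
    intro c
    rw [map_pow, TrivSqZeroExt.snd_pow, nsmul_eq_mul, hp, zero_mul]
  have h1 := congrArg (fun c => (Φ c).snd) hab
  simp only [hpow, map_mul, TrivSqZeroExt.snd_mul] at h1
  rw [smul_zero, zero_add, DualNumber.snd_eq_of_D_eq Φ ξ.d_aU, hz,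
    MulOpposite.smul_eq_mul_unop, MulOpposite.unop_op, one_mul, hΦ] at h1
  exact pow_ne_zero p hb0 h1.symm

/-- Over the fraction field of 𝒪(U ∩ V) the polynomial w^p - aU is prime, since aU is not a p-th
power, and s^l - (w^p - aU) is Eisenstein at it. Primality descends because divisibility by a monic
polynomial can be tested after an injective extension of coefficients. -/
lemma coverPoly_prime (h : 2 ≤ p * e) (hl : 0 < l) : Prime (coverPoly ξ l) := by
  have := isDomain_puncturedRing (k := k) h
  let K₀ := FractionRing (PuncturedRing k p e)
  let g : Polynomial (PuncturedRing k p e) →+* Polynomial K₀ :=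
    Polynomial.mapRingHom (algebraMap (PuncturedRing k p e) K₀)
  have hg : Function.Injective g := by
    rw [Polynomial.coe_mapRingHom]
    exact Polynomial.map_injective _ (IsFractionRing.injective _ _)
  have hmonic := coverPoly_monic ξ l hl
  have hirr : Irreducible ((coverPoly ξ l).map g) := by
    have hbase : Prime (.X ^ p - .C (algebraMap (PuncturedRing k p e) K₀ ξ.aU) :
        Polynomial K₀) := by
      rw [← irreducible_iff_prime]
      exact X_pow_sub_C_irreducible_of_prime Fact.out (aU_ne_pow ξ h)
    have := Polynomial.irreducible_X_pow_sub_C_of_prime hbase dvd_rfl (by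
      intro h2
      have := pow_dvd_pow_iff (n := 2) (m := 1) hbase.ne_zero hbase.not_isUnit
      rw [pow_one] at this
      exact absurd (this.mp h2) (by norm_num)) hl
    rw [coverPoly, Polynomial.map_sub, Polynomial.map_pow, Polynomial.map_X, Polynomial.map_C]
    simpa [g] using this
  have hprime : Prime ((coverPoly ξ l).map g) := irreducible_iff_prime.mp hirr
  refine ⟨hmonic.ne_zero, ?_, ?_⟩
  · intro hu
    exact hprime.not_isUnit (hu.map (Polynomial.mapRingHom g))
  · intro a b hab
    rw [← Polynomial.map_dvd_map g hg hmonic, ← Polynomial.map_dvd_map g hg hmonic]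
    apply hprime.dvd_or_dvd
    rw [← Polynomial.map_mul]
    exact Polynomial.map_dvd _ hab

lemma isDomain_affineCoverRing (h : 2 ≤ p * e) (hl : 0 < l) : IsDomain (AffineCoverRing ξ l) := by
  have : (Ideal.span {coverPoly ξ l}).IsPrime :=
    (Ideal.span_singleton_prime (coverPoly_prime ξ l h hl).ne_zero).mpr (coverPoly_prime ξ l h hl)
  exact inferInstanceAs (IsDomain (_ ⧸ Ideal.span {coverPoly ξ l}))

lemma f_powers_le (h : 2 ≤ p * e) (hl : 0 < l) :
    Submonoid.powers (fAff ξ l .U * fAff ξ l .V) ≤ nonZeroDivisors (AffineCoverRing ξ l) := by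
  have := isDomain_puncturedRing (k := k) h
  have := isDomain_affineCoverRing ξ l h hl
  exact powers_le_nonZeroDivisors_of_noZeroDivisors
    (mul_ne_zero (fAff_ne_zero ξ l hl _) (fAff_ne_zero ξ l hl _))

lemma isDomain_coverRing (h : 2 ≤ p * e) (hl : 0 < l) : IsDomain (CoverRing ξ l) := by
  have := isDomain_affineCoverRing ξ l h hl
  exact IsLocalization.isDomain_of_le_nonZeroDivisors
    (M := Submonoid.powers (fAff ξ l .U * fAff ξ l .V)) (CoverRing ξ l) (f_powers_le ξ l h hl)

lemma algebraMap_cover_injective (h : 2 ≤ p * e) (hl : 0 < l) :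
    Function.Injective (algebraMap (AffineCoverRing ξ l) (CoverRing ξ l)) :=
  IsLocalization.injective (CoverRing ξ l) (f_powers_le ξ l h hl)

lemma polyToCover_injective (h : 2 ≤ p * e) (hl : 0 < l) :
    Function.Injective (polyToCover ξ l) := by
  have := isDomain_puncturedRing (k := k) h
  exact (algebraMap_cover_injective ξ l h hl).comp (polyToAffineCover_injective ξ l hl)

lemma toCover_injective (h : 2 ≤ p * e) (hl : 0 < l) : Function.Injective (toCover ξ l) :=
  (polyToCover_injective ξ l h hl).comp Polynomial.C_injective

end Cover

/-! ### Generation of the ring of the total intersection by the four charts -/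

section Overlap

variable {k : Type u} [Field k] {p e : ℕ} (ξ : TangoCocycle k p e) (l : ℕ)

instance : Fintype Patch where
  elems := ⟨{Patch.U, Patch.V}, by simp⟩
  complete j := by rcases j with _ | _ <;> simp

instance : Inhabited Patch := ⟨.U⟩

variable [Fact p.Prime] [NeZero e]

/-- The coordinate rings of the charts generate that of the intersection of all charts. -/
lemma overlap_surfaceChart : Atlas.overlap (surfaceChart ξ l) Finset.univ = ⊤ := by
  set T := Atlas.overlap (surfaceChart ξ l) Finset.univ
  have hT : ∀ a, surfaceChart ξ l a ≤ T := fun a => Atlas.le_overlap _ (Finset.mem_univ a)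
  have hP : ∀ a, Atlas.projChart (baseChart ξ l) (gen ξ l (e * (p * e - 3))) (frame ξ l) a ≤ T :=
    fun a => le_sup_left.trans (hT a)
  have hB : ∀ j, baseChart ξ l j ≤ T := fun j => le_sup_left.trans (hP (j, true))
  have hC : ∀ a, toCover ξ l a ∈ T := fun a => sup_le (hB .U) (hB .V) (toCover_mem ξ l a)
  -- The generator of 𝒪_C(-D) over U is 1, so the affine chart over U supplies w itself; the same
  -- holds for s below.
  have hf : (frame ξ l .U : CoverRing ξ l) ∈ T := by
    have h1 : ((frame ξ l .U / gen ξ l (e * (p * e - 3)) .U : (CoverRing ξ l)ˣ) : CoverRing ξ l) ∈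
        T := hP (.U, false) ((le_sup_right : Algebra.adjoin k _ ≤ _)
          (Algebra.subset_adjoin (by right; rfl)))
    have h2 : gen ξ l (e * (p * e - 3)) .U = 1 := map_one _
    rwa [h2, div_one] at h1
  have hfinv : ∀ j, (((frame ξ l j)⁻¹ : (CoverRing ξ l)ˣ) : CoverRing ξ l) ∈ T := by
    intro j
    have h1 : ((gen ξ l (e * (p * e - 3)) j / frame ξ l j : (CoverRing ξ l)ˣ) : CoverRing ξ l) ∈
        T := hP (j, true) ((le_sup_right : Algebra.adjoin k _ ≤ _)
          (Algebra.subset_adjoin (by left; rfl)))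
    have h2 : (((gen ξ l (e * (p * e - 3)) j)⁻¹ : (CoverRing ξ l)ˣ) : CoverRing ξ l) ∈ T :=
      hC (((idealGen k p e (e * (p * e - 3)) j)⁻¹ : (PuncturedRing k p e)ˣ))
    have := mul_mem h2 h1
    rwa [← Units.val_mul, div_eq_mul_inv, inv_mul_cancel_left] at this
  have hs : s ξ l ∈ T := by
    have h1 : s ξ l * ((gen ξ l (e / l * (p * e - 3)) .U /
        gen ξ l (e * (p * e - 3)) .U ^ ((p + 1) / l) : (CoverRing ξ l)ˣ) : CoverRing ξ l) ∈ T :=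
      hT (.U, false) ((le_sup_right : Algebra.adjoin k _ ≤ _) (Algebra.subset_adjoin rfl))
    have h2 : ∀ n, gen ξ l n .U = 1 := fun n => map_one _
    rwa [h2, h2, one_pow, div_one, Units.val_one, mul_one] at h1
  have hpoly : ∀ P, polyToCover ξ l P ∈ T := by
    intro P
    induction P using Polynomial.induction_on' with
    | add P R hP hR => rw [map_add]; exact add_mem hP hR
    | monomial n a =>
      rw [← Polynomial.C_mul_X_pow_eq_monomial, map_mul, map_pow]
      exact mul_mem (hC a) (pow_mem hf n)
  have haff : ∀ q, algebraMap (AffineCoverRing ξ l) (CoverRing ξ l) q ∈ T := by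
    intro q
    obtain ⟨P, rfl⟩ := AdjoinRoot.mk_surjective (g := coverPoly ξ l) q
    change bivariateToCover ξ l P ∈ T
    induction P using Polynomial.induction_on' with
    | add P R hP hR => rw [map_add]; exact add_mem hP hR
    | monomial n a =>
      rw [← Polynomial.C_mul_X_pow_eq_monomial, map_mul, map_pow]
      exact mul_mem (hpoly a) (pow_mem hs n)
  rw [eq_top_iff]
  rintro q -
  obtain ⟨a, ⟨_, m, rfl⟩, rfl⟩ := IsLocalization.exists_mk'_eq
    (Submonoid.powers (fAff ξ l .U * fAff ξ l .V)) q
  have hinv : IsLocalization.mk' (CoverRing ξ l) a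
      (⟨_, m, rfl⟩ : Submonoid.powers (fAff ξ l .U * fAff ξ l .V)) =
      algebraMap (AffineCoverRing ξ l) (CoverRing ξ l) a *
        (((frame ξ l .U)⁻¹ : (CoverRing ξ l)ˣ) * ((frame ξ l .V)⁻¹ : (CoverRing ξ l)ˣ)) ^ m := by
    rw [IsLocalization.mk'_eq_iff_eq_mul]
    have : algebraMap (AffineCoverRing ξ l) (CoverRing ξ l) ((fAff ξ l .U * fAff ξ l .V) ^ m) =
        ((frame ξ l .U : CoverRing ξ l) * frame ξ l .V) ^ m := by
      rw [map_pow, map_mul]; rfl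
    change _ = _ * algebraMap (AffineCoverRing ξ l) (CoverRing ξ l) _
    rw [this, mul_assoc, ← mul_pow]
    have h1 : ((((frame ξ l .U)⁻¹ : (CoverRing ξ l)ˣ) : CoverRing ξ l) *
        ((frame ξ l .V)⁻¹ : (CoverRing ξ l)ˣ)) *
          ((frame ξ l .U : CoverRing ξ l) * frame ξ l .V) = 1 := by
      rw [mul_mul_mul_comm, Units.inv_mul, Units.inv_mul, one_mul]
    rw [h1, one_pow, mul_one]
  rw [hinv]
  exact mul_mem (haff a) (pow_mem (mul_mem (hfinv _) (hfinv _)) _)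

end Overlap

end TangoRaynaud

/-! ## Two-forms on a field and lattices of two-forms -/

namespace Canonical

open scoped TensorProduct

section Wedge

variable (k : Type u) {K : Type u} [Field k] [Field K] [Algebra k K]

/-- The two-form `x ∧ y`. -/
noncomputable def wedge (x y : Ω[K⁄k]) : ⋀[K]^2 (Ω[K⁄k]) := exteriorPower.ιMulti K 2 ![x, y]

variable {k}

lemma ιMulti_eq_wedge (m : Fin 2 → Ω[K⁄k]) :
    exteriorPower.ιMulti K 2 m = wedge k (m 0) (m 1) := by
  rw [wedge]
  congr 1
  funext i
  fin_cases i <;> rfl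

@[simp] lemma wedge_self (x : Ω[K⁄k]) : wedge k x x = 0 :=
  AlternatingMap.map_eq_zero_of_eq _ _ (i := 0) (j := 1) rfl (by simp)

lemma wedge_swap (x y : Ω[K⁄k]) : wedge k x y = -wedge k y x := by
  have := AlternatingMap.map_swap (exteriorPower.ιMulti K 2) ![y, x] (i := 0) (j := 1) (by simp)
  rw [wedge, wedge, ← this]
  congr 1
  funext i
  fin_cases i <;> rfl

lemma wedge_add_left (x x' y : Ω[K⁄k]) : wedge k (x + x') y = wedge k x y + wedge k x' y :=
  AlternatingMap.map_vecCons_add _ _ _ _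

lemma wedge_smul_left (c : K) (x y : Ω[K⁄k]) : wedge k (c • x) y = c • wedge k x y :=
  AlternatingMap.map_vecCons_smul _ _ _ _

lemma wedge_add_right (x y y' : Ω[K⁄k]) : wedge k x (y + y') = wedge k x y + wedge k x y' := by
  rw [wedge_swap, wedge_add_left, neg_add, ← wedge_swap, ← wedge_swap]

lemma wedge_smul_right (c : K) (x y : Ω[K⁄k]) : wedge k x (c • y) = c • wedge k x y := by
  rw [wedge_swap, wedge_smul_left, wedge_swap x y]
  module

lemma wedge_combination (f g h f' g' h' : K) (x y z : Ω[K⁄k]) :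
    wedge k (f • x + g • y + h • z) (f' • x + g' • y + h' • z) =
      (f * g' - g * f') • wedge k x y + (g * h' - h * g') • wedge k y z +
        (f * h' - h * f') • wedge k x z := by
  simp only [wedge_add_left, wedge_add_right, wedge_smul_left, wedge_smul_right, wedge_self,
    smul_zero, wedge_swap y x, wedge_swap z x, wedge_swap z y]
  module

/-- Two derivations that separate `f` and `g` show that `df ∧ dg` does not vanish. -/
lemma wedge_ne_zero {f g : K} (D₁ D₂ : Derivation k K K) (h₁ : D₁ f = 1) (h₁' : D₁ g = 0)
    (h₂ : D₂ f = 0) (h₂' : D₂ g = 1) :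
    wedge k (KaehlerDifferential.D k K f) (KaehlerDifferential.D k K g) ≠ 0 := by
  let L : Ω[K⁄k] →ₗ[K] (Fin 2 → K) :=
    LinearMap.pi ![D₁.liftKaehlerDifferential, D₂.liftKaehlerDifferential]
  let φ : Ω[K⁄k] [⋀^Fin 2]→ₗ[K] K := Matrix.detRowAlternating.compLinearMap L
  intro h
  have h0 := congrArg (exteriorPower.alternatingMapLinearEquiv φ) h
  rw [wedge, exteriorPower.alternatingMapLinearEquiv_apply_ιMulti, map_zero] at h0
  have h1 : φ ![KaehlerDifferential.D k K f, KaehlerDifferential.D k K g] = 1 := by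
    refine (Matrix.det_fin_two _).trans ?_
    simp [L, h₁, h₁', h₂, h₂']
  exact one_ne_zero (h1.symm.trans h0)

variable (k) in
/-- The `n`-th tensor power of a two-form. -/
noncomputable def formPow (n : ℕ) (ω : ⋀[K]^2 (Ω[K⁄k])) : PluriForm k K 2 n :=
  PiTensorProduct.tprod K fun _ => ω

/-- A linear functional with value 1 on ω, multiplied over the n tensor factors, takes the value 1
on the tensor power. -/
lemma formPow_ne_zero (n : ℕ) {ω : ⋀[K]^2 (Ω[K⁄k])} (h : ω ≠ 0) : formPow k n ω ≠ 0 := by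
  obtain ⟨f, hf⟩ := Module.Projective.exists_dual_eq_one K h
  intro h0
  have h1 := congrArg (PiTensorProduct.lift
    ((MultilinearMap.mkPiAlgebra K (Fin n) K).compLinearMap fun _ => f)) h0
  rw [formPow, PiTensorProduct.lift.tprod, map_zero] at h1
  simp [hf] at h1

lemma tprod_smul (n : ℕ) (c : Fin n → K) (ω : ⋀[K]^2 (Ω[K⁄k])) :
    (PiTensorProduct.tprod K fun i => c i • ω) = (∏ i, c i) • formPow k n ω :=
  MultilinearMap.map_smul_univ _ _ _

lemma formPow_smul (n : ℕ) (c : K) (ω : ⋀[K]^2 (Ω[K⁄k])) :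
    formPow k n (c • ω) = c ^ n • formPow k n ω := by
  rw [formPow, tprod_smul n (fun _ => c)]
  simp

/-- If `ω` generates the two-forms on a local ring, then its powers generate the pluricanonical
forms. -/
lemma stalkLattice_eq_span (O : Subring K) (n : ℕ) (ω : ⋀[K]^2 (Ω[K⁄k]))
    (h₁ : ∀ f ∈ O, ∀ g ∈ O, ∃ c ∈ O,
      wedge k (KaehlerDifferential.D k K f) (KaehlerDifferential.D k K g) = c • ω)
    (h₂ : ∃ f ∈ O, ∃ g ∈ O, ∃ c ∈ O,
      ω = c • wedge k (KaehlerDifferential.D k K f) (KaehlerDifferential.D k K g)) :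
    stalkLattice k O 2 n = Submodule.span O {formPow k n ω} := by
  refine le_antisymm (Submodule.span_le.mpr ?_) ?_
  · rintro _ ⟨a, rfl⟩
    choose c hcO hc using fun i => h₁ _ (a i 0).2 _ (a i 1).2
    rw [SetLike.mem_coe, Submodule.mem_span_singleton]
    refine ⟨∏ i, ⟨c i, hcO i⟩, ?_⟩
    simp only [ιMulti_eq_wedge, hc]
    rw [tprod_smul, Subring.smul_def]
    congr 1
    simp
  · rw [Submodule.span_singleton_le_iff_mem]
    obtain ⟨f, hf, g, hg, c, hc, rfl⟩ := h₂
    rw [formPow_smul]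
    have hmem : formPow k n (wedge k (KaehlerDifferential.D k K f) (KaehlerDifferential.D k K g)) ∈
        stalkLattice k O 2 n := by
      refine Submodule.subset_span ⟨fun _ => ![⟨f, hf⟩, ⟨g, hg⟩], ?_⟩
      simp only [ιMulti_eq_wedge]
      rfl
    have := Submodule.smul_mem _ ((⟨c, hc⟩ : O) ^ n) hmem
    rwa [Subring.smul_def] at this

/-- Lattices of rank one in the same line are compared by the ratio of their generators: they agree
when the ratio is a unit. Thus non-vanishing of a form becomes invertibility of a function. -/
lemma span_smul_eq_iff {V : Type*} [AddCommGroup V] [Module K V] (O : Subring K) {v : V}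
    (hv : v ≠ 0) {a b : K} (ha : a ≠ 0) (hb : b / a ∈ O) :
    Submodule.span O {a • v} = Submodule.span O {b • v} ↔ ∃ c ∈ O, b / a * c = 1 := by
  constructor
  · intro h
    have : a • v ∈ Submodule.span O {b • v} := h ▸ Submodule.mem_span_singleton_self _
    obtain ⟨c, hc⟩ := Submodule.mem_span_singleton.mp this
    refine ⟨c, c.2, ?_⟩
    rw [Subring.smul_def, smul_smul] at hc
    have := smul_left_injective K hv hc
    field_simp
    simpa [mul_comm] using this
  · rintro ⟨c, hc, h⟩
    refine le_antisymm ?_ ?_ <;> rw [Submodule.span_singleton_le_iff_mem,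
      Submodule.mem_span_singleton]
    · refine ⟨⟨c, hc⟩, ?_⟩
      rw [Subring.smul_def, smul_smul]
      congr 1
      field_simp at h
      simpa [mul_comm] using h
    · refine ⟨⟨_, hb⟩, ?_⟩
      rw [Subring.smul_def, smul_smul, div_mul_cancel₀ _ ha]

lemma smul_mem_span_iff {V : Type*} [AddCommGroup V] [Module K V] (O : Subring K) {v : V}
    (hv : v ≠ 0) {a b : K} (ha : a ≠ 0) : b • v ∈ Submodule.span O {a • v} ↔ b / a ∈ O := by
  rw [Submodule.mem_span_singleton]
  constructor
  · rintro ⟨c, hc⟩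
    rw [Subring.smul_def, smul_smul] at hc
    rw [← smul_left_injective K hv hc, mul_div_cancel_right₀ _ ha]
    exact c.2
  · intro h
    exact ⟨⟨_, h⟩, by rw [Subring.smul_def, smul_smul, div_mul_cancel₀ _ ha]⟩

/-- The combinations of three forms with coefficients in a ring. -/
noncomputable def combinations (O : Subring K) (x y z : Ω[K⁄k]) : AddSubgroup (Ω[K⁄k]) where
  carrier := {m | ∃ f ∈ O, ∃ g ∈ O, ∃ h ∈ O, m = f • x + g • y + h • z}
  add_mem' := by
    rintro _ _ ⟨f, hf, g, hg, h, hh, rfl⟩ ⟨f', hf', g', hg', h', hh', rfl⟩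
    exact ⟨_, add_mem hf hf', _, add_mem hg hg', _, add_mem hh hh', by module⟩
  zero_mem' := ⟨0, zero_mem _, 0, zero_mem _, 0, zero_mem _, by module⟩
  neg_mem' := by
    rintro _ ⟨f, hf, g, hg, h, hh, rfl⟩
    exact ⟨_, neg_mem hf, _, neg_mem hg, _, neg_mem hh, by module⟩

lemma smul_mem_combinations {O : Subring K} {x y z : Ω[K⁄k]} {c : K} (hc : c ∈ O) {m : Ω[K⁄k]}
    (hm : m ∈ combinations O x y z) : c • m ∈ combinations O x y z := by
  obtain ⟨f, hf, g, hg, h, hh, rfl⟩ := hm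
  exact ⟨_, mul_mem hc hf, _, mul_mem hc hg, _, mul_mem hc hh, by module⟩

lemma left_mem_combinations (O : Subring K) (x y z : Ω[K⁄k]) : x ∈ combinations O x y z :=
  ⟨1, one_mem _, 0, zero_mem _, 0, zero_mem _, by module⟩

lemma middle_mem_combinations (O : Subring K) (x y z : Ω[K⁄k]) : y ∈ combinations O x y z :=
  ⟨0, zero_mem _, 1, one_mem _, 0, zero_mem _, by module⟩

lemma right_mem_combinations (O : Subring K) (x y z : Ω[K⁄k]) : z ∈ combinations O x y z :=
  ⟨0, zero_mem _, 0, zero_mem _, 1, one_mem _, by module⟩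

/-- The elements of a ring whose differentials are combinations of three given forms. -/
noncomputable def differentialSubalgebra (O : Subring K) (hO : ∀ c, algebraMap k K c ∈ O)
    (x y z : Ω[K⁄k]) : Subalgebra k K where
  carrier := {f | f ∈ O ∧ KaehlerDifferential.D k K f ∈ combinations O x y z}
  mul_mem' := by
    rintro a b ⟨ha, ha'⟩ ⟨hb, hb'⟩
    refine ⟨mul_mem ha hb, ?_⟩
    rw [Derivation.leibniz]
    exact add_mem (smul_mem_combinations ha hb') (smul_mem_combinations hb ha')
  add_mem' := by
    rintro a b ⟨ha, ha'⟩ ⟨hb, hb'⟩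
    exact ⟨add_mem ha hb, by rw [map_add]; exact add_mem ha' hb'⟩
  algebraMap_mem' c := ⟨hO c, by rw [Derivation.map_algebraMap]; exact zero_mem _⟩

/-- `O` is a ring of fractions of `A`. -/
def IsFractions (A : Set K) (O : Subring K) : Prop :=
  A ⊆ O ∧ ∀ φ ∈ O, ∃ a ∈ A, ∃ b ∈ A, ∃ ψ ∈ O, b * ψ = 1 ∧ φ = a * ψ

/-- The differentials of the elements of a ring of fractions of `A` are combinations of three forms
if those of the elements of `A` are. -/
lemma IsFractions.D_mem_combinations {A : Set K} {O : Subring K} (hO : IsFractions A O)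
    {x y z : Ω[K⁄k]} (hA : ∀ f ∈ A, KaehlerDifferential.D k K f ∈ combinations O x y z)
    (φ : K) (hφ : φ ∈ O) : KaehlerDifferential.D k K φ ∈ combinations O x y z := by
  obtain ⟨a, ha, b, hb, ψ, hψ, hbψ, rfl⟩ := hO.2 φ hφ
  -- The differential of an inverse, obtained by differentiating b ψ = 1; it keeps the coefficients
  -- in O.
  have h1 : KaehlerDifferential.D k K ψ = -(ψ ^ 2 • KaehlerDifferential.D k K b) := by
    have := congrArg (KaehlerDifferential.D k K) hbψ
    rw [Derivation.leibniz, Derivation.map_one_eq_zero] at this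
    have h2 : KaehlerDifferential.D k K ψ = (ψ * b) • KaehlerDifferential.D k K ψ := by
      rw [mul_comm, hbψ, one_smul]
    rw [h2, mul_smul, eq_neg_of_add_eq_zero_left this, smul_neg, smul_smul, pow_two]
  rw [Derivation.leibniz, h1]
  exact add_mem (smul_mem_combinations (hO.1 ha) (neg_mem (smul_mem_combinations
    (pow_mem hψ 2) (hA b hb)))) (smul_mem_combinations hψ (hA a ha))

end Wedge

end Canonical

/-! ### Two-forms on a cyclic cover s^l = v^p - b -/

namespace Canonical

section CyclicCover

variable {k K : Type u} [Field k] [Field K] [Algebra k K]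

local notation "d" => KaehlerDifferential.D k K

lemma wedge_combination₂ (f g f' g' : K) (x y : Ω[K⁄k]) :
    wedge k (f • x + g • y) (f' • x + g' • y) = (f * g' - g * f') • wedge k x y := by
  simp only [wedge_add_left, wedge_add_right, wedge_smul_left, wedge_smul_right, wedge_self,
    smul_zero, wedge_swap y x]
  module

/-- `R` is the coordinate ring of an affine curve with differentials generated by `db`, and
`s ^ l = v ^ p - b`. -/
structure CyclicData (R : Subalgebra k K) (b v s : K) (p l : ℕ) : Prop where
  b_mem : b ∈ R
  D_base : ∀ f ∈ R, ∃ g ∈ R, d f = g • d b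
  s_pow : s ^ l = v ^ p - b
  cast_p : (p : K) = 0

variable {R : Subalgebra k K} {b v s : K} {p l : ℕ}

/-- Since d(v^p) = 0 in characteristic p, the equation of the cover gives l s^(l - 1) ds = -db.
Hence dv and ds alone generate the differentials in the affine chart. -/
lemma CyclicData.D_b (H : CyclicData R b v s p l) : d b = (-(l * s ^ (l - 1)) : K) • d s := by
  have h := congrArg (d) H.s_pow
  rw [map_sub, Derivation.leibniz_pow, Derivation.leibniz_pow, ← Nat.cast_smul_eq_nsmul K,
    ← Nat.cast_smul_eq_nsmul K, H.cast_p, zero_smul, zero_sub] at h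
  rw [← neg_eq_iff_eq_neg.mpr h, smul_smul, neg_smul]

/-- The two-forms on the cyclic cover away from the divisor at infinity. -/
lemma CyclicData.stalkLattice_affine (H : CyclicData R b v s p l) {A : Subalgebra k K} (hR : R ≤ A)
    (hv : v ∈ A) (hs : s ∈ A) (hA : A ≤ R ⊔ Algebra.adjoin k {v, s}) {O : Subring K} (hO : IsFractions (A : Set K) O)
    (n : ℕ) : stalkLattice k O 2 n = Submodule.span O {formPow k n (wedge k (d v) (d s))} := by
  have hcO : ∀ c, algebraMap k K c ∈ O := fun c => hO.1 (Subalgebra.algebraMap_mem A c)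
  have hle : A ≤ differentialSubalgebra O hcO (d v) (d s) 0 := by
    refine hA.trans (sup_le ?_ (Algebra.adjoin_le ?_))
    · intro f hf
      obtain ⟨g, hg, hfg⟩ := H.D_base f hf
      refine ⟨hO.1 (hR hf), ?_⟩
      rw [hfg, H.D_b]
      refine smul_mem_combinations (hO.1 (hR hg)) (smul_mem_combinations ?_
        (middle_mem_combinations _ _ _ _))
      exact neg_mem (mul_mem (natCast_mem _ _) (pow_mem (hO.1 hs) _))
    · rintro f (rfl | rfl)
      · exact ⟨hO.1 hv, left_mem_combinations _ _ _ _⟩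
      · exact ⟨hO.1 hs, middle_mem_combinations _ _ _ _⟩
  have hD := hO.D_mem_combinations fun f hf => (hle hf).2
  refine stalkLattice_eq_span O n _ ?_ ?_
  · intro f hf g hg
    obtain ⟨f₁, hf₁, f₂, hf₂, f₃, hf₃, h₁⟩ := hD f hf
    obtain ⟨g₁, hg₁, g₂, hg₂, g₃, hg₃, h₂⟩ := hD g hg
    refine ⟨f₁ * g₂ - f₂ * g₁, sub_mem (mul_mem hf₁ hg₂) (mul_mem hf₂ hg₁), ?_⟩
    rw [h₁, h₂, smul_zero, add_zero, smul_zero, add_zero, wedge_combination₂]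
  · exact ⟨v, hO.1 hv, s, hO.1 hs, 1, one_mem _, by rw [one_smul]⟩

/-- The two-forms on the cyclic cover near the divisor at infinity. -/
lemma CyclicData.stalkLattice_infinity (H : CyclicData R b v s p l) {r a : ℕ}
    (hrl : r * l = p + 1) (ha : a + r + 1 = p) (hv : v ≠ 0) {A : Subalgebra k K} (hR : R ≤ A) (hV : v⁻¹ ∈ A) (hσ : s * v⁻¹ ^ r ∈ A)
    (hA : A ≤ R ⊔ Algebra.adjoin k {v⁻¹, s * v⁻¹ ^ r}) {O : Subring K} (hloc : IsLocalRing O)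
    (hO : IsFractions (A : Set K) O) (n : ℕ) :
    stalkLattice k O 2 n = Submodule.span O {formPow k n (v ^ a • wedge k (d v) (d s))} := by
  have hcO : ∀ c, algebraMap k K c ∈ O := fun c => hO.1 (Subalgebra.algebraMap_mem A c)
  have hb := hO.1 (hR H.b_mem)
  -- Both r and l are nonzero because their product is p + 1. From here on r + 1 and l + 1 stand for
  -- the former r and l, which removes truncated subtraction from the exponents.
  obtain ⟨r, rfl⟩ : ∃ r', r = r' + 1 := ⟨r - 1, by
    have : r ≠ 0 := by rintro rfl; omega
    omega⟩
  obtain ⟨l, rfl⟩ : ∃ l', l = l' + 1 := ⟨l - 1, by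
    have : l ≠ 0 := by rintro rfl; omega
    omega⟩
  have hrl' : (r + 1) * l = a + 2 := by
    have : (r + 1) * (l + 1) = (r + 1) * l + (r + 1) := by ring
    omega
  set V : K := v⁻¹ with hVdef
  have hvV : v * V = 1 := mul_inv_cancel₀ hv
  have hvVpow : ∀ m, v ^ m * V ^ m = 1 := fun m => by rw [← mul_pow, hvV, one_pow]
  set σ : K := s * V ^ (r + 1) with hσdef
  have hdV : d V = (-V ^ 2) • d v + (0 : K) • d s := by
    rw [hVdef, Derivation.leibniz_inv]; module
  have hdb : d b = (0 : K) • d v + (-((l + 1 : ℕ) * s ^ l) : K) • d s := by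
    rw [H.D_b, Nat.add_sub_cancel]; module
  have hdσ : d σ = (-((r + 1 : ℕ) * s * V ^ (r + 2))) • d v + V ^ (r + 1) • d s := by
    rw [hσdef, Derivation.leibniz, Derivation.leibniz_pow, ← Nat.cast_smul_eq_nsmul K, hdV,
      Nat.add_sub_cancel]
    module
  set ω := v ^ a • wedge k (d v) (d s) with hω
  have hcast : ((r + 1 : ℕ) : K) * ((l + 1 : ℕ) : K) = 1 := by
    rw [← Nat.cast_mul, hrl, Nat.cast_add, H.cast_p, Nat.cast_one, zero_add]
  set B : K := 1 - b * V ^ p with hB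
  -- The equation at infinity is σ^(l + 1) = V - b V^(p + 1). So db, dV, dσ satisfy one linear
  -- relation, and their pairwise products are multiples of one form ω, with coefficients the
  -- partial derivatives of that equation up to sign.
  have h1 : wedge k (d V) (d σ) = (-V ^ (p + 1)) • ω := by
    rw [hdV, hdσ, wedge_combination₂, hω, smul_smul]
    congr 1
    have : p + 1 = a + (r + 3) := by omega
    rw [this, pow_add V a]
    linear_combination V ^ (r + 3) * hvVpow a
  have h2 : wedge k (d b) (d V) = (-((l + 1 : ℕ) * σ ^ l)) • ω := by
    rw [hdV, hdb, wedge_combination₂, hω, smul_smul]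
    congr 1
    rw [hσdef, mul_pow, ← pow_mul, hrl', pow_add V a]
    linear_combination (((l + 1 : ℕ) : K) * s ^ l * V ^ 2) * hvVpow a
  have h3 : wedge k (d b) (d σ) = (-B) • ω := by
    rw [hdb, hdσ, wedge_combination₂, hω, smul_smul]
    congr 1
    have e1 : s ^ l * s = v ^ p - b := by rw [← pow_succ, H.s_pow]
    have e2 : p = a + (r + 2) := by omega
    have e3 : v ^ p * V ^ (r + 2) = v ^ a := by
      rw [e2, pow_add, mul_assoc, hvVpow, mul_one]
    have e4 : V ^ p * v ^ a = V ^ (r + 2) := by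
      rw [e2, pow_add]; linear_combination V ^ (r + 2) * hvVpow a
    rw [hB]
    linear_combination (-(s ^ l * s * V ^ (r + 2))) * hcast - V ^ (r + 2) * e1 - e3 - b * e4
  have hle : A ≤ differentialSubalgebra O hcO (d b) (d V) (d σ) := by
    refine hA.trans (sup_le ?_ (Algebra.adjoin_le ?_))
    · intro f hf
      obtain ⟨g, hg, hfg⟩ := H.D_base f hf
      refine ⟨hO.1 (hR hf), ?_⟩
      rw [hfg]
      exact smul_mem_combinations (hO.1 (hR hg)) (left_mem_combinations _ _ _ _)
    · rintro f (rfl | rfl)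
      · exact ⟨hO.1 hV, middle_mem_combinations _ _ _ _⟩
      · exact ⟨hO.1 hσ, right_mem_combinations _ _ _ _⟩
  have hD := hO.D_mem_combinations fun f hf => (hle hf).2
  have hVO := hO.1 hV
  have hσO := hO.1 hσ
  have hBO : B ∈ O := sub_mem (one_mem _) (mul_mem hb (pow_mem hVO _))
  refine stalkLattice_eq_span O n _ ?_ ?_
  · intro f hf g hg
    obtain ⟨f₁, hf₁, f₂, hf₂, f₃, hf₃, e₁⟩ := hD f hf
    obtain ⟨g₁, hg₁, g₂, hg₂, g₃, hg₃, e₂⟩ := hD g hg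
    refine ⟨(f₁ * g₂ - f₂ * g₁) * -((l + 1 : ℕ) * σ ^ l) + (f₂ * g₃ - f₃ * g₂) * -V ^ (p + 1) +
      (f₁ * g₃ - f₃ * g₁) * -B, ?_, ?_⟩
    · have hminor : ∀ {x y z w : K}, x ∈ O → y ∈ O → z ∈ O → w ∈ O → x * y - z * w ∈ O :=
        fun hx hy hz hw => sub_mem (mul_mem hx hy) (mul_mem hz hw)
      exact add_mem (add_mem (mul_mem (hminor hf₁ hg₂ hf₂ hg₁)
        (neg_mem (mul_mem (natCast_mem _ _) (pow_mem hσO _))))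
        (mul_mem (hminor hf₂ hg₃ hf₃ hg₂) (neg_mem (pow_mem hVO _))))
        (mul_mem (hminor hf₁ hg₃ hf₃ hg₁) (neg_mem hBO))
    · rw [e₁, e₂, wedge_combination, h1, h2, h3]
      module
  -- Jacobian criterion: (1 - b V^p)(1 + b V^p) + b² V^(2p) = 1, so B or V^(p + 1) is a unit of the
  -- local ring. Accordingly db ∧ dσ or dV ∧ dσ generates the two-forms.
  · have hsum : (⟨B, hBO⟩ * ⟨1 + b * V ^ p, add_mem (one_mem _) (mul_mem hb (pow_mem hVO _))⟩ +
        ⟨V ^ (p + 1), pow_mem hVO _⟩ * ⟨b ^ 2 * V ^ (p - 1), mul_mem (pow_mem hb _)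
          (pow_mem hVO _)⟩ : O) = 1 := by
      apply Subtype.ext
      change B * (1 + b * V ^ p) + V ^ (p + 1) * (b ^ 2 * V ^ (p - 1)) = 1
      obtain ⟨q, rfl⟩ : ∃ q, p = q + 1 := ⟨p - 1, by omega⟩
      rw [hB, Nat.add_sub_cancel]
      ring
    rcases IsLocalRing.isUnit_or_isUnit_of_add_one hsum with hu | hu
    · obtain ⟨⟨c, hc⟩, hBc⟩ := (isUnit_of_mul_isUnit_left hu).exists_right_inv
      have hBc : B * c = 1 := congrArg Subtype.val hBc
      refine ⟨b, hb, σ, hσO, -c, neg_mem hc, ?_⟩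
      rw [h3, smul_smul, neg_mul_neg, mul_comm, hBc, one_smul]
    · obtain ⟨⟨c, hc⟩, hBc⟩ := (isUnit_of_mul_isUnit_left hu).exists_right_inv
      have hBc : V ^ (p + 1) * c = 1 := congrArg Subtype.val hBc
      refine ⟨V, hVO, σ, hσO, -c, neg_mem hc, ?_⟩
      rw [h1, smul_smul, neg_mul_neg, mul_comm, hBc, one_smul]

end CyclicCover

end Canonical

/-! ## Two-forms on the charts of the surface -/

namespace TangoRaynaud

open Canonical

/-- The degree of `D`. -/
abbrev degD (p e : ℕ) : ℕ := e * (p * e - 3)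

/-- The degree of `D / l`. -/
abbrev degRoot (p e l : ℕ) : ℕ := e / l * (p * e - 3)

/-- The coefficient of `T` in the canonical divisor of `S`. -/
abbrev coeffT (p l : ℕ) : ℕ := p - 1 - (p + 1) / l

/-- The degree on the curve of the coefficient of the canonical divisor of `S`. -/
abbrev degK (p e l : ℕ) : ℕ := p * degD p e - degRoot p e l

/-! ### Numerical relations between the degrees -/

section Numbers

variable {p e l : ℕ}

lemma degRoot_mul (hle : l ∣ e) : degRoot p e l * l = degD p e := by
  rw [degRoot, degD, mul_right_comm, Nat.div_mul_cancel hle]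

lemma div_add_one_le (hp : p.Prime) (hl : 2 ≤ l) (hlp : l ∣ p + 1) : (p + 1) / l + 1 ≤ p := by
  obtain ⟨r, hr⟩ := hlp
  rw [hr, Nat.mul_div_cancel_left _ (by omega)]
  have h2 := hp.two_le
  rcases Nat.lt_or_ge p 3 with h3 | h3
  · obtain rfl : p = 2 := by omega
    have : r ≤ 1 := by
      by_contra hlt
      have h4 : l * r = 3 := hr.symm
      have : 2 * 2 ≤ l * r := Nat.mul_le_mul hl (by omega)
      omega
    omega
  · have : 2 * r ≤ l * r := Nat.mul_le_mul_right r hl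
    omega

lemma coeffT_add (hp : p.Prime) (hl : 2 ≤ l) (hlp : l ∣ p + 1) :
    coeffT p l + (p + 1) / l + 1 = p := by
  have := div_add_one_le hp hl hlp
  rw [coeffT]; omega

lemma four_le_mul (hp : p.Prime) [NeZero e] (hl : 2 ≤ l) (hle : l ∣ e) : 4 ≤ p * e := by
  have h1 := Nat.le_of_dvd (Nat.pos_of_ne_zero (NeZero.ne e)) hle
  have : 2 * 2 ≤ p * e := Nat.mul_le_mul hp.two_le (hl.trans h1)
  omega

lemma degD_pos (hp : p.Prime) [NeZero e] (hl : 2 ≤ l) (hle : l ∣ e) : 0 < degD p e := by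
  have := four_le_mul hp hl hle
  exact Nat.mul_pos (Nat.pos_of_ne_zero (NeZero.ne e)) (by omega)

lemma degRoot_lt (hp : p.Prime) [NeZero e] (hl : 2 ≤ l) (hle : l ∣ e) :
    degRoot p e l < degD p e := by
  have h1 := degRoot_mul (p := p) hle
  have h2 := degD_pos hp hl hle
  have : 0 < degRoot p e l := by
    by_contra h
    rw [Nat.eq_zero_of_not_pos h] at h1
    omega
  have : degRoot p e l * 2 ≤ degRoot p e l * l := Nat.mul_le_mul_left _ hl
  omega

/-- This is the positivity of pD - D/l - aD: since a + 1 ≤ p, what remains is at least D - D/l. It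
holds for a = 0 as well, which gives the lower bound for the Kodaira dimension. -/
lemma degK_pos (hp : p.Prime) [NeZero e] (hl : 2 ≤ l) (hle : l ∣ e) :
    degD p e * coeffT p l < degK p e l := by
  have h1 := degRoot_lt hp hl hle
  have h2 : degD p e * coeffT p l + degD p e ≤ p * degD p e := by
    have : coeffT p l + 1 ≤ p := by
      have := hp.two_le
      have := Nat.sub_le (p - 1) ((p + 1) / l)
      rw [coeffT]
      omega
    calc degD p e * coeffT p l + degD p e = (coeffT p l + 1) * degD p e := by ring
      _ ≤ p * degD p e := Nat.mul_le_mul_right _ this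
  rw [degK]
  omega

end Numbers

variable {k : Type u} [Field k] {p e : ℕ} (ξ : TangoCocycle k p e) (l : ℕ)

lemma gen_eq_pow (n : ℕ) (j : Patch) : gen ξ l n j = gen ξ l 1 j ^ n := by
  rw [gen, gen, ← map_pow]
  congr 1
  rcases j with _ | _
  · exact (one_pow n).symm
  · exact (congrArg (· ^ n) (pow_one (t k p e))).symm

/-- The local lifts of `dz`, as multiples of the generators of `𝒪_C(-p D)`. -/
noncomputable def localLift : Patch → PuncturedRing k p e
  | .U => ξ.aU
  | .V => ξ.aV_mem.choose

lemma localLift_mem (j : Patch) : localLift ξ j ∈ curveChart k p e j := by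
  rcases j with _ | _
  · exact ξ.aU_mem
  · exact ξ.aV_mem.choose_spec.1

lemma idealGen_mul_localLift (j : Patch) :
    (idealGen k p e 1 j : PuncturedRing k p e) ^ (p * degD p e) * localLift ξ j =
      match j with
      | .U => ξ.aU
      | .V => ξ.aV := by
  rcases j with _ | _
  · change ((1 : (PuncturedRing k p e)ˣ) : PuncturedRing k p e) ^ _ * ξ.aU = ξ.aU
    simp
  · change (((t k p e) ^ 1 : (PuncturedRing k p e)ˣ) : PuncturedRing k p e) ^ _ *
      ξ.aV_mem.choose = ξ.aV
    rw [pow_one]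
    exact ξ.aV_mem.choose_spec.2.symm

lemma D_idealGen_mul_localLift (j : Patch) :
    KaehlerDifferential.D k (PuncturedRing k p e)
      ((idealGen k p e 1 j : PuncturedRing k p e) ^ (p * degD p e) * localLift ξ j) =
    KaehlerDifferential.D k (PuncturedRing k p e) (z k p e) := by
  rw [idealGen_mul_localLift]
  rcases j with _ | _
  · exact ξ.d_aU
  · exact ξ.d_aV

/-- Since c^p = aU - aV, the p-th powers satisfy (w - c)^p - aV = w^p - aU: the equation of G has
the same shape in both frames. The identity for p-th powers needs characteristic p, so the zero ring
is split off. -/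
lemma s_pow_eq [Fact p.Prime] [CharP k p] (j : Patch) :
    s ξ l ^ l = (frame ξ l j : CoverRing ξ l) ^ p -
      toCover ξ l ((idealGen k p e 1 j : PuncturedRing k p e) ^ (p * degD p e) * localLift ξ j) := by
  have : CharP (CoverRing ξ l) p ∨ Subsingleton (CoverRing ξ l) := by
    rcases subsingleton_or_nontrivial (CoverRing ξ l) with h | h
    · exact .inr h
    · exact .inl (charP_of_injective_algebraMap (algebraMap k (CoverRing ξ l)).injective p)
  rcases this with h | h
  · rw [idealGen_mul_localLift, s_pow]
    rcases j with _ | _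
    · rfl
    · simp only
      rw [frame_V, sub_pow_char, ← map_pow, ξ.c_pow, map_sub]
      ring
  · exact Subsingleton.elim _ _

section Field

variable {l} {K : Type u} [Field K] [Algebra k K] (θ : CoverRing ξ l →ₐ[k] K)

local notation "d" => KaehlerDifferential.D k K

/-- The functions on `U ∩ V` as rational functions on the surface. -/
noncomputable def baseHom : PuncturedRing k p e →ₐ[k] K := θ.comp (toCover ξ l)

/-- The generator of `𝒪_C(-∞)` on a patch. -/
noncomputable def param (j : Patch) : K := θ (gen ξ l 1 j)

/-- The second member of the frame of `ℰ` on a patch, divided by the first one. -/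
noncomputable def fiberCoord (j : Patch) : K := θ (frame ξ l j) / param ξ θ j ^ degD p e

/-- The root generating the surface over a patch. -/
noncomputable def rootCoord (j : Patch) : K :=
  θ (s ξ l) * param ξ θ j ^ degRoot p e l / (param ξ θ j ^ degD p e) ^ ((p + 1) / l)

variable {ξ}

lemma unit_ne_zero (a : (CoverRing ξ l)ˣ) : θ a ≠ 0 := (a.isUnit.map θ).ne_zero

lemma param_ne_zero (j : Patch) : param ξ θ j ≠ 0 := unit_ne_zero θ _

lemma gen_eq_param (n : ℕ) (j : Patch) : θ (gen ξ l n j) = param ξ θ j ^ n := by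
  rw [gen_eq_pow, Units.val_pow_eq_pow_val, map_pow, param]

lemma baseHom_idealGen (j : Patch) : baseHom ξ θ (idealGen k p e 1 j) = param ξ θ j := rfl

lemma map_div_units (a b : (CoverRing ξ l)ˣ) : θ ((a / b : (CoverRing ξ l)ˣ) : CoverRing ξ l) =
    θ a / θ b := by
  rw [eq_div_iff (unit_ne_zero θ b), ← map_mul, ← Units.val_mul, div_mul_cancel]

lemma baseHom_z_mul_x : baseHom ξ θ (z k p e) * baseHom ξ θ (x k p e) = 1 := by
  rw [← map_mul, zx, map_one]

lemma D_baseHom_eq {a b : PuncturedRing k p e}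
    (h : KaehlerDifferential.D k (PuncturedRing k p e) a =
      KaehlerDifferential.D k (PuncturedRing k p e) b) :
    d (baseHom ξ θ a) = d (baseHom ξ θ b) := by
  let _ : Algebra (PuncturedRing k p e) K := (baseHom ξ θ).toRingHom.toAlgebra
  have : IsScalarTower k (PuncturedRing k p e) K :=
    IsScalarTower.of_algebraMap_eq' (baseHom ξ θ).comp_algebraMap.symm
  have := congrArg (KaehlerDifferential.map k k (PuncturedRing k p e) K) h
  rwa [KaehlerDifferential.map_D, KaehlerDifferential.map_D] at this

/-- The section `z` of `𝒪_C(p e ∞)` generates this sheaf on `V`. -/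
lemma z_mul_t_pow (h : 2 ≤ p * e) : (z k p e : PuncturedRing k p e) * t k p e ^ (p * e) =
    1 + t k p e * x k p e ^ (p * e - 2) := by
  obtain ⟨N, hN⟩ : ∃ N, p * e = N + 2 := ⟨p * e - 2, by omega⟩
  have h1 := yz_eq k p e
  have h2 := zx k p e
  have h3 := t_eq k p e
  have h5 : ((z k p e : PuncturedRing k p e) * x k p e) ^ (N + 1) = 1 := by rw [h2, one_pow]
  rw [hN, h3, Nat.add_sub_cancel, mul_pow]
  rw [hN, show N + 2 - 1 = N + 1 from rfl] at h1
  have h4 : (y k p e : PuncturedRing k p e) ^ (N + 2) = y k p e + z k p e ^ (N + 1) := by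
    linear_combination h1
  rw [h4]
  have h6 : (z k p e : PuncturedRing k p e) ^ (N + 1) * x k p e ^ (N + 1) = 1 := by
    rw [← mul_pow]; exact h5
  linear_combination (y k p e * x k p e ^ (N + 1) + 1 : PuncturedRing k p e) * h2 +
    (z k p e * x k p e : PuncturedRing k p e) * h6

lemma D_x : d (baseHom ξ θ (x k p e)) =
    (-(baseHom ξ θ (x k p e)) ^ 2) • d (baseHom ξ θ (z k p e)) := by
  have h1 : baseHom ξ θ (x k p e) = (baseHom ξ θ (z k p e))⁻¹ :=
    eq_inv_of_mul_eq_one_right (baseHom_z_mul_x θ)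
  rw [h1, Derivation.leibniz_inv]

variable [CharP k p]

variable (k) in
lemma natCast_p (K : Type*) [Field K] [Algebra k K] (p : ℕ) [CharP k p] : (p : K) = 0 := by
  rw [← map_natCast (algebraMap k K), CharP.cast_eq_zero, map_zero]

lemma D_pow_mul_p (f : K) (n : ℕ) : d (f ^ (p * n)) = 0 := by
  rw [Derivation.leibniz_pow, ← Nat.cast_smul_eq_nsmul K, Nat.cast_mul, natCast_p k K p,
    zero_mul, zero_smul]

/-- The factor relating aV to its local value is a p-th power, so it passes through d as a constant.
This expresses that dz vanishes along pD. -/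
lemma D_z (j : Patch) : d (baseHom ξ θ (z k p e)) =
    param ξ θ j ^ (p * degD p e) • d (baseHom ξ θ (localLift ξ j)) := by
  have h := D_baseHom_eq θ (D_idealGen_mul_localLift ξ j)
  rw [← h, map_mul, Derivation.leibniz, map_pow, baseHom_idealGen, D_pow_mul_p, smul_zero, add_zero]

variable [Fact p.Prime] [NeZero e]

lemma D_y : d (baseHom ξ θ (y k p e)) =
    baseHom ξ θ (z k p e) ^ (p * e - 2) • d (baseHom ξ θ (z k p e)) := by
  have h := congrArg (fun a => d (baseHom ξ θ a)) (yz_eq k p e)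
  simp only [map_sub, map_pow] at h
  rw [D_pow_mul_p, Derivation.leibniz_pow, ← Nat.cast_smul_eq_nsmul K,
    natCast_sub_one (k := k), Nat.sub_sub, zero_sub, neg_one_smul, neg_inj] at h
  exact h

lemma D_t (h : 3 ≤ p * e) : d (baseHom ξ θ (t k p e)) =
    (baseHom ξ θ (z k p e) ^ (p * e - 3) - baseHom ξ θ (t k p e) * baseHom ξ θ (x k p e)) •
      d (baseHom ξ θ (z k p e)) := by
  obtain ⟨N, hN⟩ : ∃ N, p * e = N + 3 := ⟨p * e - 3, by omega⟩
  have h1 := baseHom_z_mul_x θ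
  rw [t_eq, map_mul, Derivation.leibniz, D_x, D_y, smul_smul, smul_smul, ← add_smul]
  congr 1
  have e1 : p * e - 2 = N + 1 := by omega
  have e2 : p * e - 3 = N := by omega
  rw [e1, e2]
  linear_combination baseHom ξ θ (z k p e) ^ N * h1

/-- The differentials of the functions on a patch of the curve. -/
lemma D_base (h : 3 ≤ p * e) (j : Patch) (f : K) (hf : f ∈ (curveChart k p e j).map (baseHom ξ θ)) :
    ∃ g ∈ (curveChart k p e j).map (baseHom ξ θ),
      d f = g • d (baseHom ξ θ (localLift ξ j)) := by
  set R := (curveChart k p e j).map (baseHom ξ θ) with hR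
  have hcO : ∀ c, algebraMap k K c ∈ R.toSubring := fun c => Subalgebra.algebraMap_mem R c
  have hmem : ∀ a ∈ curveChart k p e j, baseHom ξ θ a ∈ R.toSubring := fun a ha => ⟨a, ha, rfl⟩
  set β := d (baseHom ξ θ (localLift ξ j)) with hβ
  have hDz := D_z θ j
  suffices hle : R ≤ differentialSubalgebra R.toSubring hcO β 0 0 by
    obtain ⟨g, hg, _, _, _, _, h'⟩ := (hle hf).2
    exact ⟨g, hg, by rw [h']; simp⟩
  have hβmem : ∀ c ∈ R.toSubring, c • β ∈ combinations R.toSubring β 0 0 := fun c hc =>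
    smul_mem_combinations hc (left_mem_combinations _ _ _ _)
  rcases j with _ | _
  · have hy : (y k p e : PuncturedRing k p e) ∈ curveChart k p e .U :=
      Algebra.subset_adjoin (by simp)
    have hz : (z k p e : PuncturedRing k p e) ∈ curveChart k p e .U :=
      Algebra.subset_adjoin (by simp)
    have hp1 : param ξ θ .U = 1 := by
      change θ (toCover ξ l ((1 : (PuncturedRing k p e)ˣ) : PuncturedRing k p e)) = 1
      simp
    rw [hp1, one_pow, one_smul] at hDz
    refine (AlgHom.map_adjoin (baseHom ξ θ) _).le.trans (Algebra.adjoin_le ?_)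
    rw [Set.image_pair]
    rintro _ (rfl | rfl)
    · refine ⟨hmem _ hy, ?_⟩
      rw [D_y, hDz]
      exact hβmem _ (pow_mem (hmem _ hz) _)
    · refine ⟨hmem _ hz, ?_⟩
      rw [hDz]
      exact left_mem_combinations _ _ _ _
  · have hx : (x k p e : PuncturedRing k p e) ∈ curveChart k p e .V :=
      Algebra.subset_adjoin (by simp)
    have ht : (t k p e : PuncturedRing k p e) ∈ curveChart k p e .V :=
      Algebra.subset_adjoin (by simp)
    have hp1 : param ξ θ .V = baseHom ξ θ (t k p e) := by
      change baseHom ξ θ ((t k p e ^ 1 : (PuncturedRing k p e)ˣ) : PuncturedRing k p e) = _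
      rw [pow_one]
    rw [hp1] at hDz
    refine (AlgHom.map_adjoin (baseHom ξ θ) _).le.trans (Algebra.adjoin_le ?_)
    rw [Set.image_pair]
    rintro _ (rfl | rfl)
    · refine ⟨hmem _ hx, ?_⟩
      rw [D_x, hDz, smul_smul]
      exact hβmem _ (mul_mem (neg_mem (pow_mem (hmem _ hx) _)) (pow_mem (hmem _ ht) _))
    · refine ⟨hmem _ ht, ?_⟩
      rw [D_t θ h, hDz, smul_smul, sub_mul]
      -- Since p deg D = pe(pe - 3), the zero of t^(p deg D) at ∞ cancels exactly the pole of z^(pe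
      -- - 3), because z t^(pe) is regular on V. This is why deg D = e(pe - 3).
      have e1 : baseHom ξ θ (z k p e) ^ (p * e - 3) * baseHom ξ θ (t k p e) ^ (p * degD p e) =
          baseHom ξ θ (1 + t k p e * x k p e ^ (p * e - 2)) ^ (p * e - 3) := by
        rw [← z_mul_t_pow (by omega), map_mul, map_pow, mul_pow, ← pow_mul, degD, ← mul_assoc]
      rw [e1]
      exact hβmem _ (sub_mem (pow_mem (hmem _ (add_mem (one_mem _) (mul_mem ht (pow_mem hx _)))) _)
        (mul_mem (mul_mem (hmem _ ht) (hmem _ hx)) (pow_mem (hmem _ ht) _)))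

/-- The surface over a patch of the curve is a cyclic cover. -/
lemma cyclicData (h : 3 ≤ p * e) (hle : l ∣ e) (hlp : l ∣ p + 1) (j : Patch) :
    CyclicData ((curveChart k p e j).map (baseHom ξ θ)) (baseHom ξ θ (localLift ξ j))
      (fiberCoord ξ θ j) (rootCoord ξ θ j) p l where
  b_mem := ⟨_, localLift_mem ξ j, rfl⟩
  D_base := D_base θ h j
  cast_p := natCast_p k K p
  s_pow := by
    have h1 := congrArg θ (s_pow_eq ξ l j)
    rw [map_sub, map_pow, map_pow] at h1
    change _ = _ - baseHom ξ θ _ at h1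
    rw [map_mul, map_pow, baseHom_idealGen] at h1
    have hT := param_ne_zero θ j
    rw [rootCoord, fiberCoord, div_pow, mul_pow, div_pow, h1, ← pow_mul, degRoot_mul hle, ← pow_mul,
      ← pow_mul, ← pow_mul, Nat.div_mul_cancel hlp, mul_comm p]
    field_simp
    ring

end Field

end TangoRaynaud

/-! ### The generator of the canonical sheaf on the four charts -/

namespace TangoRaynaud

open Canonical

section Field

variable {k : Type u} [Field k] {p e : ℕ} {ξ : TangoCocycle k p e} {l : ℕ} {K : Type u} [Field K]
  [Algebra k K] (θ : CoverRing ξ l →ₐ[k] K)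

local notation "d" => KaehlerDifferential.D k K

lemma param_U : param ξ θ .U = 1 := by
  change θ (toCover ξ l ((1 : (PuncturedRing k p e)ˣ) : PuncturedRing k p e)) = 1
  simp

lemma param_V : param ξ θ .V = baseHom ξ θ (t k p e) := by
  change baseHom ξ θ ((t k p e ^ 1 : (PuncturedRing k p e)ˣ) : PuncturedRing k p e) = _
  rw [pow_one]

/-- The generator of `𝒪(1)` on a chart. -/
noncomputable def chartSection (b : Patch × Bool) : K :=
  θ (Atlas.frameSection (gen ξ l (degD p e)) (frame ξ l) b)

lemma chartSection_ne_zero (b : Patch × Bool) : chartSection θ b ≠ 0 := unit_ne_zero θ _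

lemma chartSection_false (j : Patch) : chartSection θ (j, false) = param ξ θ j ^ degD p e :=
  gen_eq_param θ _ j

lemma chartSection_true (j : Patch) : chartSection θ (j, true) = θ (frame ξ l j) := rfl

lemma fiberCoord_ne_zero (j : Patch) : fiberCoord ξ θ j ≠ 0 :=
  div_ne_zero (unit_ne_zero θ _) (pow_ne_zero _ (param_ne_zero θ j))

lemma map_surfaceChart_false (j : Patch) : (surfaceChart ξ l (j, false)).map θ =
    (curveChart k p e j).map (baseHom ξ θ) ⊔
      Algebra.adjoin k {fiberCoord ξ θ j, rootCoord ξ θ j} := by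
  have h1 : θ ((frame ξ l j / gen ξ l (degD p e) j : (CoverRing ξ l)ˣ) : CoverRing ξ l) =
      fiberCoord ξ θ j := by
    rw [map_div_units, gen_eq_param]; rfl
  have h2 : θ (s ξ l * ((gen ξ l (degRoot p e l) j / gen ξ l (degD p e) j ^ ((p + 1) / l) :
      (CoverRing ξ l)ˣ) : CoverRing ξ l)) = rootCoord ξ θ j := by
    rw [map_mul, map_div_units, Units.val_pow_eq_pow_val, map_pow, gen_eq_param, gen_eq_param,
      rootCoord, mul_div_assoc]
  rw [surfaceChart, Atlas.coverChart, Atlas.projChart, Algebra.map_sup, Algebra.map_sup,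
    AlgHom.map_adjoin, AlgHom.map_adjoin, Set.image_pair, Set.image_singleton, baseChart,
    Subalgebra.map_map, sup_assoc, ← Algebra.adjoin_union]
  change _ ⊔ Algebra.adjoin k ({θ ((gen ξ l (degD p e) j / gen ξ l (degD p e) j :
    (CoverRing ξ l)ˣ) : CoverRing ξ l), θ ((frame ξ l j / gen ξ l (degD p e) j :
    (CoverRing ξ l)ˣ) : CoverRing ξ l)} ∪ {θ (s ξ l * ((gen ξ l (degRoot p e l) j /
    gen ξ l (degD p e) j ^ ((p + 1) / l) : (CoverRing ξ l)ˣ) : CoverRing ξ l))}) = _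
  rw [h1, h2, div_self', Units.val_one, map_one]
  congr 1
  refine le_antisymm (Algebra.adjoin_le ?_) (Algebra.adjoin_mono ?_)
  · rintro _ ((rfl | rfl) | rfl)
    · exact one_mem _
    · exact Algebra.subset_adjoin (by simp)
    · exact Algebra.subset_adjoin (by simp)
  · rintro _ (rfl | rfl) <;> simp

lemma map_surfaceChart_true (j : Patch) : (surfaceChart ξ l (j, true)).map θ =
    (curveChart k p e j).map (baseHom ξ θ) ⊔ Algebra.adjoin k {(fiberCoord ξ θ j)⁻¹,
      rootCoord ξ θ j * (fiberCoord ξ θ j)⁻¹ ^ ((p + 1) / l)} := by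
  have hT := param_ne_zero θ j
  have hf := unit_ne_zero θ (frame ξ l j)
  have h1 : θ ((gen ξ l (degD p e) j / frame ξ l j : (CoverRing ξ l)ˣ) : CoverRing ξ l) =
      (fiberCoord ξ θ j)⁻¹ := by
    rw [map_div_units, gen_eq_param, fiberCoord, inv_div]
  have h2 : θ (s ξ l * ((gen ξ l (degRoot p e l) j / frame ξ l j ^ ((p + 1) / l) :
      (CoverRing ξ l)ˣ) : CoverRing ξ l)) =
        rootCoord ξ θ j * (fiberCoord ξ θ j)⁻¹ ^ ((p + 1) / l) := by
    rw [map_mul, map_div_units, Units.val_pow_eq_pow_val, map_pow, gen_eq_param,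
      rootCoord, fiberCoord, inv_div, div_pow]
    field_simp
  rw [surfaceChart, Atlas.coverChart, Atlas.projChart, Algebra.map_sup, Algebra.map_sup,
    AlgHom.map_adjoin, AlgHom.map_adjoin, Set.image_pair, Set.image_singleton, baseChart,
    Subalgebra.map_map, sup_assoc, ← Algebra.adjoin_union]
  change _ ⊔ Algebra.adjoin k ({θ ((gen ξ l (degD p e) j / frame ξ l j :
    (CoverRing ξ l)ˣ) : CoverRing ξ l), θ ((frame ξ l j / frame ξ l j :
    (CoverRing ξ l)ˣ) : CoverRing ξ l)} ∪ {θ (s ξ l * ((gen ξ l (degRoot p e l) j /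
    frame ξ l j ^ ((p + 1) / l) : (CoverRing ξ l)ˣ) : CoverRing ξ l))}) = _
  rw [h1, h2, div_self', Units.val_one, map_one]
  congr 1
  refine le_antisymm (Algebra.adjoin_le ?_) (Algebra.adjoin_mono ?_)
  · rintro _ ((rfl | rfl) | rfl)
    · exact Algebra.subset_adjoin (by simp)
    · exact one_mem _
    · exact Algebra.subset_adjoin (by simp)
  · rintro _ (rfl | rfl) <;> simp

/-- The coefficient of a generator of the two-forms on a chart with respect to `dw ∧ ds`. -/
noncomputable def canonicalCoef (b : Patch × Bool) : K :=
  chartSection θ b ^ coeffT p l / param ξ θ b.1 ^ degK p e l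

lemma canonicalCoef_ne_zero (b : Patch × Bool) : canonicalCoef θ b ≠ 0 :=
  div_ne_zero (pow_ne_zero _ (chartSection_ne_zero θ b)) (pow_ne_zero _ (param_ne_zero θ _))

/-- The form `dw ∧ ds`. -/
noncomputable def mainForm : ⋀[K]^2 (Ω[K⁄k]) := wedge k (d (θ (frame ξ l .U))) (d (θ (s ξ l)))

variable [CharP k p]

variable (k) in
lemma natCast_l_ne_zero (K : Type*) [Field K] [Algebra k K] (p : ℕ) [CharP k p] (hlp : l ∣ p + 1) : (l : K) ≠ 0 := by
  intro h
  obtain ⟨r, hr⟩ := hlp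
  have := congrArg (Nat.cast : ℕ → K) hr
  rw [Nat.cast_mul, h, Nat.cast_add, natCast_p k K p] at this
  simp at this

/-- The factor κ between `rootCoord` and s has κ^l equal to a p-th power. Hence l κ^(l - 1) dκ = 0,
and l is invertible because it divides p + 1, so dκ = 0. -/
lemma D_rootCoord (hle : l ∣ e) (hlp : l ∣ p + 1) (j : Patch) : d (rootCoord ξ θ j) =
    (param ξ θ j ^ degRoot p e l / (param ξ θ j ^ degD p e) ^ ((p + 1) / l)) • d (θ (s ξ l)) := by
  have hT := param_ne_zero θ j
  set κ : K := param ξ θ j ^ degRoot p e l / (param ξ θ j ^ degD p e) ^ ((p + 1) / l) with hκ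
  have hκ0 : κ ≠ 0 := div_ne_zero (pow_ne_zero _ hT) (pow_ne_zero _ (pow_ne_zero _ hT))
  have hpow : κ ^ l = (param ξ θ j)⁻¹ ^ (p * degD p e) := by
    rw [hκ, div_pow, ← pow_mul, degRoot_mul hle]
    generalize degD p e = N
    rw [← pow_mul, ← pow_mul, Nat.div_mul_cancel hlp, inv_pow, mul_comm p, mul_add,
      mul_one, pow_add]
    field_simp
  have hD := congrArg (d) hpow
  rw [D_pow_mul_p, Derivation.leibniz_pow, ← Nat.cast_smul_eq_nsmul K, smul_smul] at hD
  have hDκ : d κ = 0 := by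
    rcases smul_eq_zero.mp hD with h0 | h0
    · exact absurd h0 (mul_ne_zero (natCast_l_ne_zero k K p hlp) (pow_ne_zero _ hκ0))
    · exact h0
  rw [rootCoord, mul_div_assoc, ← hκ, Derivation.leibniz, hDκ, smul_zero, zero_add]

variable [Fact p.Prime] [NeZero e]

/-- The differentials of functions on the curve are multiples of `ds`. -/
lemma exists_D_baseHom_eq (h : 3 ≤ p * e) (hle : l ∣ e) (hlp : l ∣ p + 1)
    (a : PuncturedRing k p e) : ∃ g : K, d (baseHom ξ θ a) = g • d (θ (s ξ l)) := by
  have hs : rootCoord ξ θ .U = θ (s ξ l) := by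
    rw [rootCoord, param_U]; simp
  -- Over U the equation of the cover reads dz = -l s^(l - 1) ds, and every differential on the
  -- curve is a multiple of dz.
  have hz : ∃ g : K, d (baseHom ξ θ (z k p e)) = g • d (θ (s ξ l)) := by
    have h1 := D_z θ .U
    rw [(cyclicData θ h hle hlp .U).D_b, hs, smul_smul] at h1
    exact ⟨_, h1⟩
  obtain ⟨g, hg⟩ := hz
  have hj : ∀ j, curveChart k p e j ≤ (differentialSubalgebra (⊤ : Subring K) (fun _ => trivial)
      (d (θ (s ξ l))) 0 0).comap (baseHom ξ θ) := by
    intro j f hf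
    obtain ⟨c, -, hc⟩ := D_base θ h j _ ⟨f, hf, rfl⟩
    refine ⟨trivial, ?_⟩
    have hT := pow_ne_zero (p * degD p e) (param_ne_zero θ j)
    have h1 : d (baseHom ξ θ (localLift ξ j)) =
        (param ξ θ j ^ (p * degD p e))⁻¹ • d (baseHom ξ θ (z k p e)) := by
      rw [D_z θ j, smul_smul, inv_mul_cancel₀ hT, one_smul]
    refine hc ▸ ?_
    rw [h1, hg]
    have htop : ∀ c : K, c ∈ (⊤ : Subring K) := fun _ => trivial
    exact smul_mem_combinations (htop _) (smul_mem_combinations (htop _) (smul_mem_combinations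
      (htop _) (left_mem_combinations _ _ _ _)))
  have htop := sup_le (hj .U) (hj .V)
  rw [curveChart_sup] at htop
  obtain ⟨-, f, -, g, -, g', -, hfg⟩ := htop (Algebra.mem_top (x := a))
  exact ⟨f, by simpa using hfg⟩

/-- Changing the patch alters the fibre coordinate by a factor and a summand from the curve. Their
differentials are multiples of ds and disappear after multiplication with ds, so only the factors
themselves survive. -/
lemma wedge_coords (h : 3 ≤ p * e) (hle : l ∣ e) (hlp : l ∣ p + 1) (j : Patch) :
    wedge k (d (fiberCoord ξ θ j)) (d (rootCoord ξ θ j)) =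
      (param ξ θ j ^ degRoot p e l / (param ξ θ j ^ degD p e) ^ ((p + 1) / l) /
        param ξ θ j ^ degD p e) • mainForm θ := by
  have hT := param_ne_zero θ j
  have hframe : ∃ g : K, d (θ (frame ξ l j)) = d (θ (frame ξ l .U)) + g • d (θ (s ξ l)) := by
    rcases j with _ | _
    · exact ⟨0, by simp⟩
    · obtain ⟨g, hg⟩ := exists_D_baseHom_eq θ h hle hlp ξ.c
      refine ⟨-g, ?_⟩
      rw [frame_V, map_sub, map_sub, neg_smul, ← hg, sub_eq_add_neg]
      rfl
  obtain ⟨g, hg⟩ := hframe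
  obtain ⟨g', hg'⟩ : ∃ g : K, d (param ξ θ j ^ degD p e)⁻¹ = g • d (θ (s ξ l)) := by
    obtain ⟨g, hg⟩ := exists_D_baseHom_eq θ h hle hlp
      ((idealGen k p e 1 j : PuncturedRing k p e) ^ degD p e)
    rw [map_pow, baseHom_idealGen] at hg
    exact ⟨_, by rw [Derivation.leibniz_inv, hg, smul_smul]⟩
  have h1 : d (fiberCoord ξ θ j) = (param ξ θ j ^ degD p e)⁻¹ • d (θ (frame ξ l .U)) +
      (θ (frame ξ l j) * g' + (param ξ θ j ^ degD p e)⁻¹ * g) • d (θ (s ξ l)) := by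
    rw [fiberCoord, div_eq_mul_inv, Derivation.leibniz, hg, hg']
    module
  rw [h1, D_rootCoord θ hle hlp, wedge_smul_right, wedge_add_left, wedge_smul_left, wedge_smul_left,
    wedge_self, smul_zero, add_zero, smul_smul, mainForm, ← div_eq_mul_inv]

/-- The pluricanonical forms that are regular at a point of a chart. -/
lemma stalkLattice_eq (hl : 2 ≤ l) (hle : l ∣ e) (hlp : l ∣ p + 1)
    (b : Patch × Bool) {O : Subring K} (hloc : IsLocalRing O)
    (hO : IsFractions ((surfaceChart ξ l b).map θ : Set K) O) (n : ℕ) :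
    stalkLattice k O 2 n =
      Submodule.span O {canonicalCoef θ b ^ n • formPow k n (mainForm θ)} := by
  have hp : p.Prime := Fact.out
  have h4 := four_le_mul hp hl hle
  obtain ⟨j, i⟩ := b
  have H := cyclicData θ (by omega) hle hlp j
  have hT := param_ne_zero θ j
  have hf := unit_ne_zero θ (frame ξ l j)
  have ha := coeffT_add hp hl hlp
  -- Both sides equal p deg D, because a + r + 1 = p. This is the bookkeeping that turns the chart
  -- generator into `canonicalCoef`.
  have hexp : degK p e l + degRoot p e l =
      degD p e * coeffT p l + degD p e * ((p + 1) / l) + degD p e := by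
    have h1 := degRoot_lt hp hl hle
    have h2 : degD p e ≤ p * degD p e := Nat.le_mul_of_pos_left _ hp.pos
    have h3 : degD p e * coeffT p l + degD p e * ((p + 1) / l) + degD p e =
        (coeffT p l + (p + 1) / l + 1) * degD p e := by ring
    rw [h3, ha, degK]
    omega
  have hTpow : param ξ θ j ^ degK p e l * param ξ θ j ^ degRoot p e l =
      (param ξ θ j ^ degD p e) ^ coeffT p l * (param ξ θ j ^ degD p e) ^ ((p + 1) / l) *
        param ξ θ j ^ degD p e := by
    rw [← pow_add, hexp]
    generalize degD p e = N
    rw [pow_add, pow_add, pow_mul, pow_mul]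
  rw [← formPow_smul]
  rcases i with _ | _
  · rw [map_surfaceChart_false] at hO
    rw [H.stalkLattice_affine le_sup_left
      ((le_sup_right : Algebra.adjoin k _ ≤ _) (Algebra.subset_adjoin (by simp)))
      ((le_sup_right : Algebra.adjoin k _ ≤ _) (Algebra.subset_adjoin (by simp))) le_rfl hO,
      wedge_coords θ (by omega) hle hlp]
    congr 4
    rw [canonicalCoef, chartSection_false]
    dsimp only
    field_simp
    linear_combination hTpow
  · rw [map_surfaceChart_true] at hO
    rw [H.stalkLattice_infinity (Nat.div_mul_cancel hlp) ha (fiberCoord_ne_zero θ j) le_sup_left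
      ((le_sup_right : Algebra.adjoin k _ ≤ _) (Algebra.subset_adjoin (by simp)))
      ((le_sup_right : Algebra.adjoin k _ ≤ _) (Algebra.subset_adjoin (by simp))) le_rfl hloc hO,
      wedge_coords θ (by omega) hle hlp, smul_smul]
    congr 4
    rw [canonicalCoef, chartSection_true, fiberCoord, div_pow]
    dsimp only
    field_simp
    linear_combination hTpow

end Field

end TangoRaynaud

/-- A first order deformation of an embedding of a ring in its field of fractions extends to a
derivation of this field. -/
lemma DualNumber.exists_derivation {k R K : Type*} [CommRing k] [CommRing R] [Field K] [Algebra k R]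
    [Algebra k K] {θ : R →ₐ[k] K} (hθ : Function.Injective θ)
    (hfrac : ∀ φ : K, ∃ a b, φ = θ a / θ b) (Φ : R →ₐ[k] DualNumber K)
    (hΦ : ∀ a, (Φ a).fst = θ a) : ∃ D : Derivation k K K, ∀ a, D (θ a) = (Φ a).snd := by
  let _ : Algebra R K := θ.toRingHom.toAlgebra
  have : FaithfulSMul R K := (faithfulSMul_iff_algebraMap_injective R K).mpr hθ
  have : IsFractionRing R K := IsFractionRing.of_field R K hfrac
  have hunit : ∀ b : nonZeroDivisors R, IsUnit (Φ.toRingHom b) := by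
    intro b
    refine TrivSqZeroExt.isUnit_iff_isUnit_fst.mpr ?_
    -- A dual number is a unit when its first component is, and here that component is the image of
    -- b in the field of fractions.
    change IsUnit (Φ b).fst
    rw [hΦ]
    exact IsLocalization.map_units K b
  let Ψ : K →+* DualNumber K := IsLocalization.lift hunit
  have hΨ : ∀ a, Ψ (θ a) = Φ a := fun a => IsLocalization.lift_eq hunit a
  have hfst : ∀ φ, (Ψ φ).fst = φ := by
    have : ((TrivSqZeroExt.fstHom k K K).toRingHom.comp Ψ) = RingHom.id K := by
      refine IsLocalization.ringHom_ext (nonZeroDivisors R) (RingHom.ext fun a => ?_)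
      change (Ψ (θ a)).fst = θ a
      rw [hΨ, hΦ]
    exact fun φ => RingHom.congr_fun this φ
  have hmul : ∀ a b, (Ψ (a * b)).snd = a * (Ψ b).snd + b * (Ψ a).snd := by
    intro a b
    rw [map_mul, TrivSqZeroExt.snd_mul, hfst, hfst, smul_eq_mul, MulOpposite.smul_eq_mul_unop,
      MulOpposite.unop_op, mul_comm b]
  refine ⟨Derivation.mk'
    { toFun := fun φ => (Ψ φ).snd
      map_add' := fun a b => by rw [map_add, TrivSqZeroExt.snd_add]
      map_smul' := fun c a => ?_ } hmul, fun a => ?_⟩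
  · rw [Algebra.smul_def, hmul, ← θ.commutes, hΨ, Φ.commutes, θ.commutes, RingHom.id_apply,
      Algebra.smul_def, TrivSqZeroExt.algebraMap_eq_inl', TrivSqZeroExt.snd_inl, mul_zero, add_zero]
  · change (Ψ (θ a)).snd = _
    rw [hΨ]

/-! ### Vector fields on the surface and the form dw ∧ ds -/

namespace TangoRaynaud

open Canonical

variable {k : Type u} [Field k] {p e : ℕ} {ξ : TangoCocycle k p e} {l : ℕ} {K : Type u} [Field K]
  [Algebra k K] [CharP k p] [Fact p.Prime] [NeZero e]

/-- The vector field on the surface with given values on `w` and `s`. -/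
lemma exists_cover_dual_lift (θ : CoverRing ξ l →ₐ[k] K) (α β : K) :
    ∃ Φ : CoverRing ξ l →ₐ[k] DualNumber K, (∀ a, (Φ a).fst = θ a) ∧
      (Φ (frame ξ l .U)).snd = α ∧ (Φ (s ξ l)).snd = β := by
  set w : K := θ (frame ξ l .U) with hw
  set σ : K := θ (s ξ l) with hσ
  have hpow : σ ^ l = w ^ p - baseHom ξ θ ξ.aU := by
    rw [hσ, hw, ← map_pow, s_pow, map_sub, map_pow]
    rfl
  -- The equation s^l = w^p - aU with d aU = dz forces the value -l s^(l - 1) β on z. The value α on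
  -- w is unconstrained because d(w^p) = 0.
  obtain ⟨Φ₁, hΦ₁, hz⟩ := exists_dual_lift (baseHom ξ θ) (-(l * σ ^ (l - 1) * β))
  have haU : (Φ₁ ξ.aU).snd = -(l * σ ^ (l - 1) * β) :=
    (DualNumber.snd_eq_of_D_eq Φ₁ ξ.d_aU).trans hz
  let W : DualNumber K := TrivSqZeroExt.inl w + TrivSqZeroExt.inr α
  let τ : DualNumber K := TrivSqZeroExt.inl σ + TrivSqZeroExt.inr β
  let Φ₂ : Polynomial (PuncturedRing k p e) →+* DualNumber K :=
    Polynomial.eval₂RingHom Φ₁.toRingHom W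
  have hΦ₂C : ∀ a, Φ₂ (.C a) = Φ₁ a := fun a => Polynomial.eval₂_C _ _
  have hΦ₂X : Φ₂ .X = W := Polynomial.eval₂_X _ _
  have hroot : Polynomial.eval₂ Φ₂ τ (coverPoly ξ l) = 0 := by
    rw [coverPoly, Polynomial.eval₂_sub, Polynomial.eval₂_pow, Polynomial.eval₂_X,
      Polynomial.eval₂_C, map_sub, map_pow, hΦ₂C, hΦ₂X, sub_eq_zero]
    ext
    · simp only [τ, W, TrivSqZeroExt.fst_sub, TrivSqZeroExt.fst_pow, TrivSqZeroExt.fst_add,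
        TrivSqZeroExt.fst_inl, TrivSqZeroExt.fst_inr, add_zero, hΦ₁]
      exact hpow
    · simp only [τ, W, TrivSqZeroExt.snd_sub, TrivSqZeroExt.snd_pow, TrivSqZeroExt.fst_add,
        TrivSqZeroExt.fst_inl, TrivSqZeroExt.fst_inr, add_zero, TrivSqZeroExt.snd_add,
        TrivSqZeroExt.snd_inl, TrivSqZeroExt.snd_inr, zero_add, smul_eq_mul, haU]
      rw [nsmul_eq_mul, nsmul_eq_mul, natCast_p k K p, Nat.pred_eq_sub_one]
      ring
  let Φ₃ : AffineCoverRing ξ l →+* DualNumber K := AdjoinRoot.lift Φ₂ τ hroot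
  have hΦ₃C : ∀ P, Φ₃ (polyToAffineCover ξ l P) = Φ₂ P := fun P => AdjoinRoot.lift_of hroot
  have hΦ₃s : Φ₃ (sAff ξ l) = τ := AdjoinRoot.lift_root hroot
  have hfst₃ : ∀ a, (Φ₃ a).fst = θ (algebraMap (AffineCoverRing ξ l) (CoverRing ξ l) a) := by
    have : (TrivSqZeroExt.fstHom k K K).toRingHom.comp Φ₃ =
        θ.toRingHom.comp (algebraMap (AffineCoverRing ξ l) (CoverRing ξ l)) := by
      refine AdjoinRoot.ringHom_ext (Polynomial.ringHom_ext (fun a => ?_) ?_) ?_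
      · change (Φ₃ (polyToAffineCover ξ l (.C a))).fst = _
        rw [hΦ₃C, hΦ₂C, hΦ₁]
        rfl
      · change (Φ₃ (polyToAffineCover ξ l .X)).fst = _
        rw [hΦ₃C, hΦ₂X]
        simp only [W, TrivSqZeroExt.fst_add, TrivSqZeroExt.fst_inl, TrivSqZeroExt.fst_inr, add_zero]
        rfl
      · change (Φ₃ (sAff ξ l)).fst = _
        rw [hΦ₃s]
        simp only [τ, TrivSqZeroExt.fst_add, TrivSqZeroExt.fst_inl, TrivSqZeroExt.fst_inr,
          add_zero]
        rfl
    exact fun a => RingHom.congr_fun this a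
  have hunit : ∀ q : Submonoid.powers (fAff ξ l .U * fAff ξ l .V), IsUnit (Φ₃ q) := by
    intro q
    refine TrivSqZeroExt.isUnit_iff_isUnit_fst.mpr ?_
    rw [hfst₃]
    exact (IsLocalization.map_units (CoverRing ξ l) q).map θ
  let Φ₄ : CoverRing ξ l →+* DualNumber K :=
    IsLocalization.lift (M := Submonoid.powers (fAff ξ l .U * fAff ξ l .V)) hunit
  have hΦ₄ : ∀ a, Φ₄ (algebraMap _ _ a) = Φ₃ a := fun a => IsLocalization.lift_eq hunit a
  have hcomm : ∀ c : k, Φ₄ (algebraMap k (CoverRing ξ l) c) = algebraMap k (DualNumber K) c := by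
    intro c
    rw [IsScalarTower.algebraMap_apply k (AffineCoverRing ξ l) (CoverRing ξ l), hΦ₄]
    have h1 : algebraMap k (AffineCoverRing ξ l) c =
        polyToAffineCover ξ l (.C (algebraMap k _ c)) :=
      ((polyToAffineCover ξ l).commutes c).symm
    rw [h1, hΦ₃C, hΦ₂C, Φ₁.commutes]
  refine ⟨{ Φ₄ with commutes' := hcomm }, ?_, ?_, ?_⟩
  · have : (TrivSqZeroExt.fstHom k K K).toRingHom.comp Φ₄ = θ.toRingHom := by
      refine IsLocalization.ringHom_ext (Submonoid.powers (fAff ξ l .U * fAff ξ l .V))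
        (RingHom.ext fun a => ?_)
      change (Φ₄ (algebraMap _ _ a)).fst = θ (algebraMap _ _ a)
      rw [hΦ₄, hfst₃]
    exact fun a => RingHom.congr_fun this a
  · change (Φ₄ (algebraMap _ _ (polyToAffineCover ξ l .X))).snd = α
    rw [hΦ₄, hΦ₃C, hΦ₂X]
    simp [W]
  · change (Φ₄ (algebraMap _ _ (sAff ξ l))).snd = β
    rw [hΦ₄, hΦ₃s]
    simp [τ]

/-- The vector fields with values (1, 0) and (0, 1) on (w, s) extend to derivations of the field of
fractions and are dual to dw, ds. -/
lemma mainForm_ne_zero (θ : CoverRing ξ l →ₐ[k] K) (hθ : Function.Injective θ)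
    (hfrac : ∀ φ : K, ∃ a b, φ = θ a / θ b) : mainForm θ ≠ 0 := by
  obtain ⟨Φ, hΦ, hw, hs⟩ := exists_cover_dual_lift θ 1 0
  obtain ⟨Φ', hΦ', hw', hs'⟩ := exists_cover_dual_lift θ 0 1
  obtain ⟨D, hD⟩ := DualNumber.exists_derivation hθ hfrac Φ hΦ
  obtain ⟨D', hD'⟩ := DualNumber.exists_derivation hθ hfrac Φ' hΦ'
  exact wedge_ne_zero D D' ((hD _).trans hw) ((hD _).trans hs) ((hD' _).trans hw') ((hD' _).trans hs')

end TangoRaynaud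

/-! ## Local rings of the surface inside its function field -/

section Units

variable {K : Type*} [Field K] {O : Subring K}

lemma Subring.inv_mem_of_isUnit {φ : K} (hφ : φ ∈ O) (h : IsUnit (⟨φ, hφ⟩ : O)) : φ⁻¹ ∈ O := by
  obtain ⟨ψ, hψ⟩ := h.exists_right_inv
  have : φ * ψ = 1 := congrArg Subtype.val hψ
  rw [inv_eq_of_mul_eq_one_right this]
  exact ψ.2

lemma Subring.inv_mem_of_mul {φ ψ : K} (hψ : ψ ∈ O) (hψ0 : ψ ≠ 0) (h : (φ * ψ)⁻¹ ∈ O) : φ⁻¹ ∈ O := by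
  have : φ⁻¹ = ψ * (φ * ψ)⁻¹ := by
    rw [mul_inv, mul_left_comm, mul_inv_cancel₀ hψ0, mul_one]
  rw [this]
  exact mul_mem hψ h

lemma Subring.inv_mem_of_pow {φ : K} (hφ : φ ∈ O) {n : ℕ} (hn : n ≠ 0) (h : (φ ^ n)⁻¹ ∈ O) :
    φ⁻¹ ∈ O := by
  rcases eq_or_ne φ 0 with rfl | h0
  · simp
  · obtain ⟨m, rfl⟩ := Nat.exists_eq_succ_of_ne_zero hn
    rw [pow_succ'] at h
    exact Subring.inv_mem_of_mul (pow_mem hφ m) (pow_ne_zero _ h0) h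

/-- A subring that contains the constants, as a subalgebra. -/
def Subring.withConstants {k : Type*} [Field k] [Algebra k K] (O : Subring K)
    (hO : ∀ c, algebraMap k K c ∈ O) : Subalgebra k K where
  toSubsemiring := O.toSubsemiring
  algebraMap_mem' := hO

end Units

namespace TangoRaynaud

open Canonical

variable {k : Type u} [Field k] {p e : ℕ} {ξ : TangoCocycle k p e} {l : ℕ} {K : Type u} [Field K]
  [Algebra k K] (θ : CoverRing ξ l →ₐ[k] K) {O : Subring K}

/-- `O` contains the coordinate ring of a chart of the surface. -/
def Dominates (O : Subring K) (b : Patch × Bool) : Prop := ∀ a ∈ surfaceChart ξ l b, θ a ∈ O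

/-- `O` contains the coordinate ring of a patch of the curve. -/
def RegularOn (O : Subring K) (j : Patch) : Prop := ∀ a ∈ curveChart k p e j, baseHom ξ θ a ∈ O

/-- Sections of `𝒪_C(p e ∞)` that vanish outside `U` and outside `V`, respectively. -/
noncomputable def baseSection : Patch → K
  | .U => 1
  | .V => baseHom ξ θ (z k p e)

/-- The value of `baseSection i` on the patch `j`. -/
noncomputable def baseValue (i j : Patch) : K := baseSection θ i * param ξ θ j ^ (p * e)

/-- The section `F` of the bundle, in a chart. -/
noncomputable def sectionValue (b : Patch × Bool) : K := param ξ θ b.1 ^ degD p e / chartSection θ b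

/-- The equation of `G`, in a chart. -/
noncomputable def branchValue (b : Patch × Bool) : K := θ (s ξ l) ^ l / chartSection θ b ^ p

variable {θ}

lemma RegularOn.algebraMap_mem {j : Patch} (h : RegularOn θ O j) (c : k) : algebraMap k K c ∈ O := by
  rw [← (baseHom ξ θ).commutes]
  exact h _ (Subalgebra.algebraMap_mem _ c)

lemma sup_adjoin_subset_iff {j : Patch} {a b : K} :
    (∀ f ∈ (curveChart k p e j).map (baseHom ξ θ) ⊔ Algebra.adjoin k {a, b}, f ∈ O) ↔
      RegularOn θ O j ∧ a ∈ O ∧ b ∈ O := by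
  constructor
  · intro h
    refine ⟨fun f hf => h _ ((le_sup_left : _ ≤ _ ⊔ Algebra.adjoin k {a, b}) ⟨f, hf, rfl⟩), ?_, ?_⟩
    · exact h _ ((le_sup_right : Algebra.adjoin k {a, b} ≤ _) (Algebra.subset_adjoin (by simp)))
    · exact h _ ((le_sup_right : Algebra.adjoin k {a, b} ≤ _) (Algebra.subset_adjoin (by simp)))
  · rintro ⟨h, ha, hb⟩
    have : (curveChart k p e j).map (baseHom ξ θ) ⊔ Algebra.adjoin k {a, b} ≤
        O.withConstants h.algebraMap_mem := by
      refine sup_le ?_ (Algebra.adjoin_le ?_)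
      · rintro _ ⟨f, hf, rfl⟩
        exact h f hf
      · rintro _ (rfl | rfl)
        · exact ha
        · exact hb
    exact fun f hf => this hf

lemma dominates_iff_map {b : Patch × Bool} :
    Dominates θ O b ↔ ∀ f ∈ (surfaceChart ξ l b).map θ, f ∈ O :=
  ⟨fun h => by rintro _ ⟨a, ha, rfl⟩; exact h a ha, fun h a ha => h _ ⟨a, ha, rfl⟩⟩

lemma dominates_false_iff {j : Patch} : Dominates θ O (j, false) ↔
    RegularOn θ O j ∧ fiberCoord ξ θ j ∈ O ∧ rootCoord ξ θ j ∈ O := by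
  rw [dominates_iff_map, map_surfaceChart_false, sup_adjoin_subset_iff]

lemma dominates_true_iff {j : Patch} : Dominates θ O (j, true) ↔
    RegularOn θ O j ∧ (fiberCoord ξ θ j)⁻¹ ∈ O ∧
      rootCoord ξ θ j * (fiberCoord ξ θ j)⁻¹ ^ ((p + 1) / l) ∈ O := by
  rw [dominates_iff_map, map_surfaceChart_true, sup_adjoin_subset_iff]

lemma Dominates.regularOn {b : Patch × Bool} (h : Dominates θ O b) : RegularOn θ O b.1 := by
  obtain ⟨j, _ | _⟩ := b
  · exact (dominates_false_iff.mp h).1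
  · exact (dominates_true_iff.mp h).1

lemma Dominates.affine {j : Patch} (h : Dominates θ O (j, true)) (hv : fiberCoord ξ θ j ∈ O) :
    Dominates θ O (j, false) := by
  obtain ⟨h1, h2, h3⟩ := dominates_true_iff.mp h
  refine dominates_false_iff.mpr ⟨h1, hv, ?_⟩
  have : rootCoord ξ θ j = rootCoord ξ θ j * (fiberCoord ξ θ j)⁻¹ ^ ((p + 1) / l) *
      fiberCoord ξ θ j ^ ((p + 1) / l) := by
    rw [mul_assoc, ← mul_pow, inv_mul_cancel₀ (fiberCoord_ne_zero θ j), one_pow, mul_one]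
  rw [this]
  exact mul_mem h3 (pow_mem hv _)

lemma Dominates.infinity {j : Patch} (h : Dominates θ O (j, false))
    (hv : (fiberCoord ξ θ j)⁻¹ ∈ O) : Dominates θ O (j, true) := by
  obtain ⟨h1, h2, h3⟩ := dominates_false_iff.mp h
  exact dominates_true_iff.mpr ⟨h1, hv, mul_mem h3 (pow_mem hv _)⟩

lemma sectionValue_false (j : Patch) : sectionValue θ (j, false) = 1 := by
  rw [sectionValue, chartSection_false, div_self (pow_ne_zero _ (param_ne_zero θ j))]

lemma sectionValue_true (j : Patch) : sectionValue θ (j, true) = (fiberCoord ξ θ j)⁻¹ := by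
  rw [sectionValue, chartSection_true, fiberCoord, inv_div]

lemma sectionValue_ne_zero (b : Patch × Bool) : sectionValue θ b ≠ 0 :=
  div_ne_zero (pow_ne_zero _ (param_ne_zero θ _)) (chartSection_ne_zero θ b)

lemma Dominates.sectionValue_mem {b : Patch × Bool} (h : Dominates θ O b) : sectionValue θ b ∈ O := by
  obtain ⟨j, _ | _⟩ := b
  · rw [sectionValue_false]; exact one_mem _
  · rw [sectionValue_true]; exact (dominates_true_iff.mp h).2.1

/-- A point lies off the section at infinity if the corresponding value is invertible. -/
lemma Dominates.affine_of_sectionValue {j : Patch} {i : Bool} (h : Dominates θ O (j, i))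
    (hE : (sectionValue θ (j, i))⁻¹ ∈ O) : Dominates θ O (j, false) := by
  rcases i with _ | _
  · exact h
  · rw [sectionValue_true, inv_inv] at hE
    exact h.affine hE

lemma baseSection_ne_zero (i : Patch) : baseSection θ i ≠ 0 := by
  rcases i with _ | _
  · exact one_ne_zero
  · exact ((z k p e).isUnit.map (baseHom ξ θ)).ne_zero

lemma baseValue_ne_zero (i j : Patch) : baseValue θ i j ≠ 0 :=
  mul_ne_zero (baseSection_ne_zero i) (pow_ne_zero _ (param_ne_zero θ j))

lemma param_mem {j : Patch} (h : RegularOn θ O j) : param ξ θ j ∈ O := by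
  rcases j with _ | _
  · rw [param_U]; exact one_mem _
  · rw [param_V]; exact h _ (Algebra.subset_adjoin (by simp))

lemma branchValue_eq_false (j : Patch) [Fact p.Prime] [CharP k p] :
    branchValue θ (j, false) = fiberCoord ξ θ j ^ p - baseHom ξ θ (localLift ξ j) := by
  have h1 := congrArg θ (s_pow_eq ξ l j)
  rw [map_sub, map_pow, map_pow] at h1
  change _ = _ - baseHom ξ θ _ at h1
  rw [map_mul, map_pow, baseHom_idealGen] at h1
  have hT := param_ne_zero θ j
  rw [branchValue, chartSection_false, h1, fiberCoord, div_pow, ← pow_mul, mul_comm (degD p e)]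
  generalize p * degD p e = N
  field_simp

lemma branchValue_eq_true (j : Patch) [Fact p.Prime] [CharP k p] :
    branchValue θ (j, true) = 1 - baseHom ξ θ (localLift ξ j) * (fiberCoord ξ θ j)⁻¹ ^ p := by
  have h1 := branchValue_eq_false (θ := θ) j
  have hT := param_ne_zero θ j
  have hf := unit_ne_zero θ (frame ξ l j)
  have h2 : branchValue θ (j, true) = branchValue θ (j, false) * (fiberCoord ξ θ j)⁻¹ ^ p := by
    rw [branchValue, branchValue, chartSection_false, chartSection_true, fiberCoord, inv_div, div_pow]
    generalize degD p e = N
    field_simp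
  rw [h2, h1, sub_mul, ← mul_pow, mul_inv_cancel₀ (fiberCoord_ne_zero θ j), one_pow]

lemma Dominates.branchValue_mem [Fact p.Prime] [CharP k p] {b : Patch × Bool}
    (h : Dominates θ O b) : branchValue θ b ∈ O := by
  have hb := h.regularOn _ (localLift_mem ξ b.1)
  obtain ⟨j, _ | _⟩ := b
  · rw [branchValue_eq_false]
    exact sub_mem (pow_mem (dominates_false_iff.mp h).2.1 _) hb
  · rw [branchValue_eq_true]
    exact sub_mem (one_mem _) (mul_mem hb (pow_mem (dominates_true_iff.mp h).2.1 _))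

/-- Sections of the powers of the canonical bundle that vanish on `F` or over one point, in a
chart. -/
lemma baseSection_pow_div_canonicalCoef (i : Patch) (b : Patch × Bool)
    (h : degD p e * coeffT p l ≤ degK p e l) :
    baseSection θ i ^ (degK p e l - degD p e * coeffT p l) / canonicalCoef θ b ^ (p * e) =
      sectionValue θ b ^ (coeffT p l * (p * e)) *
        baseValue θ i b.1 ^ (degK p e l - degD p e * coeffT p l) := by
  obtain ⟨κ, hκ⟩ := Nat.exists_eq_add_of_le h
  rw [hκ, Nat.add_sub_cancel_left]
  have hT := param_ne_zero θ b.1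
  have hε := chartSection_ne_zero θ b
  rw [canonicalCoef, baseValue, sectionValue, hκ]
  generalize degD p e = n
  generalize coeffT p l = a
  generalize p * e = N
  rw [div_pow, div_pow, mul_pow, ← pow_mul, ← pow_mul, ← pow_mul, ← pow_mul, div_div_eq_mul_div,
    div_mul_eq_mul_div]
  congr 1
  ring

/-- Sections of the powers of the canonical bundle that vanish on `G` or over one point, in a
chart. -/
lemma root_pow_mul_div_canonicalCoef (i : Patch) (b : Patch × Bool) :
    (θ (s ξ l) ^ l) ^ (coeffT p l * e) * baseSection θ i ^ degK p e l /
        canonicalCoef θ b ^ (p * e) =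
      branchValue θ b ^ (coeffT p l * e) * baseValue θ i b.1 ^ degK p e l := by
  have hT := param_ne_zero θ b.1
  have hε := chartSection_ne_zero θ b
  rw [canonicalCoef, baseValue, branchValue]
  generalize degK p e l = n
  generalize coeffT p l = a
  rw [div_pow, div_pow, mul_pow, ← pow_mul, ← pow_mul, ← pow_mul, ← pow_mul, ← pow_mul,
    div_div_eq_mul_div, div_mul_eq_mul_div]
  congr 1
  · ring
  · ring

lemma RegularOn.baseValue_mem (h : 2 ≤ p * e) {i j : Patch} (hj : RegularOn θ O j) :
    baseValue θ i j ∈ O := by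
  rcases i with _ | _
  · rw [baseValue, baseSection, one_mul]
    exact pow_mem (param_mem hj) _
  · rcases j with _ | _
    · rw [baseValue, baseSection, param_U, one_pow, mul_one]
      exact hj _ (Algebra.subset_adjoin (by simp))
    · rw [baseValue, baseSection, param_V, ← map_pow, ← map_mul, z_mul_t_pow h]
      refine hj _ (add_mem (one_mem _) (mul_mem ?_ (pow_mem ?_ _))) <;>
        exact Algebra.subset_adjoin (by simp)

/-- On V the function u = z t^(pe) satisfies u = 1 + t x^(pe - 2) and u x = t^(pe). It is coprime to
t and divides a power of t, hence is a unit. -/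
lemma RegularOn.baseValue_self_inv_mem (h : 2 ≤ p * e) {j : Patch} (hj : RegularOn θ O j) :
    (baseValue θ j j)⁻¹ ∈ O := by
  rcases j with _ | _
  · rw [baseValue, baseSection, param_U, one_pow, mul_one, inv_one]
    exact one_mem _
  · have ht : baseHom ξ θ (t k p e) ∈ O := hj _ (Algebra.subset_adjoin (by simp))
    have hx : baseHom ξ θ (x k p e) ∈ O := hj _ (Algebra.subset_adjoin (by simp))
    have hu := hj.baseValue_mem h (i := .V)
    have h1 : baseValue θ .V .V =
        1 + baseHom ξ θ (t k p e) * baseHom ξ θ (x k p e) ^ (p * e - 2) := by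
      rw [baseValue, baseSection, param_V, ← map_pow, ← map_mul, z_mul_t_pow h, map_add, map_one,
        map_mul, map_pow]
    have h2 : baseValue θ .V .V * baseHom ξ θ (x k p e) = baseHom ξ θ (t k p e) ^ (p * e) := by
      rw [baseValue, baseSection, param_V]
      linear_combination baseHom ξ θ (t k p e) ^ (p * e) * baseHom_z_mul_x θ
    refine Subring.inv_mem_of_isUnit hu ?_
    have hcop : IsCoprime (⟨_, hu⟩ : O) (⟨_, ht⟩ : O) := by
      refine ⟨1, -⟨_, pow_mem hx (p * e - 2)⟩, Subtype.ext ?_⟩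
      change 1 * baseValue θ .V .V + -(baseHom ξ θ (x k p e) ^ (p * e - 2)) *
        baseHom ξ θ (t k p e) = 1
      rw [h1]; ring
    refine (hcop.pow_right (n := p * e)).isUnit_of_dvd' dvd_rfl ⟨⟨_, hx⟩, Subtype.ext ?_⟩
    exact h2.symm

/-- Where the section belonging to the patch i does not vanish, the coordinates of that patch are
regular: t^(pe) invertible makes z and y = tz regular, and z invertible makes x = 1/z and t = yx
regular. -/
lemma RegularOn.of_baseValue (h : 2 ≤ p * e) {i j : Patch} (hj : RegularOn θ O j)
    (hu : (baseValue θ i j)⁻¹ ∈ O) : RegularOn θ O i := by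
  have key : ∀ a b : PuncturedRing k p e, baseHom ξ θ a ∈ O → baseHom ξ θ b ∈ O →
      ∀ f ∈ Algebra.adjoin k {a, b}, baseHom ξ θ f ∈ O := by
    intro a b ha hb f hf
    have : Algebra.adjoin k {a, b} ≤
        (O.withConstants hj.algebraMap_mem).comap (baseHom ξ θ) := by
      refine Algebra.adjoin_le ?_
      rintro _ (rfl | rfl)
      · exact ha
      · exact hb
    exact this hf
  have hzx := baseHom_z_mul_x θ
  have hz0 : baseHom ξ θ (z k p e) ≠ 0 := baseSection_ne_zero (θ := θ) .V
  rcases i with _ | _ <;> rcases j with _ | _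
  · exact hj
  · have ht : baseHom ξ θ (t k p e) ∈ O := hj _ (Algebra.subset_adjoin (by simp))
    have hv := hj.baseValue_mem h (i := .V)
    rw [baseValue, baseSection, one_mul] at hu
    have hz : baseHom ξ θ (z k p e) ∈ O := by
      have : baseHom ξ θ (z k p e) = baseValue θ .V .V * (param ξ θ .V ^ (p * e))⁻¹ := by
        rw [baseValue, mul_inv_cancel_right₀ (pow_ne_zero _ (param_ne_zero θ _))]
        rfl
      rw [this]
      exact mul_mem hv hu
    refine key _ _ ?_ hz
    rw [y_eq, map_mul]
    exact mul_mem ht hz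
  · rw [baseValue, baseSection, param_U, one_pow, mul_one] at hu
    have hx : baseHom ξ θ (x k p e) ∈ O := by
      rwa [eq_inv_of_mul_eq_one_right hzx]
    refine key _ _ hx ?_
    rw [t_eq, map_mul]
    exact mul_mem (hj _ (Algebra.subset_adjoin (by simp))) hx
  · exact hj

variable [Fact p.Prime] [NeZero e]

/-- A point that lies over a patch lies in one of the two charts over this patch. -/
lemma Dominates.exists_of_regularOn (hloc : IsLocalRing O) {b : Patch × Bool}
    (hb : Dominates θ O b) {j : Patch} (hj : RegularOn θ O j) : ∃ i, Dominates θ O (j, i) := by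
  obtain ⟨j', i'⟩ := b
  have hj' : RegularOn θ O j' := hb.regularOn
  rcases eq_or_ne j j' with rfl | hne
  · exact ⟨i', hb⟩
  -- The point lies over U ∩ V, so O contains all functions on U ∩ V. The local parameters become
  -- units there and the two frames differ by an invertible affine change of coordinate.
  have hall : ∀ a, baseHom ξ θ a ∈ O := by
    have h1 : curveChart k p e j ⊔ curveChart k p e j' ≤
        (O.withConstants hj.algebraMap_mem).comap (baseHom ξ θ) := sup_le hj hj'
    have h2 : curveChart k p e j ⊔ curveChart k p e j' = ⊤ := by
      rcases j with _ | _ <;> rcases j' with _ | _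
      · exact absurd rfl hne
      · exact curveChart_sup k p e
      · rw [sup_comm]; exact curveChart_sup k p e
      · exact absurd rfl hne
    rw [h2] at h1
    exact fun a => h1 (Algebra.mem_top (x := a))
  have hT : ∀ i, param ξ θ i ∈ O := fun i => hall _
  have hTinv : ∀ i, (param ξ θ i)⁻¹ ∈ O := by
    intro i
    have : (param ξ θ i)⁻¹ = baseHom ξ θ ((idealGen k p e 1 i)⁻¹ : (PuncturedRing k p e)ˣ) := by
      refine inv_eq_of_mul_eq_one_right ?_
      rw [← baseHom_idealGen, ← map_mul, Units.mul_inv, map_one]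
    rw [this]
    exact hall _
  have hT0 := param_ne_zero θ j
  have hT0' := param_ne_zero θ j'
  obtain ⟨u, hu, hu', hu0, c, hc, hv⟩ : ∃ u ∈ O, u⁻¹ ∈ O ∧ u ≠ 0 ∧ ∃ c ∈ O,
      fiberCoord ξ θ j = u * fiberCoord ξ θ j' + c := by
    obtain ⟨c, hc⟩ : ∃ c, θ (frame ξ l j) = θ (frame ξ l j') + baseHom ξ θ c := by
      rcases j with _ | _ <;> rcases j' with _ | _
      · exact absurd rfl hne
      · exact ⟨ξ.c, by rw [frame_V, map_sub]; exact (sub_add_cancel _ _).symm⟩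
      · exact ⟨-ξ.c, by rw [frame_V, map_sub, map_neg]; exact sub_eq_add_neg _ _⟩
      · exact absurd rfl hne
    refine ⟨param ξ θ j' ^ degD p e * (param ξ θ j)⁻¹ ^ degD p e,
      mul_mem (pow_mem (hT _) _) (pow_mem (hTinv _) _), ?_,
      mul_ne_zero (pow_ne_zero _ hT0') (pow_ne_zero _ (inv_ne_zero hT0)), baseHom ξ θ c *
        (param ξ θ j)⁻¹ ^ degD p e, mul_mem (hall _) (pow_mem (hTinv _) _), ?_⟩
    · rw [mul_inv, ← inv_pow, ← inv_pow, inv_inv]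
      exact mul_mem (pow_mem (hTinv _) _) (pow_mem (hT _) _)
    · rw [fiberCoord, fiberCoord, hc]
      generalize degD p e = n
      rw [inv_pow]
      field_simp
  obtain ⟨u', hu'', hs⟩ : ∃ u' ∈ O, rootCoord ξ θ j = u' * rootCoord ξ θ j' := by
    refine ⟨param ξ θ j ^ degRoot p e l * (param ξ θ j)⁻¹ ^ (degD p e * ((p + 1) / l)) *
      ((param ξ θ j')⁻¹ ^ degRoot p e l * param ξ θ j' ^ (degD p e * ((p + 1) / l))), ?_, ?_⟩
    · exact mul_mem (mul_mem (pow_mem (hT _) _) (pow_mem (hTinv _) _))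
        (mul_mem (pow_mem (hTinv _) _) (pow_mem (hT _) _))
    · rw [rootCoord, rootCoord]
      generalize degD p e = n
      generalize degRoot p e l = m
      generalize (p + 1) / l = r
      rw [pow_mul, pow_mul, inv_pow, inv_pow, inv_pow]
      field_simp
  have hfalse : Dominates θ O (j', false) → ∃ i, Dominates θ O (j, i) := by
    intro h
    obtain ⟨-, h1, h2⟩ := dominates_false_iff.mp h
    refine ⟨false, dominates_false_iff.mpr ⟨hj, ?_, ?_⟩⟩
    · rw [hv]; exact add_mem (mul_mem hu h1) hc
    · rw [hs]; exact mul_mem hu'' h2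
  rcases i' with _ | _
  · exact hfalse hb
  · obtain ⟨-, h1, h2⟩ := dominates_true_iff.mp hb
    have hv0 := fiberCoord_ne_zero θ j'
    have hg : u + c * (fiberCoord ξ θ j')⁻¹ ∈ O := add_mem hu (mul_mem hc h1)
    have hcV : c * (fiberCoord ξ θ j')⁻¹ ∈ O := mul_mem hc h1
    -- With V' the fibre coordinate at infinity over j', the new coordinate is v = (u + c V') / V'.
    -- As u + c V' and c V' differ by the unit u, one of them is a unit: in the first case 1/v is
    -- regular, in the second V' is invertible and the point lies in the affine chart over j'.
    have hsum : IsUnit ((⟨_, hg⟩ : O) + -⟨_, hcV⟩) := by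
      refine IsUnit.of_mul_eq_one ⟨u⁻¹, hu'⟩ (Subtype.ext ?_)
      change (u + c * (fiberCoord ξ θ j')⁻¹ + -(c * (fiberCoord ξ θ j')⁻¹)) * u⁻¹ = 1
      rw [add_neg_cancel_right, mul_inv_cancel₀ hu0]
    rcases IsLocalRing.isUnit_or_isUnit_of_isUnit_add hsum with h | h
    · have hginv := Subring.inv_mem_of_isUnit hg h
      have hveq : (fiberCoord ξ θ j)⁻¹ =
          (fiberCoord ξ θ j')⁻¹ * (u + c * (fiberCoord ξ θ j')⁻¹)⁻¹ := by
        rw [← mul_inv, hv, mul_add, mul_left_comm, mul_inv_cancel₀ hv0, mul_one, mul_comm u]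
      refine ⟨true, dominates_true_iff.mpr ⟨hj, ?_, ?_⟩⟩
      · rw [hveq]; exact mul_mem h1 hginv
      · rw [hveq, hs, mul_pow, mul_assoc, ← mul_assoc (rootCoord ξ θ j')]
        exact mul_mem hu'' (mul_mem h2 (pow_mem hginv _))
    · rw [IsUnit.neg_iff] at h
      have hcinv := Subring.inv_mem_of_isUnit hcV h
      refine hfalse (hb.affine ?_)
      have hc0 : c ≠ 0 := by
        rintro rfl
        refine h.ne_zero (Subtype.ext ?_)
        exact zero_mul _
      rw [mul_comm] at hcinv
      simpa using Subring.inv_mem_of_mul hc hc0 hcinv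

end TangoRaynaud

/-! ## Pluricanonical forms on the surface -/

namespace TangoRaynaud

open Canonical

section Surface

variable {k : Type u} [Field k] {p e : ℕ} [Fact p.Prime] [NeZero e] (ξ : TangoCocycle k p e) (l : ℕ)

lemma isIntegral_surface [IsDomain (CoverRing ξ l)] : IsIntegral (surface ξ l) :=
  Atlas.isIntegral_glue (isAtlas_surfaceChart ξ l)

variable [IsDomain (CoverRing ξ l)] [IsIntegral (surface ξ l)]

/-- The function field of the surface as an extension of the base field. -/
noncomputable abbrev surfaceFieldAlgebra : Algebra k (surface ξ l).functionField :=
  functionFieldAlgebra (surfaceToBase ξ l)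

attribute [local instance] surfaceFieldAlgebra

/-- The inclusion in the function field of the coordinate ring of the intersection of all charts. -/
noncomputable def toField : CoverRing ξ l →ₐ[k] (surface ξ l).functionField :=
  haveI : IsIntegral (Atlas.glue (surfaceChart ξ l) (isAtlas_surfaceChart ξ l)) :=
    ‹IsIntegral (surface ξ l)›
  { Atlas.rational (isAtlas_surfaceChart ξ l) (overlap_surfaceChart ξ l) with
    commutes' := Atlas.rational_algebraMap (isAtlas_surfaceChart ξ l) (overlap_surfaceChart ξ l) }

lemma toField_injective : Function.Injective (toField ξ l) :=
  haveI : IsIntegral (Atlas.glue (surfaceChart ξ l) (isAtlas_surfaceChart ξ l)) :=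
    ‹IsIntegral (surface ξ l)›
  Atlas.rational_injective (isAtlas_surfaceChart ξ l) (overlap_surfaceChart ξ l)

/-- The inclusion of a chart. -/
noncomputable def surfaceMap (b : Patch × Bool) :
    Spec (.of (surfaceChart ξ l b)) ⟶ surface ξ l :=
  Atlas.chart (isAtlas_surfaceChart ξ l) b

instance (b : Patch × Bool) : IsOpenImmersion (surfaceMap ξ l b) :=
  inferInstanceAs (IsOpenImmersion (Atlas.chart (isAtlas_surfaceChart ξ l) b))

variable {ξ l}

lemma dominates_surfaceMap (b : Patch × Bool) (q : Spec (.of (surfaceChart ξ l b))) :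
    Dominates (toField ξ l) (localRing (surfaceMap ξ l b q)) b :=
  haveI : IsIntegral (Atlas.glue (surfaceChart ξ l) (isAtlas_surfaceChart ξ l)) :=
    ‹IsIntegral (surface ξ l)›
  fun _ ha => Atlas.rational_mem_localRing (isAtlas_surfaceChart ξ l) (overlap_surfaceChart ξ l) q ha

lemma Dominates.exists_surfaceMap_eq {b : Patch × Bool} {y : surface ξ l}
    (h : Dominates (toField ξ l) (localRing y) b) : ∃ q, surfaceMap ξ l b q = y :=
  haveI : IsIntegral (Atlas.glue (surfaceChart ξ l) (isAtlas_surfaceChart ξ l)) :=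
    ‹IsIntegral (surface ξ l)›
  Atlas.mem_range_chart (isAtlas_surfaceChart ξ l) (overlap_surfaceChart ξ l) b y h

lemma mem_opensRange_surfaceMap_iff (b : Patch × Bool) (y : surface ξ l) :
    y ∈ (surfaceMap ξ l b).opensRange ↔ Dominates (toField ξ l) (localRing y) b := by
  constructor
  · rintro ⟨q, rfl⟩
    exact dominates_surfaceMap b q
  · exact fun h => h.exists_surfaceMap_eq

variable (ξ l) in
lemma exists_dominates (y : surface ξ l) : ∃ b, Dominates (toField ξ l) (localRing y) b := by
  obtain ⟨b, q, rfl⟩ := Atlas.exists_chart_eq (isAtlas_surfaceChart ξ l) y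
  exact ⟨b, dominates_surfaceMap b q⟩

lemma Dominates.isFractions {b : Patch × Bool} {y : surface ξ l}
    (h : Dominates (toField ξ l) (localRing y) b) :
    IsFractions ((surfaceChart ξ l b).map (toField ξ l) : Set (surface ξ l).functionField)
      (localRing y) := by
  have : IsIntegral (Atlas.glue (surfaceChart ξ l) (isAtlas_surfaceChart ξ l)) :=
    ‹IsIntegral (surface ξ l)›
  refine ⟨fun f hf => dominates_iff_map.mp h f hf, fun φ hφ => ?_⟩
  obtain ⟨q, rfl⟩ := h.exists_surfaceMap_eq
  obtain ⟨a, ha, c, hc, ψ, hψ, h1, h2⟩ := Atlas.exists_eq_div (isAtlas_surfaceChart ξ l)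
    (overlap_surfaceChart ξ l) b q hφ
  exact ⟨_, ⟨a, ha, rfl⟩, _, ⟨c, hc, rfl⟩, ψ, hψ, h1, h2⟩

lemma inv_toField_mem_iff {b : Patch × Bool} (q : Spec (.of (surfaceChart ξ l b)))
    {a : CoverRing ξ l} (ha : a ∈ surfaceChart ξ l b) (ha0 : toField ξ l a ≠ 0) :
    (toField ξ l a)⁻¹ ∈ localRing (surfaceMap ξ l b q) ↔
      (⟨a, ha⟩ : surfaceChart ξ l b) ∉ primeIdeal q := by
  have : IsIntegral (Atlas.glue (surfaceChart ξ l) (isAtlas_surfaceChart ξ l)) :=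
    ‹IsIntegral (surface ξ l)›
  refine Iff.trans ?_ (Atlas.exists_mul_rational_eq_one_iff (isAtlas_surfaceChart ξ l)
    (overlap_surfaceChart ξ l) q ha)
  constructor
  · exact fun h => ⟨_, h, mul_inv_cancel₀ ha0⟩
  · have key : ∀ (O : Subring (surface ξ l).functionField), ∀ ψ ∈ O, toField ξ l a * ψ = 1 →
        (toField ξ l a)⁻¹ ∈ O := fun O ψ hψ h => by rwa [inv_eq_of_mul_eq_one_right h]
    rintro ⟨ψ, hψ, h⟩
    exact key _ ψ hψ h

variable (ξ l) in
-- The local ring at the generic point is the whole function field, so the description of local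
-- rings as fractions of a chart applies to every rational function.
lemma exists_eq_toField_div (φ : (surface ξ l).functionField) :
    ∃ a b, φ = toField ξ l a / toField ξ l b := by
  obtain ⟨b, hb⟩ := exists_dominates ξ l (genericPoint (surface ξ l))
  have hφ : φ ∈ localRing (genericPoint (surface ξ l)) := by
    refine ⟨φ, ?_⟩
    exact congrArg (fun f => f.hom φ) ((surface ξ l).presheaf.stalkSpecializes_refl _)
  obtain ⟨_, ⟨a, -, rfl⟩, _, ⟨c, -, rfl⟩, ψ, -, h1, h2⟩ := hb.isFractions.2 φ hφ
  exact ⟨a, c, by rw [h2, div_eq_mul_inv]; congr 1; exact (inv_eq_of_mul_eq_one_right h1).symm⟩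

variable [CharP k p]

variable (ξ l) in
/-- The rational pluricanonical form `(dw ∧ ds) ^ n`. -/
noncomputable def surfaceForm (n : ℕ) : PluriForm k (surface ξ l).functionField 2 n :=
  formPow k n (mainForm (toField ξ l))

variable (ξ l) in
lemma surfaceForm_ne_zero (n : ℕ) : surfaceForm ξ l n ≠ 0 :=
  formPow_ne_zero n (mainForm_ne_zero _ (toField_injective ξ l) (exists_eq_toField_div ξ l))

lemma Dominates.stalkLattice_eq (hl : 2 ≤ l) (hle : l ∣ e) (hlp : l ∣ p + 1) {b : Patch × Bool}
    {y : surface ξ l} (h : Dominates (toField ξ l) (localRing y) b) (n : ℕ) :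
    stalkLattice k (localRing y) 2 n =
      Submodule.span (localRing y) {canonicalCoef (toField ξ l) b ^ n • surfaceForm ξ l n} :=
  TangoRaynaud.stalkLattice_eq _ hl hle hlp b (isLocalRing_localRing y) h.isFractions n

lemma Dominates.smul_mem_stalkLattice_iff (hl : 2 ≤ l) (hle : l ∣ e) (hlp : l ∣ p + 1)
    {b : Patch × Bool} {y : surface ξ l} (h : Dominates (toField ξ l) (localRing y) b) (n : ℕ)
    (ψ : (surface ξ l).functionField) :
    ψ • surfaceForm ξ l n ∈ stalkLattice k (localRing y) 2 n ↔
      ψ / canonicalCoef (toField ξ l) b ^ n ∈ localRing y := by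
  rw [h.stalkLattice_eq hl hle hlp, smul_mem_span_iff _ (surfaceForm_ne_zero ξ l n)
    (pow_ne_zero n (canonicalCoef_ne_zero _ b))]

lemma Dominates.stalkLattice_eq_span_iff (hl : 2 ≤ l) (hle : l ∣ e) (hlp : l ∣ p + 1)
    {b : Patch × Bool} {y : surface ξ l} (h : Dominates (toField ξ l) (localRing y) b) (n : ℕ)
    {ψ : (surface ξ l).functionField} (hψ : ψ ≠ 0)
    (hmem : ψ / canonicalCoef (toField ξ l) b ^ n ∈ localRing y) :
    stalkLattice k (localRing y) 2 n = Submodule.span (localRing y) {ψ • surfaceForm ξ l n} ↔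
      (ψ / canonicalCoef (toField ξ l) b ^ n)⁻¹ ∈ localRing y := by
  have hφ := pow_ne_zero n (canonicalCoef_ne_zero (toField ξ l) b)
  rw [h.stalkLattice_eq hl hle hlp, span_smul_eq_iff _ (surfaceForm_ne_zero ξ l n) hφ hmem]
  constructor
  · rintro ⟨c, hc, h⟩
    rw [inv_eq_of_mul_eq_one_right h]
    exact hc
  · exact fun h => ⟨_, h, mul_inv_cancel₀ (div_ne_zero hψ hφ)⟩

end Surface

end TangoRaynaud

/-! ## Ampleness -/

namespace TangoRaynaud

open Canonical

section Ample

variable {k : Type u} [Field k] {p e : ℕ} [Fact p.Prime] [NeZero e] {ξ : TangoCocycle k p e} {l : ℕ}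

lemma s_ne_zero [CharP k p] [IsAlgClosed k] (h : 2 ≤ p * e) (hl : 0 < l) : s ξ l ≠ 0 := by
  have := isDomain_puncturedRing (k := k) h
  intro h0
  have h1 := s_pow ξ l
  rw [h0, zero_pow hl.ne'] at h1
  have h2 : polyToCover ξ l (.X ^ p - .C ξ.aU) = 0 := by
    rw [map_sub, map_pow]
    exact h1.symm
  rw [map_eq_zero_iff _ (polyToCover_injective ξ l h hl)] at h2
  exact (Polynomial.monic_X_pow_sub_C ξ.aU (Fact.out : p.Prime).ne_zero).ne_zero h2

variable [IsDomain (CoverRing ξ l)] [IsIntegral (surface ξ l)]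

attribute [local instance] surfaceFieldAlgebra

lemma branchValue_ne_zero (hs : s ξ l ≠ 0) (b : Patch × Bool) : branchValue (toField ξ l) b ≠ 0 :=
  div_ne_zero (pow_ne_zero _ ((map_ne_zero_iff _ (toField_injective ξ l)).mpr hs))
    (pow_ne_zero _ (chartSection_ne_zero _ b))

variable [CharP k p]

lemma smul_mem_pluriSections (hl : 2 ≤ l) (hle : l ∣ e) (hlp : l ∣ p + 1) {n : ℕ}
    {ψ : (surface ξ l).functionField} (h : ∀ y b, Dominates (toField ξ l) (localRing y) b →
      ψ / canonicalCoef (toField ξ l) b ^ n ∈ localRing y) :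
    ψ • surfaceForm ξ l n ∈ pluriSections (surfaceToBase ξ l) 2 n := by
  intro y
  obtain ⟨b, hb⟩ := exists_dominates ξ l y
  exact (hb.smul_mem_stalkLattice_iff hl hle hlp n ψ).mpr (h y b hb)

/-- The complement of `F` over a patch is the locus where a pluricanonical form does not vanish. -/
lemma exists_section_affine (hl : 2 ≤ l) (hle : l ∣ e) (hlp : l ∣ p + 1) (ha : coeffT p l ≠ 0)
    (j : Patch) : ∃ η ∈ pluriSections (surfaceToBase ξ l) 2 (p * e), ∃ W : (surface ξ l).Opens,
      IsAffineOpen W ∧ (∀ y, y ∈ W ↔ Dominates (toField ξ l) (localRing y) (j, false)) ∧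
      ∀ y, y ∈ W ↔ stalkLattice k (localRing y) 2 (p * e) = Submodule.span (localRing y) {η} := by
  have hp : p.Prime := Fact.out
  have h4 := four_le_mul hp hl hle
  have hK := degK_pos hp hl hle
  set θ := toField ξ l
  -- Here K_S is written as aF plus a fibre part of degree κ > 0. The power pe makes the fibre part
  -- κ times pe∞, which has the sections 1 and z to the power κ.
  set κ := degK p e l - degD p e * coeffT p l with hκ
  have hψ0 : baseSection θ j ^ κ ≠ 0 := pow_ne_zero _ (baseSection_ne_zero j)
  have hmem : ∀ y b, Dominates θ (localRing y) b →
      baseSection θ j ^ κ / canonicalCoef θ b ^ (p * e) ∈ localRing y := by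
    intro y b hb
    rw [baseSection_pow_div_canonicalCoef j b hK.le]
    exact mul_mem (pow_mem hb.sectionValue_mem _)
      (pow_mem (hb.regularOn.baseValue_mem (by omega)) _)
  -- If a product of regular factors is invertible, so is each factor. The equation of F occurs with
  -- positive exponent because a ≠ 0.
  have hinv : ∀ y b, Dominates θ (localRing y) b →
      (baseSection θ j ^ κ / canonicalCoef θ b ^ (p * e))⁻¹ ∈ localRing y →
      (sectionValue θ b)⁻¹ ∈ localRing y ∧ (baseValue θ j b.1)⁻¹ ∈ localRing y := by
    intro y b hb h
    rw [baseSection_pow_div_canonicalCoef j b hK.le] at h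
    have h1 := hb.sectionValue_mem
    have h2 := hb.regularOn.baseValue_mem (i := j) (by omega)
    constructor
    · exact Subring.inv_mem_of_pow h1 (mul_ne_zero ha (by omega)) (Subring.inv_mem_of_mul
        (pow_mem h2 _) (pow_ne_zero _ (baseValue_ne_zero _ _)) h)
    · rw [mul_comm] at h
      exact Subring.inv_mem_of_pow h2 (by omega) (Subring.inv_mem_of_mul
        (pow_mem h1 _) (pow_ne_zero _ (sectionValue_ne_zero _)) h)
  refine ⟨_, smul_mem_pluriSections hl hle hlp hmem, (surfaceMap ξ l (j, false)).opensRange,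
    isAffineOpen_opensRange _, mem_opensRange_surfaceMap_iff _, fun y => ?_⟩
  rw [mem_opensRange_surfaceMap_iff]
  constructor
  · intro hb
    rw [hb.stalkLattice_eq_span_iff hl hle hlp _ hψ0 (hmem y _ hb),
      baseSection_pow_div_canonicalCoef j _ hK.le, sectionValue_false, one_pow, one_mul, ← inv_pow]
    exact pow_mem (hb.regularOn.baseValue_self_inv_mem (by omega)) _
  · intro hy
    have hunit : ∀ b, Dominates θ (localRing y) b →
        (sectionValue θ b)⁻¹ ∈ localRing y ∧ (baseValue θ j b.1)⁻¹ ∈ localRing y := fun b hb =>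
      hinv y b hb ((hb.stalkLattice_eq_span_iff hl hle hlp _ hψ0 (hmem y _ hb)).mp hy)
    obtain ⟨b, hb⟩ := exists_dominates ξ l y
    obtain ⟨i, hi⟩ := hb.exists_of_regularOn (isLocalRing_localRing y)
      (hb.regularOn.of_baseValue (by omega) (hunit b hb).2)
    exact hi.affine_of_sectionValue (hunit _ hi).1

/-- The complement of `G` in a chart. -/
lemma exists_branch_open (hs : s ξ l ≠ 0) (b : Patch × Bool) : ∃ W : (surface ξ l).Opens,
    IsAffineOpen W ∧ ∀ y, y ∈ W ↔ Dominates (toField ξ l) (localRing y) b ∧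
      (branchValue (toField ξ l) b)⁻¹ ∈ localRing y := by
  have hdom : Dominates (toField ξ l) ((surfaceChart ξ l b).map (toField ξ l)).toSubring b :=
    fun a ha => ⟨a, ha, rfl⟩
  obtain ⟨a, ha, hab⟩ := hdom.branchValue_mem
  have hab : toField ξ l a = branchValue (toField ξ l) b := hab
  have h0 : toField ξ l a ≠ 0 := hab ▸ branchValue_ne_zero hs b
  refine ⟨(surfaceMap ξ l b).opensFunctor.obj
    (PrimeSpectrum.basicOpen (⟨a, ha⟩ : surfaceChart ξ l b)), ?_, ?_⟩
  · refine IsAffineOpen.image_of_isOpenImmersion ?_ _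
    exact IsAffineOpen.Spec_basicOpen (R := .of (surfaceChart ξ l b)) ⟨a, ha⟩
  · intro y
    constructor
    · rintro ⟨q, hq, rfl⟩
      refine ⟨dominates_surfaceMap b q, ?_⟩
      rw [← hab]
      exact (inv_toField_mem_iff q ha h0).mpr hq
    · rintro ⟨hb, hinv⟩
      obtain ⟨q, rfl⟩ := hb.exists_surfaceMap_eq
      rw [← hab] at hinv
      exact ⟨q, (inv_toField_mem_iff q ha h0).mp hinv, rfl⟩

/-- The complement of `G` over a patch is affine. -/
lemma exists_branch_affine (hs : s ξ l ≠ 0) (j : Patch) {x : surface ξ l} {i₀ : Bool}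
    (hx : Dominates (toField ξ l) (localRing x) (j, i₀))
    (hx' : (branchValue (toField ξ l) (j, i₀))⁻¹ ∈ localRing x) : ∃ W : (surface ξ l).Opens,
    IsAffineOpen W ∧ ∀ y, y ∈ W ↔ ∃ i, Dominates (toField ξ l) (localRing y) (j, i) ∧
      (branchValue (toField ξ l) (j, i))⁻¹ ∈ localRing y := by
  set θ := toField ξ l
  choose W' hW' hmem using fun i => exists_branch_open hs (j, i)
  have hW : ∀ y, y ∈ W' false ⊔ W' true ↔ ∃ i, Dominates θ (localRing y) (j, i) ∧
      (branchValue θ (j, i))⁻¹ ∈ localRing y := by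
    intro y
    have : y ∈ W' false ⊔ W' true ↔ y ∈ W' false ∨ y ∈ W' true := Iff.rfl
    rw [this, hmem, hmem, Bool.exists_bool]
  refine ⟨W' false ⊔ W' true, ?_, hW⟩
  have : Nonempty (W' false ⊔ W' true : (surface ξ l).Opens) := ⟨⟨x, (hW x).mpr ⟨i₀, hx, hx'⟩⟩⟩
  have hv0 := fiberCoord_ne_zero θ j
  have h0 := fun i => branchValue_ne_zero hs (j, i)
  -- The functions 1/(v^p - b) and v^p/(v^p - b) are regular off G, and v^p/(v^p - b) - b/(v^p - b)
  -- = 1. They generate the unit ideal, and their loci of invertibility are the complements of G in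
  -- the two charts.
  have hrel : (branchValue θ (j, true))⁻¹ = fiberCoord ξ θ j ^ p * (branchValue θ (j, false))⁻¹ := by
    rw [eq_comm, ← div_eq_mul_inv, div_eq_iff (h0 _), inv_mul_eq_div, eq_div_iff (h0 _),
      branchValue_eq_false, branchValue_eq_true, mul_sub, mul_one, mul_left_comm, ← mul_pow,
      mul_inv_cancel₀ hv0, one_pow, mul_one]
  have hrel' : (branchValue θ (j, false))⁻¹ =
      (fiberCoord ξ θ j)⁻¹ ^ p * (branchValue θ (j, true))⁻¹ := by
    rw [hrel, ← mul_assoc, ← mul_pow, inv_mul_cancel₀ hv0, one_pow, one_mul]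
  have hone : (branchValue θ (j, true))⁻¹ -
      baseHom ξ θ (localLift ξ j) * (branchValue θ (j, false))⁻¹ = 1 := by
    rw [hrel, ← sub_mul, ← branchValue_eq_false, mul_inv_cancel₀ (h0 _)]
  have hbmem : ∀ y ∈ W' false ⊔ W' true, baseHom ξ θ (localLift ξ j) ∈ localRing y := by
    intro y hy
    obtain ⟨i, hi, -⟩ := (hW y).mp hy
    exact hi.regularOn _ (localLift_mem ξ j)
  refine isAffineOpen_of_regular_pair hW' (φ := fun i => (branchValue θ (j, i))⁻¹) ?_ hbmem hone ?_
  · intro i y hy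
    obtain ⟨i', hi', hinv⟩ := (hW y).mp hy
    rcases i with _ | _ <;> rcases i' with _ | _
    · exact hinv
    · rw [hrel']
      exact mul_mem (pow_mem (dominates_true_iff.mp hi').2.1 _) hinv
    · rw [hrel]
      exact mul_mem (pow_mem (dominates_false_iff.mp hi').2.1 _) hinv
    · exact hinv
  · intro i y
    constructor
    · intro hy
      obtain ⟨hi, hinv⟩ := (hmem i y).mp hy
      exact ⟨(hW y).mpr ⟨i, hi, hinv⟩, _, hi.branchValue_mem, inv_mul_cancel₀ (h0 i)⟩
    · rintro ⟨hy, ψ, hψ, hψ1⟩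
      have hbi : branchValue θ (j, i) ∈ localRing y := by
        rw [inv_mul_eq_one₀ (h0 i)] at hψ1
        rwa [hψ1]
      obtain ⟨i', hi', hinv⟩ := (hW y).mp hy
      rw [hmem]
      have hp : p ≠ 0 := (Fact.out : p.Prime).ne_zero
      rcases i with _ | _ <;> rcases i' with _ | _
      · exact ⟨hi', hinv⟩
      · have hVmem := (dominates_true_iff.mp hi').2.1
        -- Invertibility of v^(-p) times a unit makes v^(-1) invertible, so the point already lies
        -- in the affine chart.
        have hv : fiberCoord ξ θ j ∈ localRing y := by
          have h1 : ((fiberCoord ξ θ j)⁻¹ ^ p * (branchValue θ (j, true))⁻¹)⁻¹ ∈ localRing y := by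
            rwa [← hrel', inv_inv]
          simpa using Subring.inv_mem_of_pow hVmem hp
            (Subring.inv_mem_of_mul hinv (inv_ne_zero (h0 _)) h1)
        refine ⟨hi'.affine hv, ?_⟩
        rw [hrel']
        exact mul_mem (pow_mem hVmem _) hinv
      · have hvmem := (dominates_false_iff.mp hi').2.1
        have hV : (fiberCoord ξ θ j)⁻¹ ∈ localRing y := by
          have h1 : (fiberCoord ξ θ j ^ p * (branchValue θ (j, false))⁻¹)⁻¹ ∈ localRing y := by
            rwa [← hrel, inv_inv]
          exact Subring.inv_mem_of_pow hvmem hp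
            (Subring.inv_mem_of_mul hinv (inv_ne_zero (h0 _)) h1)
        refine ⟨hi'.infinity hV, ?_⟩
        rw [hrel]
        exact mul_mem (pow_mem hvmem _) hinv
      · exact ⟨hi', hinv⟩

/-- The complement of `G` over a patch is the locus where a pluricanonical form does not vanish. -/
lemma exists_section_branch (hs : s ξ l ≠ 0) (hl : 2 ≤ l) (hle : l ∣ e) (hlp : l ∣ p + 1)
    (ha : coeffT p l ≠ 0) (j : Patch) :
    ∃ η ∈ pluriSections (surfaceToBase ξ l) 2 (p * e), ∀ y : surface ξ l,
      (∃ i, Dominates (toField ξ l) (localRing y) (j, i) ∧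
        (branchValue (toField ξ l) (j, i))⁻¹ ∈ localRing y) ↔
      stalkLattice k (localRing y) 2 (p * e) = Submodule.span (localRing y) {η} := by
  have hp : p.Prime := Fact.out
  have h4 := four_le_mul hp hl hle
  have hK := degK_pos hp hl hle
  set θ := toField ξ l
  -- Since G ~ pT, the multiple peK_S is aeG plus a fibre part `degK` times pe∞. As s^l is the
  -- equation of G, it occurs to the power ae.
  set ψ := (θ (s ξ l) ^ l) ^ (coeffT p l * e) * baseSection θ j ^ degK p e l with hψ
  have hθs : θ (s ξ l) ≠ 0 := (map_ne_zero_iff _ (toField_injective ξ l)).mpr hs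
  have hψ0 : ψ ≠ 0 := mul_ne_zero (pow_ne_zero _ (pow_ne_zero _ hθs))
    (pow_ne_zero _ (baseSection_ne_zero j))
  have hdiv : ∀ b, ψ / canonicalCoef θ b ^ (p * e) =
      branchValue θ b ^ (coeffT p l * e) * baseValue θ j b.1 ^ degK p e l :=
    root_pow_mul_div_canonicalCoef j
  have hmem : ∀ y b, Dominates θ (localRing y) b →
      ψ / canonicalCoef θ b ^ (p * e) ∈ localRing y := by
    intro y b hb
    rw [hdiv]
    exact mul_mem (pow_mem hb.branchValue_mem _)
      (pow_mem (hb.regularOn.baseValue_mem (by omega)) _)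
  have hinv : ∀ y b, Dominates θ (localRing y) b →
      (ψ / canonicalCoef θ b ^ (p * e))⁻¹ ∈ localRing y →
      (branchValue θ b)⁻¹ ∈ localRing y ∧ (baseValue θ j b.1)⁻¹ ∈ localRing y := by
    intro y b hb h
    rw [hdiv] at h
    have h1 := hb.branchValue_mem
    have h2 := hb.regularOn.baseValue_mem (i := j) (by omega)
    constructor
    · exact Subring.inv_mem_of_pow h1 (mul_ne_zero ha (NeZero.ne e)) (Subring.inv_mem_of_mul
        (pow_mem h2 _) (pow_ne_zero _ (baseValue_ne_zero _ _)) h)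
    · rw [mul_comm] at h
      exact Subring.inv_mem_of_pow h2 (by omega) (Subring.inv_mem_of_mul
        (pow_mem h1 _) (pow_ne_zero _ (branchValue_ne_zero hs _)) h)
  refine ⟨_, smul_mem_pluriSections hl hle hlp hmem, fun y => ?_⟩
  constructor
  · rintro ⟨i, hb, hi⟩
    rw [hb.stalkLattice_eq_span_iff hl hle hlp _ hψ0 (hmem y _ hb), hdiv, mul_inv, ← inv_pow,
      ← inv_pow]
    exact mul_mem (pow_mem hi _) (pow_mem (hb.regularOn.baseValue_self_inv_mem (by omega)) _)
  · intro hy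
    have hunit : ∀ b, Dominates θ (localRing y) b →
        (branchValue θ b)⁻¹ ∈ localRing y ∧ (baseValue θ j b.1)⁻¹ ∈ localRing y := fun b hb =>
      hinv y b hb ((hb.stalkLattice_eq_span_iff hl hle hlp _ hψ0 (hmem y _ hb)).mp hy)
    obtain ⟨b, hb⟩ := exists_dominates ξ l y
    obtain ⟨i, hi⟩ := hb.exists_of_regularOn (isLocalRing_localRing y)
      (hb.regularOn.of_baseValue (by omega) (hunit b hb).2)
    exact ⟨i, hi, (hunit _ hi).1⟩

/-- Every point lies off `F` or off `G`. -/
lemma Dominates.affine_or_branch {O : Subring (surface ξ l).functionField} (hloc : IsLocalRing O)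
    {j : Patch} {i : Bool} (h : Dominates (toField ξ l) O (j, i)) :
    Dominates (toField ξ l) O (j, false) ∨
      Dominates (toField ξ l) O (j, true) ∧ (branchValue (toField ξ l) (j, true))⁻¹ ∈ O := by
  rcases i with _ | _
  · exact .inl h
  have hV := (dominates_true_iff.mp h).2.1
  have hb := h.regularOn _ (localLift_mem ξ j)
  have hbV := mul_mem hb (pow_mem hV p)
  -- Near F the equation of G is 1 - b V^p, where V is that of F; their zero loci are disjoint. In
  -- the local ring either 1 - b V^p is a unit, or b V^p and hence V is.
  have hsum : (⟨_, h.branchValue_mem⟩ : O) + ⟨_, hbV⟩ = 1 := by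
    refine Subtype.ext ?_
    change branchValue _ _ + _ = (1 : (surface ξ l).functionField)
    rw [branchValue_eq_true, sub_add_cancel]
  rcases IsLocalRing.isUnit_or_isUnit_of_add_one hsum with hu | hu
  · exact .inr ⟨h, Subring.inv_mem_of_isUnit _ hu⟩
  · left
    have h1 := Subring.inv_mem_of_isUnit _ hu
    have hb0 : baseHom ξ (toField ξ l) (localLift ξ j) ≠ 0 := by
      intro h0
      refine hu.ne_zero (Subtype.ext ?_)
      change baseHom ξ (toField ξ l) (localLift ξ j) * _ = 0
      rw [h0, zero_mul]
    rw [mul_comm] at h1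
    have h2 := Subring.inv_mem_of_pow hV (Fact.out : p.Prime).ne_zero
      (Subring.inv_mem_of_mul hb hb0 h1)
    rw [inv_inv] at h2
    exact h.affine h2

/-- The complements of F and of G over the two patches cover S because F and G are disjoint. Each is
affine and is the non-vanishing locus of a section of the power pe of the canonical sheaf. -/
theorem isCanonicallyAmple (hs : s ξ l ≠ 0) (hl : 2 ≤ l) (hle : l ∣ e) (hlp : l ∣ p + 1)
    (ha : coeffT p l ≠ 0) : IsCanonicallyAmple (surfaceToBase ξ l) 2 := by
  have hp : p.Prime := Fact.out
  refine ⟨Atlas.compactSpace_glue (isAtlas_surfaceChart ξ l), fun x =>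
    ⟨p * e, Nat.mul_pos hp.pos (Nat.pos_of_ne_zero (NeZero.ne e)), ?_⟩⟩
  obtain ⟨⟨j, i⟩, hb⟩ := exists_dominates ξ l x
  rcases hb.affine_or_branch (isLocalRing_localRing x) with h | ⟨h, h'⟩
  · obtain ⟨η, hη, W, hW, hW', hW''⟩ := exists_section_affine (ξ := ξ) hl hle hlp ha j
    exact ⟨η, hη, W, hW, (hW' x).mpr h, hW''⟩
  · obtain ⟨W, hW, hW'⟩ := exists_branch_affine hs j h h'
    obtain ⟨η, hη, hη'⟩ := exists_section_branch hs hl hle hlp ha j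
    exact ⟨η, hη, W, hW, (hW' x).mpr ⟨true, h, h'⟩, fun y => (hW' y).trans (hη' y)⟩

end Ample

end TangoRaynaud

/-! ## Functions on the surface over a patch of the curve -/

namespace TangoRaynaud

section Weight

variable {k : Type u} [Field k] {p e : ℕ} (ξ : TangoCocycle k p e) (l r : ℕ)

/-- The sums of monomials `a w ^ m s ^ b` of weight at most `n`, where `w` has weight `1` and `s` has
weight `r`. -/
noncomputable def weightSpan (n : ℕ) : AddSubmonoid (CoverRing ξ l) :=
  AddSubmonoid.closure {f | ∃ a m b, m + r * b ≤ n ∧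
    f = toCover ξ l a * (frame ξ l .U : CoverRing ξ l) ^ m * s ξ l ^ b}

variable {ξ l r}

lemma monomial_mem_weightSpan {n m b : ℕ} (a : PuncturedRing k p e) (h : m + r * b ≤ n) :
    toCover ξ l a * (frame ξ l .U : CoverRing ξ l) ^ m * s ξ l ^ b ∈ weightSpan ξ l r n :=
  AddSubmonoid.subset_closure ⟨a, m, b, h, rfl⟩

lemma toCover_mem_weightSpan (a : PuncturedRing k p e) (n : ℕ) :
    toCover ξ l a ∈ weightSpan ξ l r n := by
  simpa using monomial_mem_weightSpan (r := r) (n := n) (m := 0) (b := 0) a (by simp)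

lemma frame_pow_mem_weightSpan {m n : ℕ} (h : m ≤ n) :
    (frame ξ l .U : CoverRing ξ l) ^ m ∈ weightSpan ξ l r n := by
  simpa using monomial_mem_weightSpan (ξ := ξ) (l := l) (r := r) (n := n) (m := m) (b := 0) 1 (by simpa)

lemma s_mem_weightSpan {n : ℕ} (h : r ≤ n) : s ξ l ∈ weightSpan ξ l r n := by
  simpa using monomial_mem_weightSpan (ξ := ξ) (l := l) (r := r) (n := n) (m := 0) (b := 1) 1 (by simpa)

lemma weightSpan_mono {m n : ℕ} (h : m ≤ n) : weightSpan ξ l r m ≤ weightSpan ξ l r n := by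
  refine AddSubmonoid.closure_mono ?_
  rintro _ ⟨a, i, b, hi, rfl⟩
  exact ⟨a, i, b, hi.trans h, rfl⟩

lemma mul_mem_weightSpan {m n : ℕ} {f g : CoverRing ξ l} (hf : f ∈ weightSpan ξ l r m)
    (hg : g ∈ weightSpan ξ l r n) : f * g ∈ weightSpan ξ l r (m + n) := by
  induction hf using AddSubmonoid.closure_induction with
  | zero => rw [zero_mul]; exact zero_mem _
  | add x y _ _ hx hy => rw [add_mul]; exact add_mem hx hy
  | mem x hx =>
    obtain ⟨a, i, b, hi, rfl⟩ := hx
    induction hg using AddSubmonoid.closure_induction with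
    | zero => rw [mul_zero]; exact zero_mem _
    | add x y _ _ hx hy => rw [mul_add]; exact add_mem hx hy
    | mem x hx =>
      obtain ⟨a', i', b', hi', rfl⟩ := hx
      have h1 : (i + i') + r * (b + b') ≤ m + n := by
        rw [mul_add]; omega
      have h2 := monomial_mem_weightSpan (ξ := ξ) (l := l) (a * a') h1
      rw [map_mul, pow_add, pow_add] at h2
      convert h2 using 1
      ring

/-- An element of weight at most `n` has a representative of degree less than `l` in `s`. -/
lemma exists_reduced (hl : 0 < l) (hrl : r * l = p + 1) {n : ℕ} {f : CoverRing ξ l}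
    (hf : f ∈ weightSpan ξ l r n) : ∃ P : Polynomial (Polynomial (PuncturedRing k p e)),
      P.degree < l ∧ (∀ i m, (P.coeff i).coeff m ≠ 0 → m + r * i ≤ n) ∧
        bivariateToCover ξ l P = f := by
  -- Reduced polynomials of weight at most n are closed under addition, so it suffices to reduce one
  -- monomial, by induction on the exponent of s.
  let S : AddSubmonoid (Polynomial (Polynomial (PuncturedRing k p e))) :=
    { carrier := {P | P.degree < l ∧ ∀ i m, (P.coeff i).coeff m ≠ 0 → m + r * i ≤ n}
      zero_mem' := by simp
      add_mem' := by
        rintro P Q ⟨hP, hP'⟩ ⟨hQ, hQ'⟩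
        refine ⟨(Polynomial.degree_add_le P Q).trans_lt (max_lt hP hQ), fun i m h => ?_⟩
        rw [Polynomial.coeff_add, Polynomial.coeff_add] at h
        by_cases h0 : (P.coeff i).coeff m = 0
        · exact hQ' i m fun h1 => h (by rw [h0, h1, add_zero])
        · exact hP' i m h0 }
  suffices h : weightSpan ξ l r n ≤ S.map (bivariateToCover ξ l : _ →+ CoverRing ξ l) by
    obtain ⟨P, ⟨h1, h2⟩, h3⟩ := h hf
    exact ⟨P, h1, h2, h3⟩
  refine (AddSubmonoid.closure_le).mpr ?_
  rintro _ ⟨a, m, b, h, rfl⟩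
  induction b using Nat.strong_induction_on generalizing a m with
  | _ b ih =>
    rcases lt_or_ge b l with hb | hb
    · refine ⟨Polynomial.monomial b (Polynomial.monomial m a), ⟨?_, ?_⟩, ?_⟩
      · exact (Polynomial.degree_monomial_le _ _).trans_lt (by exact_mod_cast hb)
      · intro i m' h'
        rw [Polynomial.coeff_monomial] at h'
        split_ifs at h' with hi
        · rw [Polynomial.coeff_monomial] at h'
          split_ifs at h' with hm
          · rw [← hi, ← hm]; exact h
          · exact absurd rfl h'
        · exact absurd (Polynomial.coeff_zero _) h'
      · change bivariateToCover ξ l _ = _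
        rw [← Polynomial.C_mul_X_pow_eq_monomial, ← Polynomial.C_mul_X_pow_eq_monomial, map_mul,
          map_pow]
        change polyToCover ξ l _ * s ξ l ^ b = _
        rw [map_mul, map_pow]
        rfl
    -- Replacing s^l, of weight rl = p + 1, by w^p - aU does not raise the weight.
    · obtain ⟨c, rfl⟩ := Nat.exists_eq_add_of_le hb
      have hw : m + p + r * c ≤ n := by
        rw [mul_add] at h
        omega
      have hw' : m + r * c ≤ n := by omega
      have h1 := ih c (by omega) a (m + p) hw
      have h2 := ih c (by omega) (-(a * ξ.aU)) m hw'
      have h3 := add_mem h1 h2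
      rw [SetLike.mem_coe]
      convert h3 using 1
      rw [pow_add (s ξ l), s_pow, map_neg, map_mul, pow_add]
      ring

/-- The functions on the chart off `F` over `U` have bounded weight. -/
lemma exists_mem_weightSpan {f : CoverRing ξ l} (hf : f ∈ surfaceChart ξ l (.U, false))
    (r : ℕ) : ∃ n, f ∈ weightSpan ξ l r n := by
  let T : Subalgebra k (CoverRing ξ l) :=
    { carrier := {f | ∃ n, f ∈ weightSpan ξ l r n}
      mul_mem' := by
        rintro f g ⟨m, hf⟩ ⟨n, hg⟩
        exact ⟨_, mul_mem_weightSpan hf hg⟩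
      add_mem' := by
        rintro f g ⟨m, hf⟩ ⟨n, hg⟩
        exact ⟨m + n, add_mem (weightSpan_mono (by omega) hf) (weightSpan_mono (by omega) hg)⟩
      algebraMap_mem' := fun c => ⟨0, by
        rw [← (toCover ξ l).commutes]; exact toCover_mem_weightSpan _ 0⟩ }
  suffices h : surfaceChart ξ l (.U, false) ≤ T from h hf
  have hgen : ∀ n, gen ξ l n .U = 1 := fun n => map_one _
  refine sup_le (sup_le ?_ (Algebra.adjoin_le ?_)) (Algebra.adjoin_le ?_)
  · rintro _ ⟨a, -, rfl⟩
    exact ⟨0, toCover_mem_weightSpan a 0⟩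
  · rintro _ (rfl | rfl)
    · exact ⟨0, by simpa [Atlas.frameSection] using frame_pow_mem_weightSpan (le_refl 0)⟩
    · exact ⟨1, by simpa [Atlas.frameSection, hgen] using frame_pow_mem_weightSpan (le_refl 1)⟩
  · rintro _ rfl
    exact ⟨r, by simpa [Atlas.frameSection, hgen] using s_mem_weightSpan (le_refl r)⟩

/-- The weight measures the pole along F. In the chart at infinity 1/w and s/w^r are regular, so w^n
f has weight at most n for some n. -/
lemma exists_frame_pow_mul_mem_weightSpan {f : CoverRing ξ l}
    (hf : f ∈ surfaceChart ξ l (.U, true)) :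
    ∃ n, (frame ξ l .U : CoverRing ξ l) ^ n * f ∈ weightSpan ξ l ((p + 1) / l) n := by
  set r := (p + 1) / l with hr
  let T : Subalgebra k (CoverRing ξ l) :=
    { carrier := {f | ∃ n, (frame ξ l .U : CoverRing ξ l) ^ n * f ∈ weightSpan ξ l r n}
      mul_mem' := by
        rintro f g ⟨m, hf⟩ ⟨n, hg⟩
        refine ⟨m + n, ?_⟩
        convert mul_mem_weightSpan hf hg using 1
        ring
      add_mem' := by
        rintro f g ⟨m, hf⟩ ⟨n, hg⟩
        refine ⟨m + n, ?_⟩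
        convert add_mem (mul_mem_weightSpan hf (frame_pow_mem_weightSpan (le_refl n)))
          (mul_mem_weightSpan (frame_pow_mem_weightSpan (le_refl m)) hg) using 1
        ring
      algebraMap_mem' := fun c => ⟨0, by
        rw [pow_zero, one_mul, ← (toCover ξ l).commutes]; exact toCover_mem_weightSpan _ 0⟩ }
  suffices h : surfaceChart ξ l (.U, true) ≤ T from h hf
  have hgen : ∀ n, gen ξ l n .U = 1 := fun n => map_one _
  refine sup_le (sup_le ?_ (Algebra.adjoin_le ?_)) (Algebra.adjoin_le ?_)
  · rintro _ ⟨a, -, rfl⟩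
    exact ⟨0, by simpa using toCover_mem_weightSpan a 0⟩
  · rintro _ (rfl | rfl)
    · refine ⟨1, ?_⟩
      simpa [Atlas.frameSection, hgen] using frame_pow_mem_weightSpan (Nat.zero_le 1)
    · exact ⟨0, by simpa [Atlas.frameSection] using frame_pow_mem_weightSpan (le_refl 0)⟩
  · rintro _ rfl
    refine ⟨r, ?_⟩
    have h1 : (frame ξ l .U : CoverRing ξ l) ^ r * (s ξ l * ((gen ξ l (e / l * (p * e - 3)) .U /
        frame ξ l .U ^ r : (CoverRing ξ l)ˣ) : CoverRing ξ l)) = s ξ l := by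
      rw [hgen, mul_left_comm, ← Units.val_pow_eq_pow_val, ← Units.val_mul, mul_div_cancel]
      simp
    change (frame ξ l .U : CoverRing ξ l) ^ r * (s ξ l * ((gen ξ l (e / l * (p * e - 3)) .U /
        frame ξ l .U ^ r : (CoverRing ξ l)ˣ) : CoverRing ξ l)) ∈ _
    rw [h1]
    exact s_mem_weightSpan (le_refl r)

/-- The functions on the surface over `U` are functions on the curve. -/
lemma mem_range_toCover [IsAlgClosed k] [Fact p.Prime] [CharP k p] [NeZero e] (h : 2 ≤ p * e)
    (hl : 0 < l) (hlp : l ∣ p + 1) {f : CoverRing ξ l} (hf : f ∈ surfaceChart ξ l (.U, false))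
    (hf' : f ∈ surfaceChart ξ l (.U, true)) : ∃ a, toCover ξ l a = f := by
  have := isDomain_puncturedRing (k := k) h
  have hrl : (p + 1) / l * l = p + 1 := Nat.div_mul_cancel hlp
  have hr : 0 < (p + 1) / l := Nat.pos_of_ne_zero fun h0 => by rw [h0] at hrl; omega
  obtain ⟨m, hm⟩ := exists_mem_weightSpan hf ((p + 1) / l)
  obtain ⟨P, hP, -, hPf⟩ := exists_reduced hl hrl hm
  obtain ⟨n, hn⟩ := exists_frame_pow_mul_mem_weightSpan hf'
  obtain ⟨Q, hQ, hQ', hQf⟩ := exists_reduced hl hrl hn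
  -- Both sides are reduced representatives of w^n f, and such representatives are unique.
  have hQP : Q = .C (.X ^ n) * P := by
    refine sum_root_injective ξ l hl hQ ((Polynomial.degree_mul_le _ _).trans_lt ?_) ?_
    · refine lt_of_le_of_lt (add_le_add_left Polynomial.degree_C_le _) ?_
      rwa [zero_add]
    · refine algebraMap_cover_injective ξ l h hl ?_
      change bivariateToCover ξ l Q = bivariateToCover ξ l (.C (.X ^ n) * P)
      rw [hQf, map_mul, hPf]
      congr 1
      change _ = polyToCover ξ l _
      rw [map_pow]
      rfl
  -- A monomial w^j s^i of P occurs in Q as w^(j + n) s^i, so j + n + ri ≤ n. As r > 0, only the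
  -- constant monomial is possible.
  have hzero : ∀ i j, (P.coeff i).coeff j ≠ 0 → j = 0 ∧ i = 0 := by
    intro i j hij
    have h1 := hQ' i (j + n) (by
      rwa [hQP, Polynomial.coeff_C_mul, mul_comm, Polynomial.coeff_mul_X_pow])
    have h2 : (p + 1) / l * i = 0 := by omega
    exact ⟨by omega, (Nat.mul_eq_zero.mp h2).resolve_left hr.ne'⟩
  have hPC : P = .C (.C ((P.coeff 0).coeff 0)) := by
    ext i j
    by_contra hne
    have : (P.coeff i).coeff j ≠ 0 ∨ (i = 0 ∧ j = 0) := by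
      by_cases hij : i = 0 ∧ j = 0
      · exact .inr hij
      · left
        intro h0
        rw [h0, Polynomial.coeff_C] at hne
        split_ifs at hne with hi
        · rw [Polynomial.coeff_C] at hne
          split_ifs at hne with hj
          · exact hij ⟨hi, hj⟩
          · exact hne rfl
        · exact hne (by simp)
    have h00 : i = 0 ∧ j = 0 := by
      rcases this with h1 | h1
      · exact ⟨(hzero i j h1).2, (hzero i j h1).1⟩
      · exact h1
    obtain ⟨rfl, rfl⟩ := h00
    exact hne (by simp)
  refine ⟨(P.coeff 0).coeff 0, ?_⟩
  rw [← hPf, hPC]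
  simp only [Polynomial.coeff_C_zero]
  rfl

end Weight

end TangoRaynaud

/-! ## The Kodaira dimension -/

/-- A field generated by elements that are algebraic over a polynomial ring in one variable has
transcendence degree at most one. -/
lemma IntermediateField.trdeg_adjoin_le_one {k K : Type u} [Field k] [Field K] [Algebra k K] (ζ : K)
    {S : Set K} (h : ∀ φ ∈ S, IsAlgebraic (Algebra.adjoin k {ζ}) φ) :
    Algebra.trdeg k (IntermediateField.adjoin k S) ≤ 1 := by
  set R := Algebra.adjoin k {ζ}
  let A := Subalgebra.algebraicClosure R K
  let F : IntermediateField k K := (A.restrictScalars k).toIntermediateField fun φ hφ =>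
    IsAlgebraic.inv hφ
  have hF : IntermediateField.adjoin k S ≤ F := IntermediateField.adjoin_le_iff.mpr h
  let ι : IntermediateField.adjoin k S →ₐ[k] A :=
    (IntermediateField.adjoin k S).val.codRestrict (A.restrictScalars k) fun x => hF x.2
  have hι : Function.Injective ι := fun x y hxy =>
    Subtype.ext (congrArg (fun a : A => (a : K)) hxy)
  refine (trdeg_le_of_injective ι hι).trans ?_
  have : FaithfulSMul R A := (faithfulSMul_iff_algebraMap_injective R A).mpr fun x y hxy =>
    Subtype.ext (congrArg (fun a : A => (a : K)) hxy)
  -- The algebraic closure A of k[ζ] in K adds no transcendence degree, and k[ζ] is a quotient of a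
  -- polynomial ring in one variable.
  have h1 : Algebra.trdeg k A = Algebra.trdeg k R + Algebra.trdeg R A :=
    (trdeg_add_eq k R).symm
  rw [h1, trdeg_eq_zero (R := R) (A := A), add_zero]
  have hsurj : Function.Surjective (Polynomial.aeval (R := k)
      (⟨ζ, Algebra.self_mem_adjoin_singleton k ζ⟩ : R)) := by
    rintro ⟨φ, hφ⟩
    obtain ⟨P, hP⟩ : φ ∈ (Polynomial.aeval (R := k) ζ).range := by
      rwa [← Algebra.adjoin_singleton_eq_range_aeval]
    exact ⟨P, Subtype.ext ((Polynomial.aeval_algHom_apply R.val _ P).symm.trans hP)⟩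
  exact (trdeg_le_of_surjective _ hsurj).trans Polynomial.trdeg_of_isDomain.le

namespace TangoRaynaud

open Canonical

section

variable {k : Type u} [Field k] {p e : ℕ} {ξ : TangoCocycle k p e} {l : ℕ} {K : Type u} [Field K]
  [Algebra k K] [Fact p.Prime] [NeZero e]

/-- The functions on the curve are algebraic over the polynomials in `z`. -/
lemma isAlgebraic_baseHom (θ : CoverRing ξ l →ₐ[k] K) (h : 2 ≤ p * e) (a : PuncturedRing k p e) :
    IsAlgebraic (Algebra.adjoin k {baseHom ξ θ (z k p e)}) (baseHom ξ θ a) := by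
  set R := Algebra.adjoin k {baseHom ξ θ (z k p e)}
  let A := Subalgebra.algebraicClosure R K
  have hz : IsAlgebraic R (baseHom ξ θ (z k p e)) :=
    isAlgebraic_algebraMap (⟨_, Algebra.self_mem_adjoin_singleton k _⟩ : R)
  have hx : IsAlgebraic R (baseHom ξ θ (x k p e)) := by
    rw [eq_inv_of_mul_eq_one_right (baseHom_z_mul_x θ)]
    exact hz.inv
  have hy : IsAlgebraic R (baseHom ξ θ (y k p e)) := by
    have hdeg : (Polynomial.X : Polynomial R).degree < ((p * e : ℕ) : WithBot ℕ) := by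
      rw [Polynomial.degree_X]
      exact_mod_cast (by omega : 1 < p * e)
    refine (IsIntegral.of_aeval_monic (Polynomial.monic_X_pow_sub hdeg) ?_ ?_).isAlgebraic
    · rw [Polynomial.natDegree_sub_eq_left_of_natDegree_lt (by
        rw [Polynomial.natDegree_X, Polynomial.natDegree_X_pow]; omega), Polynomial.natDegree_X_pow]
      omega
    · have h1 : Polynomial.aeval (baseHom ξ θ (y k p e))
          (Polynomial.X ^ (p * e) - Polynomial.X : Polynomial R) =
            baseHom ξ θ (z k p e) ^ (p * e - 1) := by
        rw [map_sub, map_pow, Polynomial.aeval_X, ← map_pow, ← map_sub, yz_eq, map_pow]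
      rw [h1]
      exact (isIntegral_algebraMap
        (x := (⟨_, Algebra.self_mem_adjoin_singleton k _⟩ : R))).pow _
  have ht : IsAlgebraic R (baseHom ξ θ (t k p e)) := by
    rw [t_eq, map_mul]
    exact hy.mul hx
  have hU : curveChart k p e .U ≤ (A.restrictScalars k).comap (baseHom ξ θ) := by
    refine Algebra.adjoin_le ?_
    rintro _ (rfl | rfl)
    · exact hy
    · exact hz
  have hV : curveChart k p e .V ≤ (A.restrictScalars k).comap (baseHom ξ θ) := by
    refine Algebra.adjoin_le ?_
    rintro _ (rfl | rfl)
    · exact hx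
    · exact ht
  have htop := sup_le hU hV
  rw [curveChart_sup] at htop
  exact htop (Algebra.mem_top (x := a))

end

section Kodaira

variable {k : Type u} [Field k] {p e : ℕ} [Fact p.Prime] [NeZero e]
  {ξ : TangoCocycle k p e} {l : ℕ} [IsDomain (CoverRing ξ l)] [IsIntegral (surface ξ l)]

attribute [local instance] surfaceFieldAlgebra

/-- A rational function that is regular on a chart belongs to the coordinate ring of the chart. -/
lemma exists_toField_eq {b : Patch × Bool} {φ : (surface ξ l).functionField}
    (h : ∀ q, φ ∈ localRing (surfaceMap ξ l b q)) :
    ∃ a ∈ surfaceChart ξ l b, toField ξ l a = φ := by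
  -- The ideal of denominators of φ. Regularity at each point of the chart shows that it lies in no
  -- maximal ideal.
  let I : Ideal (surfaceChart ξ l b) :=
    { carrier := {c | ∃ a ∈ surfaceChart ξ l b, toField ξ l a = φ * toField ξ l c}
      zero_mem' := ⟨0, zero_mem _, by simp⟩
      add_mem' := by
        rintro c c' ⟨a, ha, hac⟩ ⟨a', ha', hac'⟩
        exact ⟨a + a', add_mem ha ha', by
          rw [map_add, hac, hac', AddMemClass.coe_add, map_add, mul_add]⟩
      smul_mem' := by
        rintro c c' ⟨a, ha, hac⟩
        exact ⟨c * a, mul_mem c.2 ha, by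
          rw [map_mul, hac, smul_eq_mul, MulMemClass.coe_mul, map_mul, mul_left_comm]⟩ }
  have hI : I = ⊤ := by
    by_contra hne
    obtain ⟨m, hm, hIm⟩ := Ideal.exists_le_maximal I hne
    let q : Spec (.of (surfaceChart ξ l b)) := (⟨m, hm.isPrime⟩ : PrimeSpectrum _)
    obtain ⟨_, ⟨a, ha, rfl⟩, _, ⟨c, hc, rfl⟩, ψ, hψ, h1, h2⟩ :=
      (dominates_surfaceMap b q).isFractions.2 φ (h q)
    have h1 : toField ξ l c * ψ = 1 := h1
    have hc0 : toField ξ l c ≠ 0 := left_ne_zero_of_mul_eq_one h1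
    have hcq := (inv_toField_mem_iff q hc hc0).mp (by rwa [inv_eq_of_mul_eq_one_right h1])
    refine hcq (hIm ⟨a, ha, ?_⟩)
    rw [h2]
    change toField ξ l a = toField ξ l a * ψ * toField ξ l c
    rw [mul_assoc, mul_comm ψ, h1, mul_one]
  obtain ⟨a, ha, h1⟩ : (1 : surfaceChart ξ l b) ∈ I := hI ▸ Submodule.mem_top
  exact ⟨a, ha, by rw [h1]; simp⟩

variable [CharP k p] [IsAlgClosed k]

/-- For a = 0 the form dw ∧ ds generates the two-forms on both charts over U. The coefficient of a
pluricanonical form is therefore regular on both of them and is a function from the curve. -/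
lemma exists_eq_baseHom_smul (hl : 2 ≤ l) (hle : l ∣ e) (hlp : l ∣ p + 1) (ha : coeffT p l = 0)
    {n : ℕ} {η : PluriForm k (surface ξ l).functionField 2 n}
    (hη : η ∈ pluriSections (surfaceToBase ξ l) 2 n) :
    ∃ a, η = baseHom ξ (toField ξ l) a • surfaceForm ξ l n := by
  have h4 := four_le_mul (Fact.out : p.Prime) hl hle
  obtain ⟨ψ, rfl⟩ : ∃ ψ : (surface ξ l).functionField, η = ψ • surfaceForm ξ l n := by
    obtain ⟨b, hb⟩ := exists_dominates ξ l (genericPoint (surface ξ l))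
    have h1 := hη (genericPoint (surface ξ l))
    rw [hb.stalkLattice_eq hl hle hlp] at h1
    obtain ⟨c, rfl⟩ := Submodule.mem_span_singleton.mp h1
    exact ⟨_, by rw [Subring.smul_def, smul_smul]⟩
  have hreg : ∀ i, ∃ a ∈ surfaceChart ξ l (.U, i), toField ξ l a = ψ := by
    intro i
    refine exists_toField_eq fun q => ?_
    have h1 := ((dominates_surfaceMap (.U, i) q).smul_mem_stalkLattice_iff hl hle hlp n ψ).mp (hη _)
    rwa [canonicalCoef, ha, pow_zero, param_U, one_pow, div_one, one_pow, div_one] at h1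
  obtain ⟨a, ha, haψ⟩ := hreg false
  obtain ⟨a', ha', haψ'⟩ := hreg true
  obtain rfl : a = a' := toField_injective ξ l (haψ.trans haψ'.symm)
  obtain ⟨c, hc⟩ := mem_range_toCover (by omega) (by omega) hlp ha ha'
  refine ⟨c, ?_⟩
  rw [← haψ, ← hc]
  rfl

/-- Quotients of pluricanonical forms are functions from the curve, hence algebraic over k[z], which
bounds the dimension by 1. For n = pe the forms with coefficients 1 and z^κ, κ > 0, have a
transcendental quotient, so 1 is attained. -/
theorem kodairaDim_eq_one (hl : 2 ≤ l) (hle : l ∣ e) (hlp : l ∣ p + 1) (ha : coeffT p l = 0) :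
    kodairaDim (surfaceToBase ξ l) 2 = 1 := by
  have hp : p.Prime := Fact.out
  have h4 := four_le_mul hp hl hle
  have hK := degK_pos hp hl hle
  set θ := toField ξ l
  refine le_antisymm (iSup_le fun n => ?_) ?_
  · refine WithBot.coe_le_one.mpr (Cardinal.toENat_le_one.mpr ?_)
    refine IntermediateField.trdeg_adjoin_le_one (baseHom ξ θ (z k p e)) ?_
    rintro φ ⟨η, hη, η', hη', hη0, hφ⟩
    obtain ⟨a, rfl⟩ := exists_eq_baseHom_smul hl hle hlp ha hη
    obtain ⟨a', rfl⟩ := exists_eq_baseHom_smul hl hle hlp ha hη'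
    rw [smul_smul] at hφ
    have h1 := smul_left_injective _ (surfaceForm_ne_zero ξ l n) hφ
    have h2 : baseHom ξ θ a' ≠ 0 := fun h0 => hη0 (by rw [h0, zero_smul])
    have h3 : φ = baseHom ξ θ a * (baseHom ξ θ a')⁻¹ := by
      rw [h1, mul_inv_cancel_right₀ h2]
    rw [h3]
    exact (isAlgebraic_baseHom θ (by omega) a).mul (isAlgebraic_baseHom θ (by omega) a').inv
  · have hmem : ∀ j, baseSection θ j ^ (degK p e l - degD p e * coeffT p l) •
        surfaceForm ξ l (p * e) ∈ pluriSections (surfaceToBase ξ l) 2 (p * e) := by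
      refine fun j => smul_mem_pluriSections hl hle hlp fun y b hb => ?_
      rw [baseSection_pow_div_canonicalCoef j b hK.le]
      exact mul_mem (pow_mem hb.sectionValue_mem _)
        (pow_mem (hb.regularOn.baseValue_mem (by omega)) _)
    have hne : ∀ j, baseSection θ j ^ (degK p e l - degD p e * coeffT p l) •
        surfaceForm ξ l (p * e) ≠ 0 := fun j =>
      smul_ne_zero (pow_ne_zero _ (baseSection_ne_zero j)) (surfaceForm_ne_zero ξ l _)
    refine le_trans ?_ (le_iSup _ ⟨p * e, by omega, _, hmem .U, hne .U⟩)
    refine WithBot.one_le_coe.mpr (Cardinal.one_le_toENat.mpr ?_)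
    rw [Cardinal.one_le_iff_pos]
    have htr : Transcendental k (baseHom ξ θ (z k p e)) := by
      let _ : Algebra (PuncturedRing k p e) (surface ξ l).functionField :=
        (baseHom ξ θ).toRingHom.toAlgebra
      have : IsScalarTower k (PuncturedRing k p e) (surface ξ l).functionField :=
        IsScalarTower.of_algebraMap_eq' (baseHom ξ θ).comp_algebraMap.symm
      exact (transcendental_algebraMap_iff ((toField_injective ξ l).comp
        (toCover_injective ξ l (by omega) (by omega)))).mpr (transcendental_z (by omega))
    set E := IntermediateField.adjoin k {φ : (surface ξ l).functionField |
      ∃ η ∈ pluriSections (surfaceToBase ξ l) 2 (p * e),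
        ∃ η' ∈ pluriSections (surfaceToBase ξ l) 2 (p * e), η' ≠ 0 ∧ η = φ • η'}
    have hE : baseHom ξ θ (z k p e) ^ (degK p e l - degD p e * coeffT p l) ∈ E := by
      refine IntermediateField.subset_adjoin k _ ⟨_, hmem .V, _, hmem .U, hne .U, ?_⟩
      simp [baseSection]
    have : Algebra.Transcendental k E := by
      refine ⟨⟨⟨_, hE⟩, ?_⟩⟩
      exact (transcendental_algebraMap_iff (algebraMap E (surface ξ l).functionField).injective).mp
        (htr.pow (by omega))
    exact trdeg_pos k E

end Kodaira

/-- Put r = (p + 1) / l. If a = 0 then p = r + 1, so rl = r + 2 and r(l - 1) = 2; the two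
factorizations of 2 give (l, p) = (3, 2) and (2, 3). -/
lemma coeffT_eq_zero_iff {p l : ℕ} (hp : p.Prime) (hl : 2 ≤ l) (hlp : l ∣ p + 1) :
    coeffT p l = 0 ↔ ({l, p} : Set ℕ) = {2, 3} := by
  have h1 := coeffT_add hp hl hlp
  have h2 : (p + 1) / l * l = p + 1 := Nat.div_mul_cancel hlp
  rw [Set.pair_eq_pair_iff]
  generalize coeffT p l = a at *
  generalize (p + 1) / l = r at *
  constructor
  · rintro rfl
    obtain ⟨m, rfl⟩ := Nat.exists_eq_add_of_le hl
    have h3 : r * (m + 1) = 2 := by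
      have : r * (2 + m) = r * (m + 1) + r := by ring
      omega
    have hr : r ≤ 2 := Nat.le_of_dvd (by omega) ⟨_, h3.symm⟩
    interval_cases r <;> omega
  · rintro (⟨rfl, rfl⟩ | ⟨rfl, rfl⟩) <;> omega

end TangoRaynaud

theorem mainTheorem5 {k : Type*} [Field k] [IsAlgClosed k] (p : ℕ) [Fact p.Prime] [CharP k p]
    (e l : ℕ) [NeZero e] (hep : e.Coprime p) (hl : 2 ≤ l) (hle : l ∣ e) (hlp : l ∣ p + 1)
    (ξ : TangoRaynaud.TangoCocycle k p e) :
    ∃ _ : IsIntegral (TangoRaynaud.surface ξ l),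
      (({l, p} : Set ℕ) ≠ {2, 3} → Canonical.IsCanonicallyAmple (TangoRaynaud.surfaceToBase ξ l) 2) ∧
      (({l, p} : Set ℕ) = {2, 3} → Canonical.kodairaDim (TangoRaynaud.surfaceToBase ξ l) 2 = 1) := by
  have hp : p.Prime := Fact.out
  have h4 := TangoRaynaud.four_le_mul hp hl hle
  have hcoeff := TangoRaynaud.coeffT_eq_zero_iff hp hl hlp
  have := TangoRaynaud.isDomain_coverRing ξ l (by omega) (by omega)
  have hirr := TangoRaynaud.isIntegral_surface ξ l
  refine ⟨hirr, fun h => ?_, fun h => ?_⟩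
  · exact TangoRaynaud.isCanonicallyAmple (TangoRaynaud.s_ne_zero (by omega) (by omega)) hl hle hlp
      (mt hcoeff.mp h)
  · exact TangoRaynaud.kodairaDim_eq_one hl hle hlp (hcoeff.mpr h)
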